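/- Notation. $\mathcal M(X)$ is the set of positive Borel measures on $X$ with finite mass and bounded support, $|\mu|=\mu(X)$, $|\mu-\nu|$ is the total variation of the signed measure $\mu-\nu$, $B(0,R)$ is the open ball of $\mathbb R^n$ with its Euclidean norm, $T\mathbb R^n=\mathbb R^n\times\mathbb R^n$ and $\pi_1(x,v)=x$. For measures $\mu,\nu$ of equal mass, $P(\mu,\nu)$ is the set of measures on the product with marginals $\mu,\nu$; for $\mu,\nu\in\mathcal M(\mathbb R^n)$ of equal mass, $W(\mu,\nu)=\min_{\pi\in P(\mu,\nu)}\int|x-y|\,d\pi$ and $P^{opt}(\mu,\nu)$ is the set of minimizers. Put $$W^g(\mu,\nu)=\inf\{|\mu-\tilde\mu|+|\nu-\tilde\nu|+W(\tilde\mu,\tilde\nu):\ \tilde\mu,\tilde\nu\in\mathcal M(\mathbb R^n),\ |\tilde\mu|=|\tilde\nu|\}.$$ For $U_1,U_2\in\mathcal M(T\mathbb R^n)$ with $\mu_i=\pi_1\#U_i$, let $\mathcal W^g(U_1,U_2)$ be the infimum of $\int|v-w|\,dp(x,v,y,w)$ over all $p\in P(\tilde U_1,\tilde U_2)$ with $\tilde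 U_i\le U_i$ such that, with $\tilde\mu_i=\pi_1\#\tilde U_i$, $W^g(\mu_1,\mu_2)=|\mu_1-\tilde\mu_1|+W(\tilde\mu_1,\tilde\mu_2)+|\mu_2-\tilde\mu_2|$ and the image of $p$ under $(x,v,y,w)\mapsto(x,y)$ is in $P^{opt}(\tilde\mu_1,\tilde\mu_2)$. Let $V:\mathcal M(\mathbb R^n)\to\mathcal M(T\mathbb R^n)$ be a probability vector field, i.e. $\pi_1\#V[\mu]=\mu$ for all $\mu$, and let $s:\mathcal M(\mathbb R^n)\to\mathcal M(\mathbb R^n)$. Let $T>0$. A solution on $[0,T]$ of $\dot\mu=V[\mu]\oplus s[\mu]$ is a $W^g$-continuous curve $\mu:[0,T]\to\mathcal M(\mathbb R^n)$ such that for every $f\in C_c^\infty(\mathbb R^n)$: $\nabla f(x)\cdot v$ is $V[\mu(t)]$-integrable for a.e. $t$; $t\mapsto\int f\,ds[\mu(t)]$ is in $L^1([0,T])$; $t\mapsto\int f\,d\mu(t)$ is absolutely continuous and, for a.e. $t\in[0,T]$, $$\frac{d}{dt}\int f\,d\mu(t)=\int\nabla f(x)\cdot v\,dV[\mu(t)](x,v)+\int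 f\,ds[\mu(t)].$$ For $N\ge1$ let $x_i$ be the points of $(\mathbb Z^n/N^2)\cap[-N,N]^n$, $v_j$ those of $(\mathbb Z^n/N)\cap[-N,N]^n$, $Q=[0,1/N^2)^n$, $Q'=[0,1/N)^n$ and $\mathcal A_N(\mu)=\sum_i\mu(x_i+Q)\delta_{x_i}$. The lattice approximate solution $\mu^N$ with initial datum $\mu_0$ is given by $m_0=\mathcal A_N(\mu_0)$, $m_{k+1}=\Phi_{1/N}(m_k)$ and $\mu^N(k/N+\tau)=\Phi_\tau(m_k)$ for $k\in\mathbb N$, $0\le\tau<1/N$, where $$\Phi_\tau(m)=\sum_{i,j}V[m]\big((x_i+Q)\times(v_j+Q')\big)\,\delta_{x_i+\tau v_j}+\tau\,\mathcal A_N(s[m]).$$ **Theorem.** Assume: - (V1) there is $C>0$ with $\sup_{(x,v)\in\mathrm{supp}\,V[\mu]}|v|\le C(1+\sup_{x\in\mathrm{supp}\,\mu}|x|)$ for all $\mu\in\mathcal M(\mathbb R^n)$; - (V2) for each $R>0$ there is $K>0$ such that $\mathcal W^g(V[\mu],V[\nu])\le K\,W^g(\mu,\nu)$ whenever $\mathrm{supp}\,\mu\cup\mathrm{supp}\,\nu\subset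 B(0,R)$; - (s1) there is $L\ge 0$ with $W^g(s[\mu],s[\nu])\le L\,W^g(\mu,\nu)$ for all $\mu,\nu$; - (s2) $R_0\in\mathbb R$ is such that $\mathrm{supp}\,s[\mu]\subset B(0,R_0)$ for all $\mu$. Then for every $T>0$ there is a map $S:[0,T]\times\mathcal M(\mathbb R^n)\to\mathcal M(\mathbb R^n)$ such that: 1. $S_0\mu=\mu$, and $S_{t+r}\mu=S_tS_r\mu$ whenever $t,r\ge0$, $t+r\le T$; 2. $t\mapsto S_t\mu$ is a solution on $[0,T]$ for every $\mu\in\mathcal M(\mathbb R^n)$; 3. for all $R,M>0$ there is $C>0$ such that, if $\mathrm{supp}\,\mu\cup\mathrm{supp}\,\nu\subset B(0,R)$ and $|\mu|+|\nu|\le M$, then for all $t,r\in[0,T]$: (a) $\mathrm{supp}(S_t\mu)\subset B(0,e^{Ct}(\max\{R,R_0\}+M+1))$; (b) $W^g(S_t\mu,S_t\nu)\le e^{Ct}W^g(\mu,\nu)$; (c) $W^g(S_t\mu,S_r\mu)\le C|t-r|$; 4. there is a sequence $N_1<N_2<\cdots$ such that, for every $\mu_0\in\mathcal M(\mathbb R^n)$,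 the lattice approximate solutions $\mu^{N_k}$ with initial datum $\mu_0$ satisfy $\sup_{t\in[0,T]}W^g(\mu^{N_k}(t),S_t\mu_0)\to0$. -/

import Mathlib

open MeasureTheory Set Filter Topology
open scoped ENNReal NNReal ContDiff

noncomputable section

namespace MDES

/-- `ℝⁿ` with the Euclidean norm. The tangent bundle `Tℝⁿ` is `E n × E n`, with points `(x, v)`. -/
abbrev E (n : ℕ) : Type := EuclideanSpace ℝ (Fin n)

/-- The space `𝓜(X)` of positive Borel measures on `X` with finite mass and bounded support. -/
@[ext]
structure BMeasure (X : Type*) [PseudoMetricSpace X] [MeasurableSpace X] where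
  toMeasure : Measure X
  finite : IsFiniteMeasure toMeasure
  bounded : Bornology.IsBounded toMeasure.support

section General

variable {X : Type*} [PseudoMetricSpace X] [MeasurableSpace X]

instance (μ : BMeasure X) : IsFiniteMeasure μ.toMeasure := μ.finite

/-- The support of a measure. -/
def BMeasure.supp (μ : BMeasure X) : Set X := μ.toMeasure.support

/-- The total mass `|μ| = μ(X)`. -/
def BMeasure.mass (μ : BMeasure X) : ℝ≥0∞ := μ.toMeasure univ

/-- `|μ - ν|`, the mass of the total variation of the signed measure `μ - ν`. -/
def tvDist (μ ν : BMeasure X) : ℝ≥0∞ :=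
  (μ.toMeasure.toSignedMeasure - ν.toMeasure.toSignedMeasure).totalVariation univ

/-- Transference plans `P(μ, ν)`: measures on the product with marginals `μ` and `ν`
(they have the common mass of `μ` and `ν`, and there are none if the masses differ). -/
def plans (μ ν : Measure X) : Set (Measure (X × X)) :=
  {π | π.map Prod.fst = μ ∧ π.map Prod.snd = ν}

/-- The transport cost `∫ |x - y| dπ(x, y)`. -/
def cost (π : Measure (X × X)) : ℝ≥0∞ := ∫⁻ z, edist z.1 z.2 ∂π

/-- The Wasserstein distance `W` with exponent `1`. -/
def wass (μ ν : BMeasure X) : ℝ≥0∞ := ⨅ π ∈ plans μ.toMeasure ν.toMeasure, cost π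

/-- The set `P^opt(μ, ν)` of optimal transference plans. -/
def optPlans (μ ν : BMeasure X) : Set (Measure (X × X)) :=
  {π | π ∈ plans μ.toMeasure ν.toMeasure ∧
    ∀ π' ∈ plans μ.toMeasure ν.toMeasure, cost π ≤ cost π'}

/-- The generalized Wasserstein distance `W^g`. -/
def gWass (μ ν : BMeasure X) : ℝ≥0∞ :=
  ⨅ (μ' : BMeasure X) (ν' : BMeasure X) (_ : μ'.mass = ν'.mass),
    tvDist μ μ' + tvDist ν ν' + wass μ' ν'

theorem isBounded_support {μ : Measure X} {B : Set X} (hB : Bornology.IsBounded B)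
    (h : μ Bᶜ = 0) : Bornology.IsBounded μ.support := by
  refine hB.closure.subset (Measure.support_subset_of_isClosed isClosed_closure ?_)
  exact measure_mono_null (compl_subset_compl.2 subset_closure) h

/-- The sum `μ + ν`. -/
def BMeasure.add (μ ν : BMeasure X) : BMeasure X where
  toMeasure := μ.toMeasure + ν.toMeasure
  finite := inferInstance
  bounded := by
    rw [Measure.support_add]
    exact μ.bounded.union ν.bounded

/-- The finite sum of Dirac masses `∑ i ∈ I, m i • δ_{x i}`. -/
def BMeasure.diracSum [MeasurableSingletonClass X] {ι : Type*} (I : Finset ι) (m : ι → ℝ≥0)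
    (x : ι → X) : BMeasure X where
  toMeasure := ∑ i ∈ I, m i • Measure.dirac (x i)
  finite := inferInstance
  bounded := by
    have hfin : (x '' (I : Set ι)).Finite := I.finite_toSet.image x
    refine isBounded_support (B := x '' (I : Set ι)) hfin.isBounded ?_
    rw [Measure.finsetSum_apply]
    refine Finset.sum_eq_zero fun i hi => ?_
    have hx : x i ∈ x '' (I : Set ι) := mem_image_of_mem x hi
    rw [Measure.smul_apply, Measure.dirac_apply' _ hfin.measurableSet.compl]
    simp [hx]

end General

/-- The projection `π₁ # U` on the base space of a measure `U` on the tangent bundle. -/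
def base {n : ℕ} (U : BMeasure (E n × E n)) : BMeasure (E n) where
  toMeasure := U.toMeasure.map Prod.fst
  finite := inferInstance
  bounded := by
    have hc : IsCompact (closure U.toMeasure.support) := U.bounded.isCompact_closure
    have hK : IsCompact (Prod.fst '' closure U.toMeasure.support) := hc.image continuous_fst
    refine isBounded_support (B := Prod.fst '' closure U.toMeasure.support) hK.isBounded ?_
    rw [Measure.map_apply measurable_fst hK.isClosed.measurableSet.compl]
    have hsub : Prod.fst ⁻¹' (Prod.fst '' closure U.toMeasure.support)ᶜ ⊆ U.toMeasure.supportᶜ :=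
      fun p hp hp' => hp (mem_image_of_mem _ (subset_closure hp'))
    exact measure_mono_null hsub Measure.measure_compl_support

/-- The admissible plans in the definition of `𝒲^g(U₁, U₂)`: measures `p` on `Tℝⁿ × Tℝⁿ` whose
marginals are some `U₁' ≤ U₁` and `U₂' ≤ U₂` such that the projections of `U₁'` and `U₂'` realize
`W^g` between the projections of `U₁` and `U₂`, and such that the image of `p` under
`(x, v, y, w) ↦ (x, y)` is optimal between these two projections. -/
def admissible {n : ℕ} (U₁ U₂ : BMeasure (E n × E n)) :
    Set (Measure ((E n × E n) × (E n × E n))) :=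
  {p | ∃ U₁' U₂' : BMeasure (E n × E n),
    U₁'.toMeasure ≤ U₁.toMeasure ∧ U₂'.toMeasure ≤ U₂.toMeasure ∧
    p ∈ plans U₁'.toMeasure U₂'.toMeasure ∧
    gWass (base U₁) (base U₂) =
      tvDist (base U₁) (base U₁') + wass (base U₁') (base U₂') + tvDist (base U₂) (base U₂') ∧
    p.map (fun z => (z.1.1, z.2.1)) ∈ optPlans (base U₁') (base U₂')}

/-- The operator `𝒲^g`: the infimum of `∫ |v - w| dp(x, v, y, w)` over admissible `p`. -/
def fiberWass {n : ℕ} (U₁ U₂ : BMeasure (E n × E n)) : ℝ≥0∞ :=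
  ⨅ p ∈ admissible U₁ U₂, ∫⁻ z, edist z.1.2 z.2.2 ∂p

/-- `V` is a probability vector field: `π₁ # V[μ] = μ`. -/
def IsPVF {n : ℕ} (V : BMeasure (E n) → BMeasure (E n × E n)) : Prop :=
  ∀ μ, base (V μ) = μ

/-- Support sublinearity (V1). The supremum is over a bounded set of norms; if `μ = 0` and
`π₁ # V[μ] = μ` then `V[μ] = 0` and the condition is void. -/
def SupportSublinear {n : ℕ} (V : BMeasure (E n) → BMeasure (E n × E n)) : Prop :=
  ∃ C : ℝ, 0 < C ∧ ∀ μ, ∀ p ∈ (V μ).supp, ‖p.2‖ ≤ C * (1 + sSup ((fun x => ‖x‖) '' μ.supp))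

/-- Local Lipschitz continuity (V2) of `V` from `W^g` to `𝒲^g`. -/
def LocallyLipschitzPVF {n : ℕ} (V : BMeasure (E n) → BMeasure (E n × E n)) : Prop :=
  ∀ R : ℝ, 0 < R → ∃ K : ℝ≥0, 0 < K ∧ ∀ μ ν : BMeasure (E n),
    μ.supp ∪ ν.supp ⊆ Metric.ball 0 R → fiberWass (V μ) (V ν) ≤ K * gWass μ ν

/-- Lipschitz continuity (s1) of the source with respect to `W^g`. -/
def LipschitzSource {n : ℕ} (s : BMeasure (E n) → BMeasure (E n)) : Prop :=
  ∃ L : ℝ≥0, ∀ μ ν, gWass (s μ) (s ν) ≤ L * gWass μ ν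

/-- `μ : [0, T] → 𝓜(ℝⁿ)` is a (weak) solution of `dμ/dt = V[μ] ⊕ s[μ]`.
Only the values of `μ` on `[0, T]` matter; `fderiv ℝ f x v` is `∇f(x) · v`. -/
structure IsSolution {n : ℕ} (V : BMeasure (E n) → BMeasure (E n × E n))
    (s : BMeasure (E n) → BMeasure (E n)) (T : ℝ) (μ : ℝ → BMeasure (E n)) : Prop where
  continuous : ∀ t₀ ∈ Icc 0 T, Tendsto (fun t => gWass (μ t) (μ t₀)) (𝓝[Icc 0 T] t₀) (𝓝 0)
  transport_defined : ∀ f : E n → ℝ, ContDiff ℝ ∞ f → HasCompactSupport f →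
    ∀ᵐ t ∂volume.restrict (Icc 0 T),
      Integrable (fun p : E n × E n => fderiv ℝ f p.1 p.2) (V (μ t)).toMeasure
  source_integrable : ∀ f : E n → ℝ, ContDiff ℝ ∞ f → HasCompactSupport f →
    IntegrableOn (fun t => ∫ x, f x ∂(s (μ t)).toMeasure) (Icc 0 T)
  absolutely_continuous : ∀ f : E n → ℝ, ContDiff ℝ ∞ f → HasCompactSupport f →
    AbsolutelyContinuousOnInterval (fun t => ∫ x, f x ∂(μ t).toMeasure) 0 T
  weak_equation : ∀ f : E n → ℝ, ContDiff ℝ ∞ f → HasCompactSupport f →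
    ∀ᵐ t ∂volume.restrict (Icc 0 T),
      HasDerivAt (fun t => ∫ x, f x ∂(μ t).toMeasure)
        ((∫ p : E n × E n, fderiv ℝ f p.1 p.2 ∂(V (μ t)).toMeasure)
          + ∫ x, f x ∂(s (μ t)).toMeasure) t

/-- `S : [0, T] × 𝓜(ℝⁿ) → 𝓜(ℝⁿ)` is a Lipschitz semigroup of solutions, for a source whose values
are supported in the ball of radius `R₀` (this mass appears at once, whence the `max R R₀`).
Only the values of `S` on `[0, T]` matter. -/
structure IsLipschitzSemigroup {n : ℕ} (V : BMeasure (E n) → BMeasure (E n × E n))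
    (s : BMeasure (E n) → BMeasure (E n)) (R₀ T : ℝ)
    (S : ℝ → BMeasure (E n) → BMeasure (E n)) : Prop where
  zero : ∀ μ, S 0 μ = μ
  add : ∀ t r : ℝ, 0 ≤ t → 0 ≤ r → t + r ≤ T → ∀ μ, S (t + r) μ = S t (S r μ)
  solution : ∀ μ, IsSolution V s T (fun t => S t μ)
  bounds : ∀ R M : ℝ, 0 < R → 0 < M → ∃ C : ℝ, 0 < C ∧ ∀ μ ν : BMeasure (E n),
    μ.supp ∪ ν.supp ⊆ Metric.ball 0 R → μ.mass + ν.mass ≤ ENNReal.ofReal M →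
      (∀ t ∈ Icc 0 T, (S t μ).supp ⊆ Metric.ball 0 (Real.exp (C * t) * (max R R₀ + M + 1))) ∧
      (∀ t ∈ Icc 0 T, gWass (S t μ) (S t ν) ≤ ENNReal.ofReal (Real.exp (C * t)) * gWass μ ν) ∧
      (∀ t ∈ Icc 0 T, ∀ r ∈ Icc 0 T, gWass (S t μ) (S r μ) ≤ ENNReal.ofReal (C * |t - r|))

/-- The point `h z` of the grid `h ℤⁿ`. -/
def gridPoint {n : ℕ} (h : ℝ) (z : Fin n → ℤ) : E n := WithLp.toLp 2 (fun i => h * (z i : ℝ))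

/-- The half-open cube `h z + [0, h)ⁿ`. -/
def gridCell {n : ℕ} (h : ℝ) (z : Fin n → ℤ) : Set (E n) :=
  {x | ∀ i, h * (z i : ℝ) ≤ x i ∧ x i < h * (z i : ℝ) + h}

/-- The integer vectors with all coordinates in `[-m, m]`. With `m = N³` and mesh `1/N²` they
index `(ℤⁿ/N²) ∩ [-N, N]ⁿ`; with `m = N²` and mesh `1/N` they index `(ℤⁿ/N) ∩ [-N, N]ⁿ`. -/
def gridIndex (n m : ℕ) : Finset (Fin n → ℤ) :=
  Finset.Icc (fun _ => -(m : ℤ)) (fun _ => (m : ℤ))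

/-- The space mesh `1/N²`. -/
def meshX (N : ℕ) : ℝ := 1 / (N : ℝ) ^ 2

/-- The velocity mesh `1/N`, which is also the time step. -/
def meshV (N : ℕ) : ℝ := 1 / (N : ℝ)

/-- `c • 𝒜ˣ_N(μ) = c ∑ᵢ μ(xᵢ + Q) δ_{xᵢ}`. -/
def discretize {n : ℕ} (N : ℕ) (c : ℝ≥0) (μ : BMeasure (E n)) : BMeasure (E n) :=
  BMeasure.diracSum (gridIndex n (N ^ 3))
    (fun z => c * (μ.toMeasure (gridCell (meshX N) z)).toNNReal) (gridPoint (meshX N))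

/-- `∑ᵢⱼ U((xᵢ + Q) × (vⱼ + Q')) δ_{xᵢ + τ vⱼ}`. -/
def latticeTransport {n : ℕ} (N : ℕ) (τ : ℝ) (U : BMeasure (E n × E n)) : BMeasure (E n) :=
  BMeasure.diracSum (gridIndex n (N ^ 3) ×ˢ gridIndex n (N ^ 2))
    (fun q => (U.toMeasure (gridCell (meshX N) q.1 ×ˢ gridCell (meshV N) q.2)).toNNReal)
    (fun q => gridPoint (meshX N) q.1 + τ • gridPoint (meshV N) q.2)

/-- An explicit Euler step of length `τ ≥ 0` of the lattice scheme. -/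
def eulerStep {n : ℕ} (V : BMeasure (E n) → BMeasure (E n × E n))
    (s : BMeasure (E n) → BMeasure (E n)) (N : ℕ) (τ : ℝ) (μ : BMeasure (E n)) :
    BMeasure (E n) :=
  (latticeTransport N τ (V μ)).add (discretize N τ.toNNReal (s μ))

/-- The values `μᴺ(k/N)` of the lattice approximate solution with initial datum `μ₀`. -/
def latticeNode {n : ℕ} (V : BMeasure (E n) → BMeasure (E n × E n))
    (s : BMeasure (E n) → BMeasure (E n)) (N : ℕ) (μ₀ : BMeasure (E n)) : ℕ → BMeasure (E n)
  | 0 => discretize N 1 μ₀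
  | k + 1 => eulerStep V s N (meshV N) (latticeNode V s N μ₀ k)

/-- The lattice approximate solution `μᴺ(k/N + τ)`, `0 ≤ τ < 1/N`. -/
def latticeSolution {n : ℕ} (V : BMeasure (E n) → BMeasure (E n × E n))
    (s : BMeasure (E n) → BMeasure (E n)) (N : ℕ) (μ₀ : BMeasure (E n)) (t : ℝ) :
    BMeasure (E n) :=
  eulerStep V s N (t - (⌊t * N⌋₊ : ℝ) / N) (latticeNode V s N μ₀ ⌊t * N⌋₊)

/-- `S` is the limit, uniformly in time for `W^g`, of the lattice approximate solutions along one
sequence `N = φ k → ∞`, the same for all initial data. -/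
def IsLatticeLimit {n : ℕ} (V : BMeasure (E n) → BMeasure (E n × E n))
    (s : BMeasure (E n) → BMeasure (E n)) (T : ℝ)
    (S : ℝ → BMeasure (E n) → BMeasure (E n)) : Prop :=
  ∃ φ : ℕ → ℕ, StrictMono φ ∧ ∀ μ₀ : BMeasure (E n),
    Tendsto (fun k => ⨆ t ∈ Icc 0 T, gWass (latticeSolution V s (φ k) μ₀ t) (S t μ₀))
      atTop (𝓝 0)

end MDES

end

/-! The solution semigroup is the limit of an explicit Euler scheme, obtained by stability and
compactness for the metric W^g. The working form of W^g is the infimum of |μ| + |ν| - 2|π| + ∫|x-y|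
dπ over subplans π, i.e. measures whose marginals lie below μ and ν (`gdist_le_of_subplan`,
`exists_subplan_of_gdist`). Subplans can be cut, glued, added and pushed forward, and this yields
the metric axioms and all the Lipschitz bounds. Sets of measures with bounded mass in a fixed ball
are compact (`isCompact_massBall`).

Stability: (V2) supplies a single plan that attains W^g on the base and has fibre cost at most K W^g
+ ε (`exists_lipschitz_plan`). Moved by x + τv, it shows that the step without lattice is Lipschitz
with constant 1 + O(τ) (`dist_freeStep_le`). The time step and the velocity mesh are 1/N and the
space mesh is 1/N², so rounding costs O(1/N²) per step (`dist_eulerStep_freeStep_le`), hence O(1/N)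
on [0,T]. A discrete Gronwall argument then bounds mass, support, dependence on the datum and
dependence on time, uniformly in N up to O(1/N) (`exists_invariant`, `exists_schemeBounds`).

Existence: a diagonal extraction over countable dense sets of data and times, extended by these
equi-Lipschitz bounds, gives one subsequence for all data and times (`exists_subseq_tendsto`). The
semigroup law needs no uniqueness: iterates of the scheme compose exactly, up to one step lost to
integer parts, and stability in the datum allows a restart from the limit (`semigroup`).

Equation: the right-hand side of the weak equation is Lipschitz in μ (`abs_weakRHS_sub_le`) and one
free step agrees with it up to O(τ²) (`abs_integral_freeStep_sub_le`). Summed over the steps and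
passed to the limit, this is an expansion of S at time 0 with error O(t²), uniform over bounded data
(`exists_expansion`). The semigroup law moves it to any time, which gives the derivative at every
interior point of [0,T]. -/

noncomputable section

namespace MDES

/-! ### Parts of measures and of plans -/

section Subplans

variable {X : Type*} [MeasurableSpace X]

/-- Subtraction of measures is truncated, so `μ - ν` and `ν - μ` are the two Jordan parts of the
signed difference; their masses differ by its net mass. -/
theorem real_univ_sub_sub (μ ν : Measure X) [IsFiniteMeasure μ] [IsFiniteMeasure ν] :
    (μ - ν).real univ - (ν - μ).real univ = μ.real univ - ν.real univ := by
  have h := congrArg (fun s => s univ) (Measure.sub_toSignedMeasure_eq_toSignedMeasure_sub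
    (μ := μ) (ν := ν))
  simpa [Measure.toSignedMeasure_apply_measurable MeasurableSet.univ] using h.symm

theorem real_univ_sub_of_le {μ ν : Measure X} [IsFiniteMeasure μ] [IsFiniteMeasure ν]
    (h : ν ≤ μ) : (μ - ν).real univ = μ.real univ - ν.real univ := by
  have := real_univ_sub_sub μ ν
  rw [Measure.sub_eq_zero_of_le h] at this
  simpa using this

/-- For finite measures, `μ - (μ - ν)` is the common part of `μ` and `ν`. Plans are trimmed below to
marginals of this form. -/
theorem sub_sub_le (μ ν : Measure X) [IsFiniteMeasure μ] [IsFiniteMeasure ν] :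
    μ - (μ - ν) ≤ ν := by
  refine Measure.sub_le_of_le_add ?_
  rw [add_comm]
  exact Measure.sub_le_iff_le_add.1 le_rfl

theorem real_mono_of_le {μ ν : Measure X} [IsFiniteMeasure ν] (h : μ ≤ ν) (s : Set X) :
    μ.real s ≤ ν.real s :=
  ENNReal.toReal_mono (measure_ne_top ν s) (h s)

theorem map_mono_of_le {Y : Type*} [MeasurableSpace Y] {μ ν : Measure X} (h : μ ≤ ν)
    {f : X → Y} (hf : Measurable f) : μ.map f ≤ ν.map f :=
  Measure.map_mono h hf

theorem real_univ_map {Y : Type*} [MeasurableSpace Y] (μ : Measure X) {f : X → Y}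
    (hf : Measurable f) : (μ.map f).real univ = μ.real univ := by
  simp [measureReal_def, Measure.map_apply hf MeasurableSet.univ]

/-- A measure on the product can be cut down to one with a given smaller first marginal. -/
theorem exists_le_map_fst_eq {Y : Type*} [MeasurableSpace Y] (π : Measure (X × Y))
    [IsFiniteMeasure π] {σ : Measure X} (hσ : σ ≤ π.map Prod.fst) :
    ∃ π' ≤ π, π'.map Prod.fst = σ := by
  have hfin : IsFiniteMeasure σ := isFiniteMeasure_of_le _ hσ
  set μ := π.map Prod.fst with hμ
  have hm : Measurable (σ.rnDeriv μ) := Measure.measurable_rnDeriv σ μ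
  -- Thin out `π` by the density of `σ` with respect to its first marginal; the density is at most 1
  -- because `σ` lies below that marginal.
  refine ⟨π.withDensity (fun z => σ.rnDeriv μ z.1), ?_, ?_⟩
  · have h1 : ∀ᵐ z ∂π, σ.rnDeriv μ z.1 ≤ 1 := by
      have := Measure.rnDeriv_le_one_of_le hσ
      exact ae_of_ae_map measurable_fst.aemeasurable this
    calc _ ≤ π.withDensity 1 := withDensity_mono h1
      _ = π := withDensity_one
  · ext s hs
    rw [Measure.map_apply measurable_fst hs, withDensity_apply _ (measurable_fst hs),
      ← setLIntegral_map hs hm measurable_fst, ← hμ]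
    exact Measure.setLIntegral_rnDeriv (Measure.absolutelyContinuous_of_le hσ) s

theorem exists_le_map_snd_eq {Y : Type*} [MeasurableSpace Y] (π : Measure (X × Y))
    [IsFiniteMeasure π] {σ : Measure Y} (hσ : σ ≤ π.map Prod.snd) :
    ∃ π' ≤ π, π'.map Prod.snd = σ := by
  have h : (π.map Prod.swap).map Prod.fst = π.map Prod.snd := by
    rw [Measure.map_map measurable_fst measurable_swap]; rfl
  obtain ⟨ρ, hρ, hρ'⟩ := exists_le_map_fst_eq (π.map Prod.swap) (h ▸ hσ)
  refine ⟨ρ.map Prod.swap, ?_, ?_⟩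
  · refine (map_mono_of_le hρ measurable_swap).trans_eq ?_
    rw [Measure.map_map measurable_swap measurable_swap]
    simp
  · rw [Measure.map_map measurable_snd measurable_swap]
    exact hρ'

open ProbabilityTheory in
/-- Gluing of two plans along a common marginal. -/
theorem exists_glue {Z : Type*} [MeasurableSpace Z] [StandardBorelSpace X] [Nonempty X]
    [StandardBorelSpace Z] [Nonempty Z] {Y : Type*} [MeasurableSpace Y]
    (π : Measure (X × Y)) (ρ : Measure (Y × Z))
    [IsFiniteMeasure π] [IsFiniteMeasure ρ] (h : π.map Prod.snd = ρ.map Prod.fst) :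
    ∃ Θ : Measure (Y × X × Z), Θ.map (fun z => (z.2.1, z.1)) = π ∧
      Θ.map (fun z => (z.1, z.2.2)) = ρ := by
  set π' := π.map Prod.swap with hπ'
  set σ := ρ.map Prod.fst with hσ
  have h1 : σ ⊗ₘ π'.condKernel = π' := by
    have : σ = π'.fst := by
      rw [← h, Measure.fst, hπ', Measure.map_map measurable_fst measurable_swap]; rfl
    rw [this]
    exact Measure.IsCondKernel.disintegrate
  have h2 : σ ⊗ₘ ρ.condKernel = ρ := Measure.IsCondKernel.disintegrate
  -- The two outer coordinates are taken conditionally independent given the shared one.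
  refine ⟨σ ⊗ₘ (π'.condKernel ×ₖ ρ.condKernel), ?_, ?_⟩
  · have h3 : π = π'.map Prod.swap := by
      rw [hπ', Measure.map_map measurable_swap measurable_swap]; simp
    conv_rhs => rw [h3, ← h1]
    ext s hs
    have hf : Measurable (fun z : Y × X × Z => (z.2.1, z.1)) := by fun_prop
    rw [Measure.map_apply hf hs, Measure.map_apply measurable_swap hs,
      Measure.compProd_apply (hf hs), Measure.compProd_apply (measurable_swap hs)]
    refine lintegral_congr fun a => ?_
    rw [Kernel.prod_apply]
    have : Prod.mk a ⁻¹' ((fun z : Y × X × Z => (z.2.1, z.1)) ⁻¹' s)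
      = (Prod.mk a ⁻¹' (Prod.swap ⁻¹' s)) ×ˢ univ := by ext; simp
    rw [this, Measure.prod_prod]; simp
  · conv_rhs => rw [← h2]
    ext s hs
    have hf : Measurable (fun z : Y × X × Z => (z.1, z.2.2)) := by fun_prop
    rw [Measure.map_apply hf hs,
      Measure.compProd_apply (hf hs), Measure.compProd_apply hs]
    refine lintegral_congr fun a => ?_
    rw [Kernel.prod_apply]
    have : Prod.mk a ⁻¹' ((fun z : Y × X × Z => (z.1, z.2.2)) ⁻¹' s)
      = univ ×ˢ (Prod.mk a ⁻¹' s) := by ext; simp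
    rw [this, Measure.prod_prod]; simp

end Subplans

/-! ### The distance W^g expressed by plans between parts -/

/-- The total mass as a real number. -/
def BMeasure.rmass {X : Type*} [PseudoMetricSpace X] [MeasurableSpace X] (μ : BMeasure X) : ℝ :=
  μ.toMeasure.real univ

section General

variable {X : Type*} [PseudoMetricSpace X] [MeasurableSpace X]

theorem BMeasure.rmass_nonneg (μ : BMeasure X) : 0 ≤ μ.rmass := measureReal_nonneg

theorem BMeasure.mass_eq (μ : BMeasure X) : μ.mass = ENNReal.ofReal μ.rmass :=
  (ENNReal.ofReal_toReal (measure_ne_top _ _)).symm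

/-- A measure dominated by one with bounded support. -/
def BMeasure.ofLE (μ : BMeasure X) {m : Measure X} (h : m ≤ μ.toMeasure) : BMeasure X where
  toMeasure := m
  finite := isFiniteMeasure_of_le _ h
  bounded := μ.bounded.subset (Measure.support_mono h)

theorem tvDist_eq (μ ν : BMeasure X) : tvDist μ ν =
    ENNReal.ofReal ((μ.toMeasure - ν.toMeasure).real univ
      + (ν.toMeasure - μ.toMeasure).real univ) := by
  rw [tvDist, SignedMeasure.totalVariation, Measure.toJordanDecomposition_toSignedMeasure_sub,
    Measure.jordanDecompositionOfToSignedMeasureSub_posPart,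
    Measure.jordanDecompositionOfToSignedMeasureSub_negPart, Measure.add_apply,
    ENNReal.ofReal_add measureReal_nonneg measureReal_nonneg]
  simp [measureReal_def]

/-- `W^g` is bounded by the cost of a plan between parts of the two measures, plus the mass that
is not moved. -/
theorem gWass_le_of_subplan {μ ν : BMeasure X} {π : Measure (X × X)}
    (h₁ : π.map Prod.fst ≤ μ.toMeasure) (h₂ : π.map Prod.snd ≤ ν.toMeasure)
    {c : ℝ} (hc : 0 ≤ c) (hπ : cost π ≤ ENNReal.ofReal c) :
    gWass μ ν ≤ ENNReal.ofReal (μ.rmass + ν.rmass - 2 * π.real univ + c) := by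
  have f₁ : IsFiniteMeasure (π.map Prod.fst) := isFiniteMeasure_of_le _ h₁
  have f₂ : IsFiniteMeasure (π.map Prod.snd) := isFiniteMeasure_of_le _ h₂
  have m₁ := real_univ_sub_of_le h₁
  have m₂ := real_univ_sub_of_le h₂
  rw [real_univ_map π measurable_fst] at m₁
  rw [real_univ_map π measurable_snd] at m₂
  have hm : (μ.ofLE h₁).mass = (ν.ofLE h₂).mass := by
    simp [BMeasure.ofLE, BMeasure.mass, Measure.map_apply, measurable_fst, measurable_snd]
  refine (iInf_le_of_le (μ.ofLE h₁) (iInf_le_of_le (ν.ofLE h₂) (iInf_le _ hm))).trans ?_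
  have hw : wass (μ.ofLE h₁) (ν.ofLE h₂) ≤ ENNReal.ofReal c :=
    (iInf₂_le π ⟨rfl, rfl⟩).trans hπ
  have a₁ : 0 ≤ (μ.toMeasure - π.map Prod.fst).real univ := measureReal_nonneg
  have a₂ : 0 ≤ (ν.toMeasure - π.map Prod.snd).real univ := measureReal_nonneg
  have t₁ : tvDist μ (μ.ofLE h₁) = ENNReal.ofReal (μ.rmass - π.real univ) := by
    rw [tvDist_eq]
    simp only [BMeasure.ofLE, Measure.sub_eq_zero_of_le h₁, m₁, BMeasure.rmass]
    simp
  have t₂ : tvDist ν (ν.ofLE h₂) = ENNReal.ofReal (ν.rmass - π.real univ) := by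
    rw [tvDist_eq]
    simp only [BMeasure.ofLE, Measure.sub_eq_zero_of_le h₂, m₂, BMeasure.rmass]
    simp
  rw [m₁] at a₁
  rw [m₂] at a₂
  change 0 ≤ μ.rmass - π.real univ at a₁
  change 0 ≤ ν.rmass - π.real univ at a₂
  rw [t₁, t₂]
  refine (add_le_add le_rfl hw).trans_eq ?_
  rw [← ENNReal.ofReal_add a₁ a₂, ← ENNReal.ofReal_add (add_nonneg a₁ a₂) hc]
  congr 1
  ring

theorem gWass_ne_top (μ ν : BMeasure X) : gWass μ ν ≠ ⊤ := by
  -- The zero plan: nothing is moved and all mass is discarded.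
  have h := gWass_le_of_subplan (μ := μ) (ν := ν) (π := 0) (c := 0)
    (by simp [Measure.zero_le]) (by simp [Measure.zero_le]) le_rfl (by simp [cost])
  exact ne_top_of_le_ne_top ENNReal.ofReal_ne_top h

/-- `W^g` as a real number. -/
def gdist (μ ν : BMeasure X) : ℝ := (gWass μ ν).toReal

theorem gdist_nonneg (μ ν : BMeasure X) : 0 ≤ gdist μ ν := ENNReal.toReal_nonneg

theorem gWass_eq (μ ν : BMeasure X) : gWass μ ν = ENNReal.ofReal (gdist μ ν) :=
  (ENNReal.ofReal_toReal (gWass_ne_top μ ν)).symm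

theorem gdist_le_of_subplan {μ ν : BMeasure X} {π : Measure (X × X)}
    (h₁ : π.map Prod.fst ≤ μ.toMeasure) (h₂ : π.map Prod.snd ≤ ν.toMeasure)
    {c : ℝ} (hc : 0 ≤ c) (hπ : cost π ≤ ENNReal.ofReal c) :
    gdist μ ν ≤ μ.rmass + ν.rmass - 2 * π.real univ + c := by
  have m₁ := real_mono_of_le h₁ univ
  have m₂ := real_mono_of_le h₂ univ
  rw [real_univ_map π measurable_fst] at m₁
  rw [real_univ_map π measurable_snd] at m₂
  refine ENNReal.toReal_le_of_le_ofReal ?_ (gWass_le_of_subplan h₁ h₂ hc hπ)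
  simp only [BMeasure.rmass]
  linarith

theorem cost_mono {π π' : Measure (X × X)} (h : π' ≤ π) : cost π' ≤ cost π :=
  lintegral_mono' h le_rfl

/-- `W^g` is approximated by plans between parts of the two measures. -/
theorem exists_subplan_of_gdist (μ ν : BMeasure X) {ε : ℝ} (hε : 0 < ε) :
    ∃ (π : Measure (X × X)) (c : ℝ), IsFiniteMeasure π ∧ π.map Prod.fst ≤ μ.toMeasure ∧
      π.map Prod.snd ≤ ν.toMeasure ∧ 0 ≤ c ∧ cost π ≤ ENNReal.ofReal c ∧
      μ.rmass + ν.rmass - 2 * π.real univ + c ≤ gdist μ ν + ε := by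
  have hlt : gWass μ ν < ENNReal.ofReal (gdist μ ν + ε) := by
    rw [gWass_eq]
    exact (ENNReal.ofReal_lt_ofReal_iff (by linarith [gdist_nonneg μ ν])).2 (by linarith)
  obtain ⟨μ', hμ'⟩ := iInf_lt_iff.1 hlt
  obtain ⟨ν', hν'⟩ := iInf_lt_iff.1 hμ'
  obtain ⟨-, h⟩ := iInf_lt_iff.1 hν'
  have hw : wass μ' ν' ≠ ⊤ := ne_top_of_lt ((le_add_self).trans_lt h)
  set A := (μ.toMeasure - μ'.toMeasure).real univ
  set B := (μ'.toMeasure - μ.toMeasure).real univ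
  set A' := (ν.toMeasure - ν'.toMeasure).real univ
  set B' := (ν'.toMeasure - ν.toMeasure).real univ
  have hA : 0 ≤ A := measureReal_nonneg
  have hB : 0 ≤ B := measureReal_nonneg
  have hA' : 0 ≤ A' := measureReal_nonneg
  have hB' : 0 ≤ B' := measureReal_nonneg
  have hABs : 0 ≤ A + B + (A' + B') := add_nonneg (add_nonneg hA hB) (add_nonneg hA' hB')
  rw [tvDist_eq, tvDist_eq,
    ← ENNReal.ofReal_add (add_nonneg hA hB) (add_nonneg hA' hB')] at h
  have hw2 : wass μ' ν' < ENNReal.ofReal (gdist μ ν + ε - (A + B + (A' + B'))) := by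
    rw [ENNReal.ofReal_sub _ hABs]
    exact lt_tsub_iff_left.2 h
  obtain ⟨π, hπ⟩ := iInf_lt_iff.1 hw2
  obtain ⟨⟨hπ₁, hπ₂⟩, hπc⟩ := iInf_lt_iff.1 hπ
  have fπ : IsFiniteMeasure π := by
    refine ⟨?_⟩
    have : (π.map Prod.fst) univ < ⊤ := by rw [hπ₁]; exact measure_lt_top _ _
    rwa [Measure.map_apply measurable_fst MeasurableSet.univ, preimage_univ] at this
  have mπ₁ : π.real univ = μ'.rmass := by
    rw [← real_univ_map π measurable_fst, hπ₁]; rfl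
  have mπ₂ : π.real univ = ν'.rmass := by
    rw [← real_univ_map π measurable_snd, hπ₂]; rfl
  -- The competitors `μ'`, `ν'` need not lie below `μ`, `ν`, so `π` is trimmed, first to the common
  -- part of `μ'` and `μ`, then to a second marginal below `ν`. At most `B + B'` of its mass is
  -- lost, and twice this loss is already paid for: `|μ| - |μ'| + 2B = A + B`, and likewise for `ν`.
  obtain ⟨π₁, hle₁, hfst⟩ := exists_le_map_fst_eq π
    (σ := μ'.toMeasure - (μ'.toMeasure - μ.toMeasure)) (by rw [hπ₁]; exact Measure.sub_le)
  have fπ₁ : IsFiniteMeasure π₁ := isFiniteMeasure_of_le _ hle₁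
  have m₁ : π₁.real univ = μ'.rmass - B := by
    rw [← real_univ_map π₁ measurable_fst, hfst, real_univ_sub_of_le Measure.sub_le]; rfl
  obtain ⟨π₂, hle₂, hsnd⟩ := exists_le_map_snd_eq π₁
    (σ := π₁.map Prod.snd - (π₁.map Prod.snd - ν.toMeasure)) Measure.sub_le
  have m₂ : π₂.real univ = π₁.real univ - (π₁.map Prod.snd - ν.toMeasure).real univ := by
    rw [← real_univ_map π₂ measurable_snd, hsnd, real_univ_sub_of_le Measure.sub_le,
      real_univ_map π₁ measurable_snd]
  have hBB : (π₁.map Prod.snd - ν.toMeasure).real univ ≤ B' := by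
    refine real_mono_of_le (Measure.sub_le_of_le_add ?_) univ
    refine (map_mono_of_le hle₁ measurable_snd).trans ?_
    rw [hπ₂]
    exact Measure.sub_le_iff_le_add.1 le_rfl
  have e₁ := real_univ_sub_sub μ.toMeasure μ'.toMeasure
  have e₂ := real_univ_sub_sub ν.toMeasure ν'.toMeasure
  have hpos : 0 < gdist μ ν + ε - (A + B + (A' + B')) := by
    by_contra hcon
    rw [ENNReal.ofReal_of_nonpos (not_lt.1 hcon)] at hw2
    exact not_lt_zero hw2
  refine ⟨π₂, gdist μ ν + ε - (A + B + (A' + B')), isFiniteMeasure_of_le _ hle₂, ?_, ?_,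
    hpos.le, (cost_mono (hle₂.trans hle₁)).trans hπc.le, ?_⟩
  · refine (map_mono_of_le hle₂ measurable_fst).trans ?_
    rw [hfst]
    exact sub_sub_le _ _
  · rw [hsnd]
    exact sub_sub_le _ _
  · simp only [BMeasure.rmass] at *
    linarith

/-- Integrals along a plan between parts of two measures. -/
theorem abs_integral_sub_integral_le {Y : Type*} [MeasurableSpace Y] {U₁ U₂ : Measure Y}
    [IsFiniteMeasure U₁] [IsFiniteMeasure U₂] {p : Measure (Y × Y)}
    (h₁ : p.map Prod.fst ≤ U₁) (h₂ : p.map Prod.snd ≤ U₂) {h : Y → ℝ} (hm : Measurable h)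
    {A c : ℝ} (hA₁ : ∀ᵐ y ∂U₁, |h y| ≤ A) (hA₂ : ∀ᵐ y ∂U₂, |h y| ≤ A) (hc : 0 ≤ c)
    (hp : ∫⁻ z, edist (h z.1) (h z.2) ∂p ≤ ENNReal.ofReal c) :
    |∫ y, h y ∂U₁ - ∫ y, h y ∂U₂| ≤ A * (U₁.real univ + U₂.real univ - 2 * p.real univ) + c := by
  have key : ∀ (U : Measure Y) [IsFiniteMeasure U] (f : Y × Y → Y), Measurable f → p.map f ≤ U →
      (∀ᵐ y ∂U, |h y| ≤ A) → Integrable (fun z => h (f z)) p ∧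
        |∫ y, h y ∂U - ∫ z, h (f z) ∂p| ≤ A * (U.real univ - p.real univ) := by
    intro U _ f hf hle hA
    have f₁ : IsFiniteMeasure (p.map f) := isFiniteMeasure_of_le _ hle
    have hi : Integrable h U := Integrable.of_bound hm.aestronglyMeasurable A hA
    have hi₁ : Integrable h (p.map f) := hi.mono_measure hle
    have hi₂ : Integrable h (U - p.map f) := hi.mono_measure Measure.sub_le
    have hI : Integrable (fun z => h (f z)) p := hi₁.comp_measurable hf
    refine ⟨hI, ?_⟩
    -- Only the part of `U` not reached by `p` is estimated by the sup bound.
    have e : ∫ y, h y ∂U = ∫ y, h y ∂(U - p.map f) + ∫ z, h (f z) ∂p := by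
      conv_lhs => rw [← Measure.sub_add_cancel_of_le hle]
      rw [integral_add_measure hi₂ hi₁, integral_map hf.aemeasurable hm.aestronglyMeasurable]
    rw [e, add_sub_cancel_right]
    have hA' : ∀ᵐ y ∂(U - p.map f), ‖h y‖ ≤ A :=
      (Measure.absolutelyContinuous_of_le Measure.sub_le).ae_le hA
    have := norm_integral_le_of_norm_le_const hA'
    rwa [Real.norm_eq_abs, real_univ_sub_of_le hle, real_univ_map p hf] at this
  obtain ⟨i₁, k₁⟩ := key U₁ Prod.fst measurable_fst h₁ hA₁
  obtain ⟨i₂, k₂⟩ := key U₂ Prod.snd measurable_snd h₂ hA₂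
  have k₃ : |∫ z, h z.1 ∂p - ∫ z, h z.2 ∂p| ≤ c := by
    rw [← integral_sub i₁ i₂, ← Real.norm_eq_abs]
    refine (norm_integral_le_lintegral_norm _).trans ?_
    refine ENNReal.toReal_le_of_le_ofReal hc (le_trans (le_of_eq ?_) hp)
    refine lintegral_congr fun z => ?_
    rw [edist_dist, Real.dist_eq, Real.norm_eq_abs]
  rw [abs_le] at *
  constructor <;> linarith [k₁.1, k₁.2, k₂.1, k₂.2, k₃.1, k₃.2]

end General

/-! ### W^g as a metric -/

variable {n : ℕ}

theorem gdist_comm (μ ν : BMeasure (E n)) : gdist μ ν = gdist ν μ := by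
  have key : ∀ μ ν : BMeasure (E n), gdist μ ν ≤ gdist ν μ := by
    intro μ ν
    refine le_of_forall_pos_le_add fun ε hε => ?_
    obtain ⟨π, c, _, h₁, h₂, hc, hπ, hle⟩ := exists_subplan_of_gdist ν μ hε
    have e₁ : (π.map Prod.swap).map Prod.fst = π.map Prod.snd := by
      rw [Measure.map_map measurable_fst measurable_swap]; rfl
    have e₂ : (π.map Prod.swap).map Prod.snd = π.map Prod.fst := by
      rw [Measure.map_map measurable_snd measurable_swap]; rfl
    have hcost : cost (π.map Prod.swap) = cost π := by
      rw [cost, lintegral_map (by fun_prop) measurable_swap]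
      exact lintegral_congr fun z => edist_comm _ _
    have := gdist_le_of_subplan (π := π.map Prod.swap) (by rwa [e₁]) (by rwa [e₂]) hc
      (by rwa [hcost])
    rw [real_univ_map π measurable_swap] at this
    linarith
  exact le_antisymm (key _ _) (key _ _)

/-- The distance of two images of one measure. -/
theorem gdist_le_of_map {Y : Type*} [MeasurableSpace Y] (lam : Measure Y)
    [IsFiniteMeasure lam] {f g : Y → E n} (hf : Measurable f) (hg : Measurable g)
    {μ ν : BMeasure (E n)} (hμ : μ.toMeasure = lam.map f) (hν : ν.toMeasure = lam.map g)
    {c : ℝ} (hc : 0 ≤ c) (h : ∀ᵐ y ∂lam, dist (f y) (g y) ≤ c) :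
    gdist μ ν ≤ c * lam.real univ := by
  have hfg : Measurable fun y => (f y, g y) := hf.prodMk hg
  have e₁ : (lam.map fun y => (f y, g y)).map Prod.fst = μ.toMeasure := by
    rw [Measure.map_map measurable_fst hfg, hμ]; rfl
  have e₂ : (lam.map fun y => (f y, g y)).map Prod.snd = ν.toMeasure := by
    rw [Measure.map_map measurable_snd hfg, hν]; rfl
  have hcost : cost (lam.map fun y => (f y, g y)) ≤ ENNReal.ofReal (c * lam.real univ) := by
    rw [cost, lintegral_map (by fun_prop) hfg]
    calc ∫⁻ y, edist (f y) (g y) ∂lam ≤ ∫⁻ _, ENNReal.ofReal c ∂lam := by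
          refine lintegral_mono_ae ?_
          filter_upwards [h] with y hy
          rw [edist_dist]
          exact ENNReal.ofReal_le_ofReal hy
      _ = ENNReal.ofReal (c * lam.real univ) := by
          rw [lintegral_const, ENNReal.ofReal_mul hc, measureReal_def,
            ENNReal.ofReal_toReal (measure_ne_top _ _)]
  have := gdist_le_of_subplan e₁.le e₂.le (by positivity) hcost
  have m₁ : μ.rmass = lam.real univ := by rw [BMeasure.rmass, hμ, real_univ_map lam hf]
  have m₂ : ν.rmass = lam.real univ := by rw [BMeasure.rmass, hν, real_univ_map lam hg]
  rw [real_univ_map lam hfg, m₁, m₂] at this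
  linarith

theorem gdist_self (μ : BMeasure (E n)) : gdist μ μ = 0 := by
  refine le_antisymm ?_ (gdist_nonneg _ _)
  have := gdist_le_of_map (n := n) μ.toMeasure (f := id) (g := id) measurable_id measurable_id
    (μ := μ) (ν := μ) (by simp) (by simp) (c := 0) le_rfl (by simp)
  simpa using this

/-- Near-optimal subplans from μ to ν and from ν to η may use different parts of ν, so both are cut
to the common part σ of their marginals on ν before being glued. Both marginals lie below ν, hence
|π| + |ρ| - |σ| ≤ |ν|, which is exactly what the count of lost mass requires. -/
theorem gdist_triangle (μ ν η : BMeasure (E n)) : gdist μ η ≤ gdist μ ν + gdist ν η := by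
  refine le_of_forall_pos_le_add fun ε hε => ?_
  obtain ⟨π, c, _, h₁, h₂, hc, hπ, hle⟩ := exists_subplan_of_gdist μ ν (half_pos hε)
  obtain ⟨ρ, d, _, k₁, k₂, hd, hρ, kle⟩ := exists_subplan_of_gdist ν η (half_pos hε)
  set σ := π.map Prod.snd - (π.map Prod.snd - ρ.map Prod.fst) with hσ
  obtain ⟨π₁, hπ₁, eπ₁⟩ := exists_le_map_snd_eq π (σ := σ) Measure.sub_le
  obtain ⟨ρ₁, hρ₁, eρ₁⟩ := exists_le_map_fst_eq ρ (σ := σ) (sub_sub_le _ _)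
  have _ : IsFiniteMeasure π₁ := isFiniteMeasure_of_le _ hπ₁
  have _ : IsFiniteMeasure ρ₁ := isFiniteMeasure_of_le _ hρ₁
  obtain ⟨Θ, t₁, t₂⟩ := exists_glue π₁ ρ₁ (eπ₁.trans eρ₁.symm)
  have mf : Measurable fun z : E n × E n × E n => (z.2.1, z.1) := by fun_prop
  have mg : Measurable fun z : E n × E n × E n => (z.1, z.2.2) := by fun_prop
  have mh : Measurable fun z : E n × E n × E n => z.2 := by fun_prop
  have e₁ : (Θ.map fun z => z.2).map Prod.fst = π₁.map Prod.fst := by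
    rw [← t₁, Measure.map_map measurable_fst mf, Measure.map_map measurable_fst mh]; rfl
  have e₂ : (Θ.map fun z => z.2).map Prod.snd = ρ₁.map Prod.snd := by
    rw [← t₂, Measure.map_map measurable_snd mg, Measure.map_map measurable_snd mh]; rfl
  have hcost : cost (Θ.map fun z => z.2) ≤ ENNReal.ofReal (c + d) := by
    rw [ENNReal.ofReal_add hc hd]
    have c₁ : cost π₁ ≤ ENNReal.ofReal c := (cost_mono hπ₁).trans hπ
    have c₂ : cost ρ₁ ≤ ENNReal.ofReal d := (cost_mono hρ₁).trans hρ
    refine le_trans ?_ (add_le_add c₁ c₂)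
    rw [← t₁, ← t₂, cost, cost, cost, lintegral_map (by fun_prop) mh,
      lintegral_map (by fun_prop) mf, lintegral_map (by fun_prop) mg,
      ← lintegral_add_left (by fun_prop)]
    exact lintegral_mono fun z => edist_triangle _ _ _
  have hfin := gdist_le_of_subplan
    (e₁.le.trans ((map_mono_of_le hπ₁ measurable_fst).trans h₁))
    (e₂.le.trans ((map_mono_of_le hρ₁ measurable_snd).trans k₂)) (add_nonneg hc hd) hcost
  have mass : (Θ.map fun z => z.2).real univ =
      π.real univ - (π.map Prod.snd - ρ.map Prod.fst).real univ := by
    rw [← real_univ_map _ measurable_fst, e₁, real_univ_map _ measurable_fst,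
      ← real_univ_map π₁ measurable_snd, eπ₁, hσ, real_univ_sub_of_le Measure.sub_le,
      real_univ_map _ measurable_snd]
  have hdef : (π.map Prod.snd - ρ.map Prod.fst).real univ ≤ ν.rmass - ρ.real univ := by
    have : (ν.toMeasure - ρ.map Prod.fst).real univ = ν.rmass - ρ.real univ := by
      rw [real_univ_sub_of_le k₁, real_univ_map _ measurable_fst]; rfl
    rw [← this]
    refine real_mono_of_le (Measure.sub_le_of_le_add ?_) univ
    rw [Measure.sub_add_cancel_of_le k₁]
    exact h₂
  linarith

/-- Kantorovich-type bound: bounded Lipschitz functions are tested continuously. -/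
theorem abs_integral_sub_le_gdist {f : E n → ℝ} {A : ℝ≥0} (hb : ∀ x, |f x| ≤ A)
    (hl : LipschitzWith A f) (μ ν : BMeasure (E n)) :
    |∫ x, f x ∂μ.toMeasure - ∫ x, f x ∂ν.toMeasure| ≤ A * gdist μ ν := by
  refine le_of_forall_pos_le_add fun ε hε => ?_
  obtain ⟨π, c, _, h₁, h₂, hc, hπ, hle⟩ :=
    -- The denominator is `A + 1` because `A` may vanish; the same device recurs below.
    exists_subplan_of_gdist μ ν (ε := ε / (A + 1)) (by positivity)
  have hcost : ∫⁻ z, edist (f z.1) (f z.2) ∂π ≤ ENNReal.ofReal (A * c) := by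
    calc ∫⁻ z, edist (f z.1) (f z.2) ∂π ≤ ∫⁻ z, A * edist z.1 z.2 ∂π :=
          lintegral_mono fun z => hl z.1 z.2
      _ = A * cost π := by rw [lintegral_const_mul _ (by fun_prop), cost]
      _ ≤ A * ENNReal.ofReal c := by gcongr
      _ = ENNReal.ofReal (A * c) := by rw [ENNReal.ofReal_mul (by positivity)]; simp
  have := abs_integral_sub_integral_le h₁ h₂ hl.continuous.measurable (A := A)
    (ae_of_all _ hb) (ae_of_all _ hb) (by positivity) hcost
  have h3 : (A : ℝ) * (μ.rmass + ν.rmass - 2 * π.real univ + c) ≤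
      A * (gdist μ ν + ε / (A + 1)) := by gcongr
  have h4 : (A : ℝ) * (ε / (A + 1)) ≤ ε := by
    rw [mul_div_assoc', div_le_iff₀ (by positivity)]
    nlinarith
  simp only [BMeasure.rmass] at *
  linarith

/-- Thickened indicators of a closed set are bounded and Lipschitz, so both measures integrate them
equally; in the limit the measures agree on closed sets, a π-system that generates the Borel sets.
-/
theorem eq_of_gdist_eq_zero {μ ν : BMeasure (E n)} (h : gdist μ ν = 0) : μ = ν := by
  have key : ∀ F : Set (E n), IsClosed F → μ.toMeasure F = ν.toMeasure F := by
    intro F hF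
    have hlim : ∀ η : BMeasure (E n), Tendsto
        (fun k : ℕ => ∫⁻ x, thickenedIndicator (δ := 1 / ((k : ℝ) + 1))
          (Nat.one_div_pos_of_nat) F x ∂η.toMeasure)
        atTop (𝓝 (η.toMeasure F)) := fun η => by
      have := tendsto_lintegral_thickenedIndicator_of_isClosed η.toMeasure hF
        (δs := fun k : ℕ => 1 / ((k : ℝ) + 1)) (fun k => Nat.one_div_pos_of_nat)
        tendsto_one_div_add_atTop_nhds_zero_nat
      exact this
    refine tendsto_nhds_unique (hlim μ) ((hlim ν).congr fun k => ?_)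
    obtain ⟨δ, hδ, hδk⟩ : ∃ δ : ℝ, 0 < δ ∧ δ = 1 / ((k : ℝ) + 1) :=
      ⟨_, Nat.one_div_pos_of_nat, rfl⟩
    simp only [← hδk]
    have hg := lipschitzWith_thickenedIndicator hδ F
    set g := thickenedIndicator hδ F
    have hl : LipschitzWith (max 1 δ.toNNReal⁻¹) fun x => (g x : ℝ) := by
      refine LipschitzWith.weaken ?_ (le_max_right _ _)
      have := NNReal.isometry_coe.lipschitz.comp hg
      simpa [Function.comp_def] using this
    have hb : ∀ x, |(g x : ℝ)| ≤ (max 1 δ.toNNReal⁻¹ : ℝ≥0) := fun x => by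
      rw [abs_of_nonneg (NNReal.coe_nonneg _)]
      exact_mod_cast (thickenedIndicator_le_one hδ F x).trans (le_max_left _ _)
    have h0 := abs_integral_sub_le_gdist hb hl μ ν
    rw [h, mul_zero] at h0
    have h1 := sub_eq_zero.1 (abs_nonpos_iff.1 h0)
    have hi : ∀ η : BMeasure (E n), Integrable (fun x => (g x : ℝ)) η.toMeasure := fun η =>
      Integrable.of_bound hl.continuous.aestronglyMeasurable _ (ae_of_all _ hb)
    rw [lintegral_coe_eq_integral _ (hi ν), lintegral_coe_eq_integral _ (hi μ), h1]
  refine BMeasure.ext ?_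
  refine ext_of_generate_finite _ ?_ isPiSystem_isClosed (fun F hF => key F hF)
    (key _ isClosed_univ)
  rw [BorelSpace.measurable_eq (α := E n), borel_eq_generateFrom_isClosed]

instance : MetricSpace (BMeasure (E n)) where
  dist := gdist
  dist_self := gdist_self
  dist_comm := gdist_comm
  dist_triangle := gdist_triangle
  eq_of_dist_eq_zero := eq_of_gdist_eq_zero

theorem dist_eq_gdist (μ ν : BMeasure (E n)) : dist μ ν = gdist μ ν := rfl

theorem abs_rmass_sub_le (μ ν : BMeasure (E n)) : |μ.rmass - ν.rmass| ≤ dist μ ν := by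
  have := abs_integral_sub_le_gdist (n := n) (f := fun _ => 1) (A := 1) (by simp)
    (LipschitzWith.const' 1 |>.weaken zero_le_one) μ ν
  simpa [BMeasure.rmass, dist_eq_gdist] using this

/-- Two measures with a common part. -/
theorem dist_le_of_common_le {μ ν : BMeasure (E n)} {σ : Measure (E n)}
    (h₁ : σ ≤ μ.toMeasure) (h₂ : σ ≤ ν.toMeasure) :
    dist μ ν ≤ μ.rmass + ν.rmass - 2 * σ.real univ := by
  have hm : Measurable fun x : E n => (x, x) := by fun_prop
  have e₁ : (σ.map fun x => (x, x)).map Prod.fst = σ := by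
    rw [Measure.map_map measurable_fst hm]; exact Measure.map_id
  have e₂ : (σ.map fun x => (x, x)).map Prod.snd = σ := by
    rw [Measure.map_map measurable_snd hm]; exact Measure.map_id
  have := gdist_le_of_subplan (μ := μ) (ν := ν) (π := σ.map fun x => (x, x)) (c := 0)
    (by rwa [e₁]) (by rwa [e₂]) le_rfl (by
      rw [cost, lintegral_map (by fun_prop) hm]; simp)
  rw [real_univ_map _ hm, add_zero] at this
  exact this

theorem dist_add_add_le (μ μ' ν ν' : BMeasure (E n)) :
    dist (μ.add μ') (ν.add ν') ≤ dist μ ν + dist μ' ν' := by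
  refine le_of_forall_pos_le_add fun ε hε => ?_
  obtain ⟨π, c, _, h₁, h₂, hc, hπ, hle⟩ := exists_subplan_of_gdist μ ν (half_pos hε)
  obtain ⟨ρ, d, _, k₁, k₂, hd, hρ, kle⟩ := exists_subplan_of_gdist μ' ν' (half_pos hε)
  have := gdist_le_of_subplan (μ := μ.add μ') (ν := ν.add ν') (π := π + ρ) (c := c + d)
    (by rw [Measure.map_add _ _ measurable_fst]; exact add_le_add h₁ k₁)
    (by rw [Measure.map_add _ _ measurable_snd]; exact add_le_add h₂ k₂)
    (add_nonneg hc hd) (by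
      rw [cost, lintegral_add_measure, ENNReal.ofReal_add hc hd]
      exact add_le_add hπ hρ)
  have m₁ : (μ.add μ').rmass = μ.rmass + μ'.rmass := measureReal_add_apply
  have m₂ : (ν.add ν').rmass = ν.rmass + ν'.rmass := measureReal_add_apply
  have m₃ : (π + ρ).real univ = π.real univ + ρ.real univ := measureReal_add_apply
  rw [m₁, m₂, m₃] at this
  simp only [dist_eq_gdist]
  linarith

theorem smul_measure_mono {X : Type*} [MeasurableSpace X] (c : ℝ≥0) {μ ν : Measure X}
    (h : μ ≤ ν) : c • μ ≤ c • ν := fun s => by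
  simp only [Measure.smul_apply]
  gcongr

/-- The measure `c • μ`. -/
def BMeasure.smul (c : ℝ≥0) (μ : BMeasure (E n)) : BMeasure (E n) where
  toMeasure := c • μ.toMeasure
  finite := inferInstance
  bounded := μ.bounded.subset
    (Measure.AbsolutelyContinuous.support_mono (Measure.smul_absolutelyContinuous (c := c)))

theorem BMeasure.rmass_smul (c : ℝ≥0) (μ : BMeasure (E n)) :
    (BMeasure.smul c μ).rmass = c * μ.rmass := by
  rw [BMeasure.rmass, BMeasure.rmass, BMeasure.smul, measureReal_nnreal_smul_apply]

theorem BMeasure.rmass_add (μ ν : BMeasure (E n)) : (μ.add ν).rmass = μ.rmass + ν.rmass :=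
  measureReal_add_apply

theorem dist_smul_smul_le (c : ℝ≥0) (μ ν : BMeasure (E n)) :
    dist (BMeasure.smul c μ) (BMeasure.smul c ν) ≤ c * dist μ ν := by
  refine le_of_forall_pos_le_add fun ε hε => ?_
  obtain ⟨π, d, _, h₁, h₂, hd, hπ, hle⟩ :=
    exists_subplan_of_gdist μ ν (ε := ε / (c + 1)) (by positivity)
  have := gdist_le_of_subplan (μ := BMeasure.smul c μ) (ν := BMeasure.smul c ν) (π := c • π)
    (c := c * d)
    (by rw [Measure.map_smul]; exact smul_measure_mono c h₁)
    (by rw [Measure.map_smul]; exact smul_measure_mono c h₂)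
    (by positivity) (by
      rw [cost, lintegral_smul_measure, ENNReal.ofReal_mul c.coe_nonneg, ENNReal.ofReal_coe_nnreal]
      exact mul_le_mul_right hπ _)
  have m : (c • π).real univ = c * π.real univ := by
    rw [measureReal_nnreal_smul_apply]
  rw [BMeasure.rmass_smul, BMeasure.rmass_smul, m] at this
  have h3 : (c : ℝ) * (μ.rmass + ν.rmass - 2 * π.real univ + d) ≤
      c * (gdist μ ν + ε / (c + 1)) := by gcongr
  have h4 : (c : ℝ) * (ε / (c + 1)) ≤ ε := by
    rw [mul_div_assoc', div_le_iff₀ (by positivity)]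
    nlinarith
  simp only [dist_eq_gdist]
  linarith

/-! ### Compactness of measures with bounded mass and support -/

/-- The measures carried by the closed ball of radius `R` with mass at most `M`. -/
def massBall (n : ℕ) (R M : ℝ) : Set (BMeasure (E n)) :=
  {μ | μ.toMeasure (Metric.closedBall 0 R)ᶜ = 0 ∧ μ.rmass ≤ M}

theorem supp_subset_closedBall_iff {μ : BMeasure (E n)} {R : ℝ} :
    μ.supp ⊆ Metric.closedBall 0 R ↔ μ.toMeasure (Metric.closedBall 0 R)ᶜ = 0 :=
  ⟨fun h => measure_mono_null (compl_subset_compl.2 h) Measure.measure_compl_support,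
    fun h => Measure.support_subset_of_isClosed Metric.isClosed_closedBall h⟩

theorem massBall_mono {R R' M M' : ℝ} (hR : R ≤ R') (hM : M ≤ M') :
    massBall n R M ⊆ massBall n R' M' := fun _ h =>
  ⟨measure_mono_null (compl_subset_compl.2 (Metric.closedBall_subset_closedBall hR)) h.1,
    h.2.trans hM⟩

theorem exists_mem_massBall (μ : BMeasure (E n)) :
    ∃ m : ℕ, μ ∈ massBall n m m := by
  obtain ⟨R, hR⟩ := μ.bounded.subset_closedBall 0
  obtain ⟨m, hm⟩ := exists_nat_ge (max R μ.rmass)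
  exact ⟨m, massBall_mono ((le_max_left _ _).trans hm) ((le_max_right _ _).trans hm)
    ⟨supp_subset_closedBall_iff.1 hR, le_rfl⟩⟩

theorem rmass_diracSum {ι : Type*} (I : Finset ι) (m : ι → ℝ≥0) (x : ι → E n) :
    (BMeasure.diracSum I m x).rmass = ∑ i ∈ I, (m i : ℝ) := by
  simp [BMeasure.rmass, BMeasure.diracSum, measureReal_def, Measure.finsetSum_apply,
    ENNReal.toReal_sum]

theorem dist_diracSum_le {ι : Type*} (I : Finset ι) (a b : ι → ℝ≥0) (x : ι → E n) :
    dist (BMeasure.diracSum I a x) (BMeasure.diracSum I b x) ≤ ∑ i ∈ I, |(a i : ℝ) - b i| := by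
  have key : ∀ a b : ι → ℝ≥0, a ≤ b →
      (BMeasure.diracSum I a x).toMeasure ≤ (BMeasure.diracSum I b x).toMeasure := by
    intro a b hab
    refine Finset.sum_le_sum fun i _ => ?_
    intro s
    simp only [Measure.smul_apply]
    gcongr
    exact hab i
  have := dist_le_of_common_le (μ := BMeasure.diracSum I a x) (ν := BMeasure.diracSum I b x)
    (key (fun i => min (a i) (b i)) a fun i => min_le_left _ _)
    (key (fun i => min (a i) (b i)) b fun i => min_le_right _ _)
  have hm := rmass_diracSum I (fun i => min (a i) (b i)) x
  rw [BMeasure.rmass] at hm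
  rw [hm, rmass_diracSum, rmass_diracSum, Finset.mul_sum, ← Finset.sum_add_distrib,
    ← Finset.sum_sub_distrib] at this
  refine this.trans (Finset.sum_le_sum fun i _ => ?_)
  rw [NNReal.coe_min]
  rcases le_total (a i : ℝ) (b i) with h | h
  · rw [min_eq_left h, abs_of_nonpos (by linarith)]; linarith
  · rw [min_eq_right h, abs_of_nonneg (by linarith)]; linarith

/-- Discretization of a measure by a partition of unity. -/
theorem dist_diracSum_partition_le {ι : Type*} [Fintype ι] (x : ι → E n) {φ : ι → E n → ℝ}
    (hφ : ∀ i, Continuous (φ i)) (h0 : ∀ i y, 0 ≤ φ i y) {δ : ℝ} (hδ : 0 ≤ δ)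
    (hs : ∀ i y, φ i y ≠ 0 → dist (x i) y ≤ δ) (μ : BMeasure (E n))
    (h1 : ∀ᵐ y ∂μ.toMeasure, ∑ i, φ i y = 1) :
    dist (BMeasure.diracSum Finset.univ (fun i => (∫ y, φ i y ∂μ.toMeasure).toNNReal) x) μ
      ≤ δ * μ.rmass := by
  have hle : ∀ i, ∀ᵐ y ∂μ.toMeasure, φ i y ≤ 1 := fun i => by
    filter_upwards [h1] with y hy
    rw [← hy]
    exact Finset.single_le_sum (f := fun i => φ i y) (fun j _ => h0 j y) (Finset.mem_univ i)
  have hi : ∀ i, Integrable (φ i) μ.toMeasure := fun i =>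
    Integrable.of_bound (hφ i).aestronglyMeasurable 1 (by
      filter_upwards [hle i] with y hy
      rwa [Real.norm_of_nonneg (h0 i y)])
  set D := BMeasure.diracSum Finset.univ (fun i => (∫ y, φ i y ∂μ.toMeasure).toNNReal) x with hD
  set w : ι → Measure (E n) := fun i => μ.toMeasure.withDensity (fun y => ENNReal.ofReal (φ i y))
  have hw : ∀ i, w i univ = ENNReal.ofReal (∫ y, φ i y ∂μ.toMeasure) := fun i => by
    simp only [w]
    rw [withDensity_apply _ MeasurableSet.univ, Measure.restrict_univ,
      ofReal_integral_eq_lintegral_ofReal (hi i) (ae_of_all _ (h0 i))]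
  have hf : ∀ i, Measurable fun y : E n => (x i, y) := fun i => by fun_prop
  -- Couple the piece of `μ` with density `φ i` to the atom at `x i`; no pair is farther apart than
  -- `δ`.
  set π : Measure (E n × E n) := ∑ i, (w i).map fun y => (x i, y) with hπ
  have e₁ : π.map Prod.fst = D.toMeasure := by
    rw [hπ, Measure.map_finset_sum measurable_fst.aemeasurable]
    simp only [hD, BMeasure.diracSum]
    refine Finset.sum_congr rfl fun i _ => ?_
    rw [Measure.map_map measurable_fst (hf i)]
    have : (Prod.fst ∘ fun y : E n => (x i, y)) = fun _ => x i := rfl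
    rw [this, Measure.map_const, hw]
    rfl
  have e₂ : π.map Prod.snd = μ.toMeasure := by
    rw [hπ, Measure.map_finset_sum measurable_snd.aemeasurable]
    have : ∀ i, ((w i).map fun y => (x i, y)).map Prod.snd = w i := fun i => by
      rw [Measure.map_map measurable_snd (hf i)]
      exact Measure.map_id
    simp only [this]
    ext s hs
    rw [Measure.finsetSum_apply]
    simp only [w]
    simp_rw [withDensity_apply _ hs]
    rw [← lintegral_finsetSum' _ (fun i _ => ((hφ i).measurable.ennreal_ofReal).aemeasurable)]
    have : ∀ᵐ y ∂μ.toMeasure.restrict s, ∑ i, ENNReal.ofReal (φ i y) = 1 := by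
      filter_upwards [ae_restrict_of_ae h1] with y hy
      rw [← ENNReal.ofReal_sum_of_nonneg (fun i _ => h0 i y), hy, ENNReal.ofReal_one]
    rw [lintegral_congr_ae this]
    simp
  have hmass : π.real univ = μ.rmass := by
    rw [← real_univ_map π measurable_snd, e₂]; rfl
  have hmass' : D.rmass = μ.rmass := by
    rw [← hmass, BMeasure.rmass, ← e₁, real_univ_map π measurable_fst]
  have hc : cost π ≤ ENNReal.ofReal (δ * μ.rmass) := by
    have hs' : ∀ i, ∫⁻ y, edist (x i) y ∂(w i) ≤ ENNReal.ofReal δ * w i univ := fun i => by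
      rw [← lintegral_const]
      refine lintegral_mono_ae ?_
      simp only [w]
      rw [ae_withDensity_iff ((hφ i).measurable.ennreal_ofReal)]
      refine ae_of_all _ fun y hy => ?_
      rw [edist_dist]
      refine ENNReal.ofReal_le_ofReal (hs i y ?_)
      intro h0
      simp [h0] at hy
    calc cost π = ∑ i, ∫⁻ y, edist (x i) y ∂(w i) := by
          rw [cost, hπ, lintegral_finsetSum_measure]
          refine Finset.sum_congr rfl fun i _ => ?_
          rw [lintegral_map (by fun_prop) (hf i)]
      _ ≤ ∑ i, ENNReal.ofReal δ * w i univ := Finset.sum_le_sum fun i _ => hs' i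
      _ = ENNReal.ofReal δ * π univ := by
          rw [← Finset.mul_sum, hπ, Measure.finsetSum_apply]
          congr 1
          refine Finset.sum_congr rfl fun i _ => ?_
          rw [Measure.map_apply (hf i) MeasurableSet.univ, preimage_univ]
      _ = ENNReal.ofReal (δ * μ.rmass) := by
          rw [ENNReal.ofReal_mul hδ, ← BMeasure.mass_eq, BMeasure.mass, ← e₂,
            Measure.map_apply measurable_snd MeasurableSet.univ, preimage_univ]
  have := gdist_le_of_subplan e₁.le e₂.le (by positivity [μ.rmass_nonneg]) hc
  rw [hmass, hmass'] at this
  rw [dist_eq_gdist]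
  linarith

/-- The restriction of a finite measure to a closed ball. -/
def restrictBall (R : ℝ) (m : FiniteMeasure (E n)) : BMeasure (E n) where
  toMeasure := (m : Measure (E n)).restrict (Metric.closedBall 0 R)
  finite := inferInstance
  bounded := isBounded_support (B := Metric.closedBall 0 R) Metric.isBounded_closedBall (by
    rw [Measure.restrict_apply Metric.isClosed_closedBall.measurableSet.compl]
    simp)

/-- Weak convergence of measures on a ball implies convergence for `W^g`. -/
theorem continuousOn_restrictBall (R : ℝ) (M : ℝ≥0) : ContinuousOn (restrictBall (n := n) R)
    {m | m.mass ≤ M ∧ m (Metric.closedBall 0 R)ᶜ = 0} := by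
  set 𝒦 : Set (FiniteMeasure (E n)) := {m | m.mass ≤ M ∧ m (Metric.closedBall 0 R)ᶜ = 0}
  have hae : ∀ m ∈ 𝒦, ∀ᵐ y ∂(m : Measure (E n)), y ∈ Metric.closedBall (0 : E n) R := by
    intro m hm
    exact (FiniteMeasure.null_iff_toMeasure_null _ _).1 hm.2
  have hrestr : ∀ m ∈ 𝒦, (restrictBall R m).toMeasure = m := fun m hm =>
    Measure.restrict_eq_self_of_ae_mem (hae m hm)
  have hmass : ∀ m ∈ 𝒦, (restrictBall R m).rmass ≤ M := fun m hm => by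
    rw [BMeasure.rmass, hrestr m hm]
    exact_mod_cast hm.1
  intro m hm
  rw [ContinuousWithinAt, Metric.tendsto_nhds]
  intro ε hε
  set δ : ℝ := ε / (3 * (M + 1)) with hδ
  have hδ0 : 0 < δ := by positivity
  have hδM : δ * M ≤ ε / 3 := by
    rw [hδ, div_mul_eq_mul_div, div_le_div_iff₀ (by positivity) (by positivity)]
    nlinarith
  -- All measures in `𝒦` are quantized by one finite partition of unity, at a cost of at most `δ *
  -- M`. The quantized measures share their atoms, and their finitely many weights are integrals of
  -- continuous functions, so they converge under weak convergence.
  obtain ⟨t, -, htf, ht⟩ := (isCompact_closedBall (0 : E n) R).finite_cover_balls hδ0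
  have _ : Fintype t := htf.fintype
  obtain ⟨φ, hφ⟩ := PartitionOfUnity.exists_isSubordinate Metric.isClosed_closedBall
    (fun i : t => Metric.ball (i : E n) δ) (fun i => Metric.isOpen_ball)
    (by simpa [iUnion_subtype] using ht)
  have hsum : ∀ y ∈ Metric.closedBall (0 : E n) R, ∑ i, φ i y = 1 := fun y hy => by
    rw [← φ.sum_eq_one hy, finsum_eq_sum_of_fintype]
  have hs : ∀ i y, φ i y ≠ 0 → dist (i : E n) y ≤ δ := fun i y hy => by
    have := hφ i (subset_tsupport _ hy)
    rw [dist_comm]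
    exact (Metric.mem_ball.1 this).le
  have happ : ∀ m' ∈ 𝒦, dist (BMeasure.diracSum Finset.univ
      (fun i : t => (∫ y, φ i y ∂(m' : Measure (E n))).toNNReal) (fun i => (i : E n)))
      (restrictBall R m') ≤ ε / 3 := by
    intro m' hm'
    have := dist_diracSum_partition_le (fun i : t => (i : E n)) (φ := fun i => φ i)
      (fun i => (φ i).continuous) (fun i y => φ.nonneg i y) hδ0.le hs (restrictBall R m') (by
        rw [hrestr m' hm']
        filter_upwards [hae m' hm'] with y hy using hsum y hy)
    rw [hrestr m' hm'] at this
    refine this.trans (le_trans ?_ hδM)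
    gcongr
    exact hmass m' hm'
  have hlim : Tendsto (fun m' : FiniteMeasure (E n) =>
      ∑ i, |∫ y, φ i y ∂(m' : Measure (E n)) - ∫ y, φ i y ∂(m : Measure (E n))|) (𝓝[𝒦] m)
      (𝓝 0) := by
    have : (0 : ℝ) = ∑ i : t, |∫ y, φ i y ∂(m : Measure (E n))
        - ∫ y, φ i y ∂(m : Measure (E n))| := by simp
    rw [this]
    refine tendsto_finsetSum _ fun i _ => ((Tendsto.sub_const ?_ _).abs)
    have hb : ∀ y, ‖φ i y‖ ≤ 1 := fun y => by
      rw [Real.norm_of_nonneg (φ.nonneg i y)]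
      exact φ.le_one i y
    have := FiniteMeasure.tendsto_iff_forall_integral_tendsto.1
      (tendsto_id.mono_left nhdsWithin_le_nhds : Tendsto id (𝓝[𝒦] m) (𝓝 m))
      (BoundedContinuousFunction.ofNormedAddCommGroup (φ i) (φ i).continuous 1 hb)
    simpa using this
  filter_upwards [hlim.eventually (gt_mem_nhds (show (0 : ℝ) < ε / 3 by positivity)),
    self_mem_nhdsWithin] with m' hlt hm'
  have h1 := happ m' hm'
  have h2 := happ m hm
  have h3 := dist_diracSum_le Finset.univ
    (fun i : t => (∫ y, φ i y ∂(m' : Measure (E n))).toNNReal)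
    (fun i : t => (∫ y, φ i y ∂(m : Measure (E n))).toNNReal) (fun i => (i : E n))
  simp only [Real.coe_toNNReal _ (integral_nonneg (fun y => φ.nonneg _ y))] at h3
  rw [dist_comm] at h1
  have t1 := dist_triangle4 (restrictBall R m') _ _ (restrictBall R m)
    |>.trans (add_le_add (add_le_add h1 h3) h2)
  linarith

/-- Finite measures carried by a compact ball, with mass at most M, are weakly compact, and weak
convergence there implies W^g-convergence; the set is thus a continuous image of a compact one. For
negative M it is empty. -/
theorem isCompact_massBall (R M : ℝ) : IsCompact (massBall n R M) := by
  rcases lt_or_ge M 0 with hM | hM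
  · convert isCompact_empty
    exact eq_empty_of_forall_notMem fun μ hμ => by linarith [hμ.2, μ.rmass_nonneg]
  lift M to ℝ≥0 using hM
  have h := (isCompact_setOfPred_finiteMeasure_le_of_isCompact M
    (isCompact_closedBall (0 : E n) R)).image_of_continuousOn (continuousOn_restrictBall R M)
  convert h using 1
  ext μ
  constructor
  · intro hμ
    refine ⟨⟨μ.toMeasure, μ.finite⟩, ⟨?_, ?_⟩, ?_⟩
    · exact_mod_cast hμ.2
    · exact (FiniteMeasure.null_iff_toMeasure_null _ _).2 hμ.1
    · refine BMeasure.ext ?_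
      exact Measure.restrict_eq_self_of_ae_mem (s := Metric.closedBall 0 R) hμ.1
  · rintro ⟨m, hm, rfl⟩
    have hr : (restrictBall R m).toMeasure = m := Measure.restrict_eq_self_of_ae_mem
      ((FiniteMeasure.null_iff_toMeasure_null _ _).1 hm.2)
    refine ⟨?_, ?_⟩
    · rw [hr]
      exact (FiniteMeasure.null_iff_toMeasure_null _ _).1 hm.2
    · rw [BMeasure.rmass, hr]
      exact_mod_cast hm.1

/-! ### The Euler step without lattice -/

/-- The image of `U` under the free flow `(x, v) ↦ x + τ v`. -/
def freeFlow (τ : ℝ) (U : BMeasure (E n × E n)) : BMeasure (E n) where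
  toMeasure := U.toMeasure.map (fun p => p.1 + τ • p.2)
  finite := inferInstance
  bounded := by
    have hcont : Continuous fun p : E n × E n => p.1 + τ • p.2 := by fun_prop
    have hc : IsCompact (closure U.toMeasure.support) := U.bounded.isCompact_closure
    have hK := hc.image hcont
    refine isBounded_support hK.isBounded ?_
    rw [Measure.map_apply hcont.measurable hK.isClosed.measurableSet.compl]
    exact measure_mono_null (fun p hp hp' => hp (mem_image_of_mem _ (subset_closure hp')))
      Measure.measure_compl_support

/-- The explicit Euler step without discretization in space and velocity. -/
def freeStep (V : BMeasure (E n) → BMeasure (E n × E n)) (s : BMeasure (E n) → BMeasure (E n))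
    (τ : ℝ) (μ : BMeasure (E n)) : BMeasure (E n) :=
  (freeFlow τ (V μ)).add (BMeasure.smul τ.toNNReal (s μ))

/-- The hypotheses on the vector field and the source, with explicit constants. -/
structure IsRegular (V : BMeasure (E n) → BMeasure (E n × E n))
    (s : BMeasure (E n) → BMeasure (E n)) (C L R₀ : ℝ) : Prop where
  pvf : IsPVF V
  C_pos : 0 < C
  sublinear : ∀ μ, ∀ p ∈ (V μ).supp, ‖p.2‖ ≤ C * (1 + sSup ((fun x => ‖x‖) '' μ.supp))
  locLip : LocallyLipschitzPVF V
  L_nonneg : 0 ≤ L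
  lipSource : ∀ μ ν, dist (s μ) (s ν) ≤ L * dist μ ν
  supp_source : ∀ μ, (s μ).toMeasure (Metric.closedBall 0 R₀)ᶜ = 0

namespace IsRegular

variable {V : BMeasure (E n) → BMeasure (E n × E n)} {s : BMeasure (E n) → BMeasure (E n)}
  {C L R₀ : ℝ}

theorem map_fst (H : IsRegular V s C L R₀) (μ : BMeasure (E n)) :
    (V μ).toMeasure.map Prod.fst = μ.toMeasure :=
  congrArg BMeasure.toMeasure (H.pvf μ)

theorem rmass_V (H : IsRegular V s C L R₀) (μ : BMeasure (E n)) :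
    (V μ).toMeasure.real univ = μ.rmass := by
  rw [← real_univ_map _ measurable_fst, H.map_fst]; rfl

theorem ae_bound (H : IsRegular V s C L R₀) {μ : BMeasure (E n)} {R : ℝ} (hR : 0 ≤ R)
    (hμ : μ.toMeasure (Metric.closedBall 0 R)ᶜ = 0) :
    ∀ᵐ p ∂(V μ).toMeasure, ‖p.1‖ ≤ R ∧ ‖p.2‖ ≤ C * (1 + R) := by
  have h1 : ∀ᵐ p ∂(V μ).toMeasure, ‖p.1‖ ≤ R := by
    have : ∀ᵐ x ∂(V μ).toMeasure.map Prod.fst, x ∈ Metric.closedBall (0 : E n) R := by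
      rw [H.map_fst]; exact hμ
    filter_upwards [ae_of_ae_map measurable_fst.aemeasurable this] with p hp
    simpa using hp
  have h2 : ∀ᵐ p ∂(V μ).toMeasure, p ∈ (V μ).supp := Measure.support_mem_ae
  filter_upwards [h1, h2] with p hp hp'
  refine ⟨hp, (H.sublinear μ p hp').trans ?_⟩
  have hsup : sSup ((fun x => ‖x‖) '' μ.supp) ≤ R := by
    -- The bound `0 ≤ R` covers an empty support, whose supremum is 0 by convention.
    refine Real.sSup_le ?_ hR
    rintro _ ⟨x, hx, rfl⟩
    simpa using supp_subset_closedBall_iff.2 hμ hx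
  have := H.C_pos
  gcongr

/-- This is the usable form of (V2). An admissible plan is optimal on the base between parts that
realize W^g, so its mass defect and base cost add up to at most W^g with no error; the ε enters only
because the fibre cost is an infimum over such plans. Both bounds hold for the same plan. -/
theorem exists_lipschitz_plan (H : IsRegular V s C L R₀) {R : ℝ} (hR : 0 ≤ R) :
    ∃ K : ℝ, 0 ≤ K ∧ ∀ μ ν : BMeasure (E n), μ.toMeasure (Metric.closedBall 0 R)ᶜ = 0 →
      ν.toMeasure (Metric.closedBall 0 R)ᶜ = 0 → ∀ ε : ℝ, 0 < ε →
      ∃ (p : Measure ((E n × E n) × (E n × E n))) (c₁ c₂ : ℝ),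
        p.map Prod.fst ≤ (V μ).toMeasure ∧ p.map Prod.snd ≤ (V ν).toMeasure ∧
        0 ≤ c₁ ∧ 0 ≤ c₂ ∧ ∫⁻ z, edist z.1.1 z.2.1 ∂p ≤ ENNReal.ofReal c₁ ∧
        ∫⁻ z, edist z.1.2 z.2.2 ∂p ≤ ENNReal.ofReal c₂ ∧
        μ.rmass + ν.rmass - 2 * p.real univ + c₁ ≤ dist μ ν ∧ c₂ ≤ K * dist μ ν + ε := by
  -- (V2) speaks of open balls, hence the larger radius.
  obtain ⟨K, -, hK⟩ := H.locLip (R + 1) (by linarith)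
  refine ⟨K, K.coe_nonneg, fun μ ν hμ hν ε hε => ?_⟩
  have hsub : μ.supp ∪ ν.supp ⊆ Metric.ball 0 (R + 1) :=
    (union_subset (supp_subset_closedBall_iff.2 hμ) (supp_subset_closedBall_iff.2 hν)).trans
      (Metric.closedBall_subset_ball (by linarith))
  have hc₂ : 0 ≤ K * dist μ ν := by positivity
  have hlt : fiberWass (V μ) (V ν) < ENNReal.ofReal (K * dist μ ν + ε) := by
    refine (hK μ ν hsub).trans_lt ?_
    rw [gWass_eq, ← ENNReal.ofReal_coe_nnreal, ← ENNReal.ofReal_mul K.coe_nonneg]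
    exact (ENNReal.ofReal_lt_ofReal_iff (by linarith)).2 (by rw [← dist_eq_gdist]; linarith)
  obtain ⟨p, hp⟩ := iInf_lt_iff.1 hlt
  obtain ⟨⟨U₁, U₂, hU₁, hU₂, ⟨e₁, e₂⟩, hgw, -, hopt⟩, hcost⟩ := iInf_lt_iff.1 hp
  rw [H.pvf μ, H.pvf ν] at hgw
  have hw : wass (base U₁) (base U₂) ≠ ⊤ := by
    refine ne_top_of_le_ne_top (gWass_ne_top μ ν) ?_
    rw [hgw, add_assoc]
    exact le_add_left le_self_add
  have hcost₁ : ∫⁻ z, edist z.1.1 z.2.1 ∂p ≤ wass (base U₁) (base U₂) := by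
    have : ∫⁻ z, edist z.1.1 z.2.1 ∂p = cost (p.map fun z => (z.1.1, z.2.1)) := by
      rw [cost, lintegral_map (by fun_prop) (by fun_prop)]
    rw [this]
    exact le_iInf₂ hopt
  have tv : ∀ μ ν : BMeasure (E n),
      ENNReal.ofReal (μ.rmass - ν.rmass) ≤ tvDist μ ν := fun μ ν => by
    rw [tvDist_eq]
    refine ENNReal.ofReal_le_ofReal ?_
    rw [BMeasure.rmass, BMeasure.rmass, ← real_univ_sub_sub]
    linarith [measureReal_nonneg (μ := ν.toMeasure - μ.toMeasure) (s := univ)]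
  have m₁ : (base U₁).rmass = p.real univ := by
    rw [BMeasure.rmass, base, real_univ_map _ measurable_fst, ← e₁,
      real_univ_map _ measurable_fst]
  have m₂ : (base U₂).rmass = p.real univ := by
    rw [BMeasure.rmass, base, real_univ_map _ measurable_fst, ← e₂,
      real_univ_map _ measurable_snd]
  have a₁ : p.real univ ≤ μ.rmass := by
    rw [← H.rmass_V, ← real_univ_map p measurable_fst, e₁]
    exact real_mono_of_le hU₁ _
  have a₂ : p.real univ ≤ ν.rmass := by
    rw [← H.rmass_V, ← real_univ_map p measurable_snd, e₂]
    exact real_mono_of_le hU₂ _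
  refine ⟨p, (wass (base U₁) (base U₂)).toReal, K * dist μ ν + ε, e₁.le.trans hU₁,
    e₂.le.trans hU₂, ENNReal.toReal_nonneg, by linarith, ?_, hcost.le, ?_, le_rfl⟩
  · rwa [ENNReal.ofReal_toReal hw]
  · have t₁ := tv μ (base U₁)
    have t₂ := tv ν (base U₂)
    rw [m₁] at t₁
    rw [m₂] at t₂
    have : ENNReal.ofReal (μ.rmass - p.real univ + (wass (base U₁) (base U₂)).toReal
        + (ν.rmass - p.real univ)) ≤ gWass μ ν := by
      rw [hgw, ENNReal.ofReal_add (add_nonneg (by linarith) ENNReal.toReal_nonneg) (by linarith),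
        ENNReal.ofReal_add (by linarith) ENNReal.toReal_nonneg, ENNReal.ofReal_toReal hw]
      gcongr
    rw [gWass_eq, ENNReal.ofReal_le_ofReal_iff (gdist_nonneg _ _)] at this
    rw [dist_eq_gdist]
    linarith

/-- Compare with the zero measure, whose distance to μ is at most |μ|. -/
theorem rmass_source_le (H : IsRegular V s C L R₀) : ∃ s₀ : ℝ, 0 ≤ s₀ ∧
    ∀ μ, (s μ).rmass ≤ s₀ + L * μ.rmass := by
  set ν : BMeasure (E n) := ⟨0, inferInstance, by simp⟩
  have hν : ν.rmass = 0 := by simp [ν, BMeasure.rmass]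
  refine ⟨(s ν).rmass, BMeasure.rmass_nonneg _, fun μ => ?_⟩
  have h1 := abs_le.1 (abs_rmass_sub_le (s μ) (s ν))
  have h2 := H.lipSource μ ν
  have h3 : dist μ ν ≤ μ.rmass := by
    have := dist_le_of_common_le (μ := μ) (ν := ν) (σ := 0) (Measure.zero_le _) (Measure.zero_le _)
    simpa [hν] using this
  have := mul_le_mul_of_nonneg_left h3 H.L_nonneg
  linarith

/-- The free Euler step is Lipschitz continuous on measures carried by a ball. -/
theorem dist_freeStep_le (H : IsRegular V s C L R₀) {R : ℝ} (hR : 0 ≤ R) :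
    ∃ K : ℝ, 0 ≤ K ∧ ∀ μ ν : BMeasure (E n), μ.toMeasure (Metric.closedBall 0 R)ᶜ = 0 →
      ν.toMeasure (Metric.closedBall 0 R)ᶜ = 0 → ∀ τ : ℝ, 0 ≤ τ →
      dist (freeStep V s τ μ) (freeStep V s τ ν) ≤ (1 + τ * K) * dist μ ν := by
  obtain ⟨K, hK, h⟩ := H.exists_lipschitz_plan hR
  refine ⟨K + L, add_nonneg hK H.L_nonneg, fun μ ν hμ hν τ hτ => ?_⟩
  -- The flow separates a pair by at most `|x - y| + τ |v - w|`. Only the fibre cost carries a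
  -- factor `τ`, while base cost and mass defect contribute the distance with coefficient exactly 1,
  -- as a Gronwall argument requires.
  have hflow : dist (freeFlow τ (V μ)) (freeFlow τ (V ν)) ≤ (1 + τ * K) * dist μ ν := by
    refine le_of_forall_pos_le_add fun ε hε => ?_
    obtain ⟨p, c₁, c₂, h₁, h₂, hc₁, hc₂, k₁, k₂, l₁, l₂⟩ :=
      h μ ν hμ hν (ε / (τ + 1)) (by positivity)
    have hF : Measurable fun q : E n × E n => q.1 + τ • q.2 := by fun_prop
    have hG : Measurable fun z : (E n × E n) × (E n × E n) =>
      (z.1.1 + τ • z.1.2, z.2.1 + τ • z.2.2) := by fun_prop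
    have e₁ : (p.map fun z => (z.1.1 + τ • z.1.2, z.2.1 + τ • z.2.2)).map Prod.fst
        ≤ (freeFlow τ (V μ)).toMeasure := by
      refine le_trans (le_of_eq ?_) (map_mono_of_le h₁ hF)
      rw [Measure.map_map measurable_fst hG, Measure.map_map hF measurable_fst]; rfl
    have e₂ : (p.map fun z => (z.1.1 + τ • z.1.2, z.2.1 + τ • z.2.2)).map Prod.snd
        ≤ (freeFlow τ (V ν)).toMeasure := by
      refine le_trans (le_of_eq ?_) (map_mono_of_le h₂ hF)
      rw [Measure.map_map measurable_snd hG, Measure.map_map hF measurable_snd]; rfl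
    have hcost : cost (p.map fun z => (z.1.1 + τ • z.1.2, z.2.1 + τ • z.2.2))
        ≤ ENNReal.ofReal (c₁ + τ * c₂) := by
      rw [cost, lintegral_map (by fun_prop) hG, ENNReal.ofReal_add hc₁ (by positivity),
        ENNReal.ofReal_mul hτ]
      calc ∫⁻ z, edist (z.1.1 + τ • z.1.2) (z.2.1 + τ • z.2.2) ∂p
          ≤ ∫⁻ z, (edist z.1.1 z.2.1 + ENNReal.ofReal τ * edist z.1.2 z.2.2) ∂p := by
            refine lintegral_mono fun z => ?_
            refine (edist_add_add_le _ _ _ _).trans (add_le_add le_rfl ?_)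
            rw [edist_smul₀, ENNReal.smul_def, smul_eq_mul]
            exact mul_le_mul_left (Real.enorm_of_nonneg hτ).le _
        _ = ∫⁻ z, edist z.1.1 z.2.1 ∂p + ENNReal.ofReal τ * ∫⁻ z, edist z.1.2 z.2.2 ∂p := by
            rw [lintegral_add_left (by fun_prop), lintegral_const_mul _ (by fun_prop)]
        _ ≤ _ := by gcongr
    have := gdist_le_of_subplan e₁ e₂ (by positivity) hcost
    rw [real_univ_map p hG] at this
    have m₁ : (freeFlow τ (V μ)).rmass = μ.rmass := by
      rw [BMeasure.rmass, freeFlow, real_univ_map _ hF, H.rmass_V]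
    have m₂ : (freeFlow τ (V ν)).rmass = ν.rmass := by
      rw [BMeasure.rmass, freeFlow, real_univ_map _ hF, H.rmass_V]
    rw [m₁, m₂, ← dist_eq_gdist] at this
    have h5 : τ * c₂ ≤ τ * (K * dist μ ν + ε / (τ + 1)) := by gcongr
    have h6 : τ * (ε / (τ + 1)) ≤ ε := by
      rw [mul_div_assoc', div_le_iff₀ (by positivity)]
      nlinarith
    linarith
  have hsrc : dist (BMeasure.smul τ.toNNReal (s μ)) (BMeasure.smul τ.toNNReal (s ν))
      ≤ τ * (L * dist μ ν) := by
    refine (dist_smul_smul_le _ _ _).trans ?_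
    rw [Real.coe_toNNReal _ hτ]
    exact mul_le_mul_of_nonneg_left (H.lipSource μ ν) hτ
  have := dist_add_add_le (freeFlow τ (V μ)) (BMeasure.smul τ.toNNReal (s μ))
    (freeFlow τ (V ν)) (BMeasure.smul τ.toNNReal (s ν))
  simp only [freeStep]
  linarith

theorem dist_freeStep_self_le (H : IsRegular V s C L R₀) {μ : BMeasure (E n)} {R : ℝ}
    (hR : 0 ≤ R) (hμ : μ.toMeasure (Metric.closedBall 0 R)ᶜ = 0) {τ : ℝ} (hτ : 0 ≤ τ) :
    dist (freeStep V s τ μ) μ ≤ τ * (C * (1 + R) * μ.rmass + (s μ).rmass) := by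
  have hF : Measurable fun q : E n × E n => q.1 + τ • q.2 := by fun_prop
  have hC := H.C_pos
  have h1 : dist (freeFlow τ (V μ)) μ ≤ (τ * (C * (1 + R))) * (V μ).toMeasure.real univ := by
    refine gdist_le_of_map (V μ).toMeasure hF measurable_fst rfl (H.map_fst μ).symm
      (by positivity) ?_
    filter_upwards [H.ae_bound hR hμ] with p hp
    rw [dist_eq_norm, add_sub_cancel_left, norm_smul, Real.norm_of_nonneg hτ]
    exact mul_le_mul_of_nonneg_left hp.2 hτ
  have h2 := dist_le_of_common_le (μ := freeStep V s τ μ) (ν := freeFlow τ (V μ))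
    (σ := (freeFlow τ (V μ)).toMeasure) (Measure.le_add_right le_rfl) le_rfl
  have h3 : (freeFlow τ (V μ)).rmass = (freeFlow τ (V μ)).toMeasure.real univ := rfl
  have h4 : (freeStep V s τ μ).rmass = (freeFlow τ (V μ)).rmass + τ * (s μ).rmass := by
    rw [freeStep, BMeasure.rmass_add, BMeasure.rmass_smul, Real.coe_toNNReal _ hτ]
  have h5 := dist_triangle (freeStep V s τ μ) (freeFlow τ (V μ)) μ
  rw [H.rmass_V] at h1
  linarith

end IsRegular

/-! ### The weak equation: continuity and consistency -/

/-- The right-hand side of the weak equation for the test function `f`. -/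
def weakRHS (V : BMeasure (E n) → BMeasure (E n × E n)) (s : BMeasure (E n) → BMeasure (E n))
    (f : E n → ℝ) (μ : BMeasure (E n)) : ℝ :=
  (∫ p : E n × E n, fderiv ℝ f p.1 p.2 ∂(V μ).toMeasure) + ∫ x, f x ∂(s μ).toMeasure

theorem exists_bounds_of_testFunction {f : E n → ℝ} (hf : ContDiff ℝ ∞ f)
    (hc : HasCompactSupport f) :
    ∃ A : ℝ≥0, (∀ x, |f x| ≤ A) ∧ LipschitzWith A f ∧ (∀ x, ‖fderiv ℝ f x‖ ≤ A) ∧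
      LipschitzWith A (fderiv ℝ f) := by
  obtain ⟨a, ha⟩ := hc.exists_bound_of_continuous hf.continuous
  have hd : ContDiff ℝ 1 (fderiv ℝ f) := hf.fderiv_right (WithTop.coe_le_coe.2 le_top)
  obtain ⟨b, hb⟩ := (hc.fderiv ℝ).exists_bound_of_continuous hd.continuous
  obtain ⟨c, hcl⟩ := hd.lipschitzWith_of_hasCompactSupport (hc.fderiv ℝ) one_ne_zero
  refine ⟨max (max a.toNNReal b.toNNReal) c, fun x => ?_, ?_, fun x => ?_,
    hcl.weaken (le_max_right _ _)⟩
  · refine (ha x).trans ((Real.le_coe_toNNReal a).trans ?_)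
    exact_mod_cast (le_max_left _ _).trans (le_max_left _ _)
  · refine LipschitzWith.weaken (lipschitzWith_of_nnnorm_fderiv_le (C := b.toNNReal)
      (hf.differentiable (by simp)) fun x => ?_) ((le_max_right _ _).trans (le_max_left _ _))
    exact_mod_cast (hb x).trans (Real.le_coe_toNNReal b)
  · refine (hb x).trans ((Real.le_coe_toNNReal b).trans ?_)
    exact_mod_cast (le_max_right _ _).trans (le_max_left _ _)

theorem continuous_fderiv_pair {f : E n → ℝ} {A : ℝ≥0} (hl : LipschitzWith A (fderiv ℝ f)) :
    Continuous fun p : E n × E n => fderiv ℝ f p.1 p.2 :=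
  (hl.continuous.comp continuous_fst).clm_apply continuous_snd

namespace IsRegular

variable {V : BMeasure (E n) → BMeasure (E n × E n)} {s : BMeasure (E n) → BMeasure (E n)}
  {C L R₀ : ℝ}

theorem abs_fderiv_le (H : IsRegular V s C L R₀) {R : ℝ} (hR : 0 ≤ R) {f : E n → ℝ} {A : ℝ≥0}
    (hA : ∀ x, ‖fderiv ℝ f x‖ ≤ A) {μ : BMeasure (E n)}
    (hμ : μ.toMeasure (Metric.closedBall 0 R)ᶜ = 0) :
    ∀ᵐ p ∂(V μ).toMeasure, |fderiv ℝ f p.1 p.2| ≤ A * (C * (1 + R)) := by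
  filter_upwards [H.ae_bound hR hμ] with p hp
  refine ((fderiv ℝ f p.1).le_opNorm p.2).trans ?_
  exact mul_le_mul (hA _) hp.2 (norm_nonneg _) A.coe_nonneg

theorem integrable_fderiv (H : IsRegular V s C L R₀) {R : ℝ} (hR : 0 ≤ R) {f : E n → ℝ} {A : ℝ≥0}
    (hA : ∀ x, ‖fderiv ℝ f x‖ ≤ A) (hl : LipschitzWith A (fderiv ℝ f)) {μ : BMeasure (E n)}
    (hμ : μ.toMeasure (Metric.closedBall 0 R)ᶜ = 0) :
    Integrable (fun p : E n × E n => fderiv ℝ f p.1 p.2) (V μ).toMeasure :=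
  Integrable.of_bound (continuous_fderiv_pair hl).aestronglyMeasurable _ (H.abs_fderiv_le hR hA hμ)

/-- The right-hand side of the weak equation is Lipschitz continuous for `W^g`. -/
theorem abs_weakRHS_sub_le (H : IsRegular V s C L R₀) {R : ℝ} (hR : 0 ≤ R) {f : E n → ℝ}
    (hf : ContDiff ℝ ∞ f) (hc : HasCompactSupport f) :
    ∃ B : ℝ, 0 ≤ B ∧ ∀ μ ν : BMeasure (E n), μ.toMeasure (Metric.closedBall 0 R)ᶜ = 0 →
      ν.toMeasure (Metric.closedBall 0 R)ᶜ = 0 →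
      |weakRHS V s f μ - weakRHS V s f ν| ≤ B * dist μ ν := by
  obtain ⟨A, hA1, hA2, hA3, hA4⟩ := exists_bounds_of_testFunction hf hc
  obtain ⟨K, hK, h⟩ := H.exists_lipschitz_plan hR
  have hC := H.C_pos
  have hL := H.L_nonneg
  set v := C * (1 + R) with hv
  have hv0 : 0 ≤ v := by positivity
  refine ⟨A * v + A * K + A * L, by positivity, fun μ ν hμ hν => ?_⟩
  have h1 : |(∫ p : E n × E n, fderiv ℝ f p.1 p.2 ∂(V μ).toMeasure)
      - ∫ p : E n × E n, fderiv ℝ f p.1 p.2 ∂(V ν).toMeasure| ≤ (A * v + A * K) * dist μ ν := by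
    refine le_of_forall_pos_le_add fun ε hε => ?_
    obtain ⟨p, c₁, c₂, h₁, h₂, hc₁, hc₂, k₁, k₂, l₁, l₂⟩ :=
      h μ ν hμ hν (ε / (A + 1)) (by positivity)
    have hcost : ∫⁻ z, edist (fderiv ℝ f z.1.1 z.1.2) (fderiv ℝ f z.2.1 z.2.2) ∂p
        ≤ ENNReal.ofReal (A * v * c₁ + A * c₂) := by
      -- The integrand is linear in the velocity and so need not be globally Lipschitz; the velocity
      -- bound on one marginal controls the variation of the gradient in `x`.
      have hae : ∀ᵐ z ∂p, ‖z.1.2‖ ≤ v := by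
        have h0 : ∀ᵐ q ∂p.map Prod.fst, ‖q.2‖ ≤ v :=
          (Measure.absolutelyContinuous_of_le h₁).ae_le
            ((H.ae_bound hR hμ).mono fun q hq => hq.2)
        exact ae_of_ae_map measurable_fst.aemeasurable h0
      calc ∫⁻ z, edist (fderiv ℝ f z.1.1 z.1.2) (fderiv ℝ f z.2.1 z.2.2) ∂p
          ≤ ∫⁻ z, (ENNReal.ofReal (A * v) * edist z.1.1 z.2.1
              + ENNReal.ofReal A * edist z.1.2 z.2.2) ∂p := by
            refine lintegral_mono_ae ?_
            filter_upwards [hae] with z hz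
            rw [edist_dist, edist_dist, edist_dist, ← ENNReal.ofReal_mul (by positivity),
              ← ENNReal.ofReal_mul (by positivity),
              ← ENNReal.ofReal_add (by positivity) (by positivity)]
            refine ENNReal.ofReal_le_ofReal ?_
            have e : fderiv ℝ f z.1.1 z.1.2 - fderiv ℝ f z.2.1 z.2.2 =
              (fderiv ℝ f z.1.1 - fderiv ℝ f z.2.1) z.1.2
                + fderiv ℝ f z.2.1 (z.1.2 - z.2.2) := by
              rw [map_sub, sub_apply]; ring
            rw [dist_eq_norm, e]
            refine (norm_add_le _ _).trans (add_le_add ?_ ?_)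
            · refine (ContinuousLinearMap.le_opNorm _ _).trans ?_
              have := hA4.dist_le_mul z.1.1 z.2.1
              rw [dist_eq_norm] at this
              calc _ ≤ (A * dist z.1.1 z.2.1) * v :=
                    mul_le_mul this hz (norm_nonneg _) (by positivity)
                _ = _ := by ring
            · refine (ContinuousLinearMap.le_opNorm _ _).trans ?_
              rw [dist_eq_norm]
              exact mul_le_mul_of_nonneg_right (hA3 _) (norm_nonneg _)
        _ = ENNReal.ofReal (A * v) * ∫⁻ z, edist z.1.1 z.2.1 ∂p
              + ENNReal.ofReal A * ∫⁻ z, edist z.1.2 z.2.2 ∂p := by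
            rw [lintegral_add_left (by fun_prop), lintegral_const_mul _ (by fun_prop),
              lintegral_const_mul _ (by fun_prop)]
        _ ≤ _ := by
            rw [ENNReal.ofReal_add (by positivity) (by positivity),
              ENNReal.ofReal_mul (p := A * v) (by positivity),
              ENNReal.ofReal_mul (p := (A : ℝ)) (q := c₂) (by positivity)]
            gcongr
    have := abs_integral_sub_integral_le h₁ h₂ (continuous_fderiv_pair hA4).measurable
      (H.abs_fderiv_le hR hA3 hμ) (H.abs_fderiv_le hR hA3 hν) (by positivity) hcost
    rw [H.rmass_V, H.rmass_V] at this
    have g1 : A * v * (μ.rmass + ν.rmass - 2 * p.real univ + c₁) ≤ A * v * dist μ ν := by gcongr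
    have g2 : A * c₂ ≤ A * (K * dist μ ν + ε / (A + 1)) := by gcongr
    have g3 : (A : ℝ) * (ε / (A + 1)) ≤ ε := by
      rw [mul_div_assoc', div_le_iff₀ (by positivity)]
      nlinarith
    linarith
  have h2 := abs_integral_sub_le_gdist hA1 hA2 (s μ) (s ν)
  have h3 : A * gdist (s μ) (s ν) ≤ A * (L * dist μ ν) := by
    gcongr
    exact H.lipSource μ ν
  have e : weakRHS V s f μ - weakRHS V s f ν =
      ((∫ p : E n × E n, fderiv ℝ f p.1 p.2 ∂(V μ).toMeasure)
      - ∫ p : E n × E n, fderiv ℝ f p.1 p.2 ∂(V ν).toMeasure)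
      + (∫ x, f x ∂(s μ).toMeasure - ∫ x, f x ∂(s ν).toMeasure) := by
    simp only [weakRHS]; ring
  rw [e]
  refine (abs_add_le _ _).trans ?_
  linarith

/-- Consistency of the free Euler step with the weak equation. -/
theorem abs_integral_freeStep_sub_le (H : IsRegular V s C L R₀) {R : ℝ} (hR : 0 ≤ R)
    {f : E n → ℝ} (hf : ContDiff ℝ ∞ f) (hc : HasCompactSupport f) (M : ℝ) :
    ∃ B : ℝ, 0 ≤ B ∧ ∀ μ ∈ massBall n R M, ∀ τ : ℝ, 0 ≤ τ →
      |∫ x, f x ∂(freeStep V s τ μ).toMeasure - ∫ x, f x ∂μ.toMeasure - τ * weakRHS V s f μ|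
        ≤ B * τ ^ 2 := by
  obtain ⟨A, hA1, hA2, hA3, hA4⟩ := exists_bounds_of_testFunction hf hc
  have hC := H.C_pos
  refine ⟨A * (C * (1 + R)) ^ 2 * |M|, by positivity, fun μ hμ τ hτ => ?_⟩
  have hcont : Continuous fun p : E n × E n => p.1 + τ • p.2 := by fun_prop
  have hi : ∀ m : Measure (E n), IsFiniteMeasure m → Integrable f m := fun m _ =>
    Integrable.of_bound hf.continuous.aestronglyMeasurable _ (ae_of_all _ hA1)
  -- The source enters linearly in `τ`, so it produces no consistency error; only the transport term
  -- does.
  have e1 : ∫ x, f x ∂(freeStep V s τ μ).toMeasure =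
      ∫ p, f (p.1 + τ • p.2) ∂(V μ).toMeasure + τ * ∫ x, f x ∂(s μ).toMeasure := by
    have : (freeStep V s τ μ).toMeasure = (V μ).toMeasure.map (fun p => p.1 + τ • p.2)
      + τ.toNNReal • (s μ).toMeasure := rfl
    rw [this, integral_add_measure (hi _ inferInstance) (hi _ inferInstance),
      integral_map hcont.measurable.aemeasurable hf.continuous.aestronglyMeasurable,
      integral_smul_nnreal_measure, NNReal.smul_def, Real.coe_toNNReal _ hτ, smul_eq_mul]
  have e2 : ∫ x, f x ∂μ.toMeasure = ∫ p, f p.1 ∂(V μ).toMeasure := by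
    rw [← H.map_fst μ, integral_map measurable_fst.aemeasurable
      hf.continuous.aestronglyMeasurable]
  have i1 : Integrable (fun p : E n × E n => f (p.1 + τ • p.2)) (V μ).toMeasure :=
    Integrable.of_bound (hf.continuous.comp hcont).aestronglyMeasurable _
      (ae_of_all _ fun p => hA1 _)
  have i2 : Integrable (fun p : E n × E n => f p.1) (V μ).toMeasure :=
    Integrable.of_bound (hf.continuous.comp continuous_fst).aestronglyMeasurable _
      (ae_of_all _ fun p => hA1 _)
  have i3 := H.integrable_fderiv hR hA3 hA4 hμ.1
  have e3 : ∫ x, f x ∂(freeStep V s τ μ).toMeasure - ∫ x, f x ∂μ.toMeasure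
      - τ * weakRHS V s f μ = ∫ p, (f (p.1 + τ • p.2) - f p.1 - τ * fderiv ℝ f p.1 p.2)
        ∂(V μ).toMeasure := by
    have i12 : Integrable (fun p : E n × E n => f (p.1 + τ • p.2) - f p.1) (V μ).toMeasure :=
      i1.sub i2
    rw [integral_sub i12 (i3.const_mul τ), integral_sub i1 i2, integral_const_mul, e1, e2,
      weakRHS]
    ring
  rw [e3]
  have hb : ∀ᵐ p ∂(V μ).toMeasure, ‖f (p.1 + τ • p.2) - f p.1 - τ * fderiv ℝ f p.1 p.2‖
      ≤ A * (C * (1 + R)) ^ 2 * τ ^ 2 := by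
    filter_upwards [H.ae_bound hR hμ.1] with p hp
    -- First-order Taylor remainder: on the segment the derivative differs from its value at `p.1`
    -- by at most `A τ ‖p.2‖`.
    have hmv := (convex_segment p.1 (p.1 + τ • p.2)).norm_image_sub_le_of_norm_hasFDerivWithin_le'
      (f := f) (f' := fderiv ℝ f) (φ := fderiv ℝ f p.1) (C := A * (τ * ‖p.2‖))
      (fun x _ => ((hf.differentiable (by simp)) x).hasFDerivAt.hasFDerivWithinAt)
      (fun x hx => by
        have h0 := hA4.dist_le_mul x p.1
        rw [dist_eq_norm, dist_eq_norm] at h0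
        refine h0.trans ?_
        gcongr
        have := norm_sub_le_of_mem_segment hx
        simpa [norm_smul, abs_of_nonneg hτ] using this)
      (left_mem_segment ℝ _ _) (right_mem_segment ℝ _ _)
    rw [add_sub_cancel_left, map_smul, smul_eq_mul, norm_smul, Real.norm_of_nonneg hτ] at hmv
    refine hmv.trans ?_
    calc A * (τ * ‖p.2‖) * (τ * ‖p.2‖) = A * ‖p.2‖ ^ 2 * τ ^ 2 := by ring
      _ ≤ _ := by gcongr; exact hp.2
  have := norm_integral_le_of_norm_le_const hb
  rw [Real.norm_eq_abs, H.rmass_V] at this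
  refine this.trans ?_
  have : μ.rmass ≤ |M| := hμ.2.trans (le_abs_self _)
  calc _ ≤ A * (C * (1 + R)) ^ 2 * τ ^ 2 * |M| := by gcongr
    _ = _ := by ring

end IsRegular

/-! ### Rounding to the grid -/

/-- The index of the grid cell of mesh `h` that contains `x`. -/
def cellIndex (h : ℝ) (x : E n) : Fin n → ℤ := fun i => ⌊x i / h⌋

/-- The corner of the grid cell of mesh `h` that contains `x`. -/
def gridRound (h : ℝ) (x : E n) : E n := gridPoint h (cellIndex h x)

theorem measurable_cellIndex (h : ℝ) : Measurable (cellIndex (n := n) h) := by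
  refine measurable_pi_lambda _ fun i => ?_
  have : Measurable fun x : E n => x i / h := by fun_prop
  exact Int.measurable_floor.comp this

theorem measurable_gridRound (h : ℝ) : Measurable (gridRound (n := n) h) :=
  (Measurable.of_discrete (f := gridPoint h)).comp (measurable_cellIndex h)

theorem cellIndex_eq_iff {h : ℝ} (hh : 0 < h) {x : E n} {z : Fin n → ℤ} :
    cellIndex h x = z ↔ x ∈ gridCell h z := by
  simp only [gridCell, mem_ofPred_eq, funext_iff, cellIndex]
  refine forall_congr' fun i => ?_
  rw [Int.floor_eq_iff, le_div_iff₀ hh, div_lt_iff₀ hh]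
  constructor
  · rintro ⟨a, b⟩
    exact ⟨by linarith, by linarith⟩
  · rintro ⟨a, b⟩
    exact ⟨by linarith, by linarith⟩

theorem gridCell_eq_preimage {h : ℝ} (hh : 0 < h) (z : Fin n → ℤ) :
    gridCell (n := n) h z = cellIndex h ⁻¹' {z} := by
  ext x
  simp [cellIndex_eq_iff hh]

theorem dist_gridRound_le {h : ℝ} (hh : 0 < h) (x : E n) :
    dist (gridRound h x) x ≤ √n * h := by
  rw [EuclideanSpace.dist_eq]
  have hx : x ∈ gridCell h (cellIndex h x) := (cellIndex_eq_iff hh).1 rfl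
  have : ∀ i, dist (gridRound h x i) (x i) ^ 2 ≤ h ^ 2 := fun i => by
    obtain ⟨a, b⟩ := hx i
    have e : gridRound h x i = h * (cellIndex h x i : ℝ) := rfl
    rw [Real.dist_eq, e, sq_abs]
    nlinarith
  calc √(∑ i, dist (gridRound h x i) (x i) ^ 2) ≤ √(∑ _i : Fin n, h ^ 2) :=
        Real.sqrt_le_sqrt (Finset.sum_le_sum fun i _ => this i)
    _ = √n * h := by
        rw [Finset.sum_const, Finset.card_univ, Fintype.card_fin, nsmul_eq_mul,
          Real.sqrt_mul (by positivity), Real.sqrt_sq hh.le]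

theorem norm_gridRound_le {h : ℝ} (hh : 0 < h) {x : E n} {r : ℝ} (hx : ‖x‖ ≤ r) :
    ‖gridRound h x‖ ≤ r + √n * h := by
  have h1 := dist_gridRound_le hh x
  rw [dist_eq_norm] at h1
  have h3 : ‖gridRound h x‖ ≤ ‖x‖ + ‖gridRound h x - x‖ := by
    simpa using norm_add_le x (gridRound h x - x)
  linarith

theorem cellIndex_mem_gridIndex {h : ℝ} (hh : 0 < h) {m : ℕ} {x : E n} (hx : ‖x‖ ≤ h * m) :
    cellIndex h x ∈ gridIndex n m := by
  have hi : ∀ i, |x i| ≤ h * m := fun i => by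
    have := PiLp.norm_apply_le x i
    rw [Real.norm_eq_abs] at this
    exact this.trans hx
  rw [gridIndex, Finset.mem_Icc]
  refine ⟨fun i => ?_, fun i => ?_⟩
  · have := (abs_le.1 (hi i)).1
    change -(m : ℤ) ≤ ⌊x i / h⌋
    rw [Int.le_floor, le_div_iff₀ hh]
    push_cast
    linarith
  · have := (abs_le.1 (hi i)).2
    change ⌊x i / h⌋ ≤ (m : ℤ)
    have h1 : x i / h ≤ m := by rw [div_le_iff₀ hh]; linarith
    have h2 : ((⌊x i / h⌋ : ℤ) : ℝ) ≤ ((m : ℤ) : ℝ) :=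
      (Int.floor_le (x i / h)).trans (by exact_mod_cast h1)
    exact Int.cast_le.1 h2

/-- A measure on a partitioned space, collapsed to one point for each part. -/
theorem sum_smul_dirac_eq_map {Y ι : Type*} [MeasurableSpace Y] [MeasurableSpace ι]
    [MeasurableSingletonClass ι] [Countable ι] (m : Measure Y) [IsFiniteMeasure m] {z : Y → ι}
    (hz : Measurable z) (I : Finset ι) (hI : ∀ᵐ y ∂m, z y ∈ I) (x : ι → E n) :
    ∑ i ∈ I, (m (z ⁻¹' {i})).toNNReal • Measure.dirac (x i) = m.map (fun y => x (z y)) := by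
  have hx : Measurable x := Measurable.of_discrete
  have hxz : Measurable fun y => x (z y) := hx.comp hz
  ext t ht
  rw [Measure.map_apply hxz ht, Measure.finsetSum_apply]
  have hsplit : m ((fun y => x (z y)) ⁻¹' t) =
      ∑ i ∈ I, m ((fun y => x (z y)) ⁻¹' t ∩ z ⁻¹' {i}) := by
    rw [← measure_biUnion_finset]
    · refine measure_congr ?_
      filter_upwards [hI] with y hy
      refine propext ⟨fun h => ?_, fun h => ?_⟩
      · exact mem_biUnion (show z y ∈ (I : Set ι) from hy) ⟨h, rfl⟩
      · obtain ⟨i, -, hi⟩ := mem_iUnion₂.1 h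
        exact hi.1
    · intro i _ j _ hij
      refine Set.disjoint_left.2 fun y hy hy' => hij ?_
      exact hy.2.symm.trans hy'.2
    · intro i _
      exact (hxz ht).inter (hz (measurableSet_singleton i))
  rw [hsplit]
  refine Finset.sum_congr rfl fun i _ => ?_
  rw [Measure.smul_apply, Measure.dirac_apply' _ ht]
  by_cases h : x i ∈ t
  · have : (fun y => x (z y)) ⁻¹' t ∩ z ⁻¹' {i} = z ⁻¹' {i} := by
      refine inter_eq_right.2 fun y hy => ?_
      rw [mem_preimage, mem_singleton_iff] at hy
      simpa [hy] using h
    rw [this]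
    simp [h, ENNReal.smul_def]
  · have : (fun y => x (z y)) ⁻¹' t ∩ z ⁻¹' {i} = ∅ := by
      refine eq_empty_of_forall_notMem fun y hy => h ?_
      have h2 : z y = i := hy.2
      simpa [← h2] using hy.1
    rw [this]
    simp [h]

theorem meshX_pos {N : ℕ} (hN : 0 < N) : 0 < meshX N := by
  rw [meshX]; positivity

theorem meshV_pos {N : ℕ} (hN : 0 < N) : 0 < meshV N := by
  rw [meshV]; positivity

/-- When the grid covers the measure no mass is cut off, and the sum of Dirac masses is an image
under the rounding map; the later estimates use only this form. The closed ball is allowed because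
the index range includes its upper end `N³`. -/
theorem toMeasure_discretize {N : ℕ} (hN : 0 < N) (c : ℝ≥0) {μ : BMeasure (E n)}
    (hμ : μ.toMeasure (Metric.closedBall 0 N)ᶜ = 0) :
    (discretize N c μ).toMeasure = c • μ.toMeasure.map (gridRound (meshX N)) := by
  have h := meshX_pos hN
  have hI : ∀ᵐ x ∂μ.toMeasure, cellIndex (meshX N) x ∈ gridIndex n (N ^ 3) := by
    have : ∀ᵐ x ∂μ.toMeasure, x ∈ Metric.closedBall (0 : E n) N := hμ
    filter_upwards [this] with x hx
    refine cellIndex_mem_gridIndex h ?_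
    rw [mem_closedBall_zero_iff] at hx
    refine hx.trans (le_of_eq ?_)
    have : (N : ℝ) ≠ 0 := by positivity
    rw [meshX]; push_cast; field_simp
  have e := sum_smul_dirac_eq_map μ.toMeasure (measurable_cellIndex (meshX N)) _ hI
    (gridPoint (meshX N))
  have e' : (discretize N c μ).toMeasure = ∑ z ∈ gridIndex n (N ^ 3),
      (c * (μ.toMeasure (gridCell (meshX N) z)).toNNReal)
        • Measure.dirac (gridPoint (meshX N) z) := rfl
  rw [e']
  simp only [mul_smul, ← Finset.smul_sum, gridCell_eq_preimage h]
  rw [e]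
  rfl

theorem toMeasure_latticeTransport {N : ℕ} (hN : 0 < N) (τ : ℝ) {U : BMeasure (E n × E n)}
    (hU : ∀ᵐ p ∂U.toMeasure, ‖p.1‖ ≤ N ∧ ‖p.2‖ ≤ N) :
    (latticeTransport N τ U).toMeasure =
      U.toMeasure.map fun p => gridRound (meshX N) p.1 + τ • gridRound (meshV N) p.2 := by
  have h := meshX_pos hN
  have h' := meshV_pos hN
  have hN0 : (N : ℝ) ≠ 0 := by positivity
  have hm : Measurable fun p : E n × E n => (cellIndex (meshX N) p.1, cellIndex (meshV N) p.2) :=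
    ((measurable_cellIndex _).comp measurable_fst).prodMk
      ((measurable_cellIndex _).comp measurable_snd)
  have hI : ∀ᵐ p ∂U.toMeasure, (cellIndex (meshX N) p.1, cellIndex (meshV N) p.2) ∈
      gridIndex n (N ^ 3) ×ˢ gridIndex n (N ^ 2) := by
    filter_upwards [hU] with p hp
    rw [Finset.mem_product]
    refine ⟨cellIndex_mem_gridIndex h (hp.1.trans (le_of_eq ?_)),
      cellIndex_mem_gridIndex h' (hp.2.trans (le_of_eq ?_))⟩
    · rw [meshX]; push_cast; field_simp
    · rw [meshV]; push_cast; field_simp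
  have e := sum_smul_dirac_eq_map U.toMeasure hm _ hI
    (fun q => gridPoint (n := n) (meshX N) q.1 + τ • gridPoint (meshV N) q.2)
  refine Eq.trans ?_ e
  refine Finset.sum_congr rfl fun q _ => ?_
  have : gridCell (meshX N) q.1 ×ˢ gridCell (meshV N) q.2 =
      (fun p : E n × E n => (cellIndex (meshX N) p.1, cellIndex (meshV N) p.2)) ⁻¹' {q} := by
    rw [gridCell_eq_preimage h, gridCell_eq_preimage h']
    ext p
    simp [Prod.ext_iff]
  rw [← this]

theorem measurable_roundFlow (N : ℕ) (τ : ℝ) : Measurable fun p : E n × E n =>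
    gridRound (meshX N) p.1 + τ • gridRound (meshV N) p.2 :=
  ((measurable_gridRound _).comp measurable_fst).add
    (((measurable_gridRound _).comp measurable_snd).const_smul τ)

section Discretize

variable {N : ℕ} {μ : BMeasure (E n)} {R : ℝ}

theorem carried_mono {R' : ℝ} (h : R ≤ R') (hμ : μ.toMeasure (Metric.closedBall 0 R)ᶜ = 0) :
    μ.toMeasure (Metric.closedBall 0 R')ᶜ = 0 :=
  measure_mono_null (compl_subset_compl.2 (Metric.closedBall_subset_closedBall h)) hμ

theorem rmass_discretize (hN : 0 < N) (c : ℝ≥0)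
    (hμ : μ.toMeasure (Metric.closedBall 0 N)ᶜ = 0) :
    (discretize N c μ).rmass = c * μ.rmass := by
  rw [BMeasure.rmass, toMeasure_discretize hN c hμ, measureReal_nnreal_smul_apply,
    real_univ_map _ (measurable_gridRound _)]
  rfl

theorem carried_discretize (hN : 0 < N) (c : ℝ≥0) (hRN : R ≤ N)
    (hμ : μ.toMeasure (Metric.closedBall 0 R)ᶜ = 0) :
    (discretize N c μ).toMeasure (Metric.closedBall 0 (R + √n * meshX N))ᶜ = 0 := by
  rw [toMeasure_discretize hN c (carried_mono hRN hμ), Measure.smul_apply,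
    Measure.map_apply (measurable_gridRound _) Metric.isClosed_closedBall.measurableSet.compl]
  have : μ.toMeasure (gridRound (meshX N) ⁻¹' (Metric.closedBall 0 (R + √n * meshX N))ᶜ) = 0 := by
    refine measure_mono_null (t := (Metric.closedBall 0 R)ᶜ) (fun x hx hx' => hx ?_) hμ
    rw [mem_closedBall_zero_iff] at hx' ⊢
    exact norm_gridRound_le (meshX_pos hN) hx'
  rw [this, smul_zero]

theorem dist_discretize_le (hN : 0 < N) (c : ℝ≥0)
    (hμ : μ.toMeasure (Metric.closedBall 0 N)ᶜ = 0) :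
    dist (discretize N c μ) (BMeasure.smul c μ) ≤ c * (√n * meshX N * μ.rmass) := by
  have h := meshX_pos hN
  have := gdist_le_of_map (c • μ.toMeasure) (measurable_gridRound (meshX N)) measurable_id
    (μ := discretize N c μ) (ν := BMeasure.smul c μ) (c := √n * meshX N)
    (by rw [toMeasure_discretize hN c hμ, Measure.map_smul]) (by simp [BMeasure.smul])
    (by positivity) (ae_of_all _ fun x => dist_gridRound_le h x)
  rw [measureReal_nnreal_smul_apply] at this
  rw [dist_eq_gdist]
  refine this.trans (le_of_eq ?_)
  rw [BMeasure.rmass]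
  ring

theorem BMeasure.one_smul (μ : BMeasure (E n)) : BMeasure.smul 1 μ = μ :=
  BMeasure.ext (by simp [BMeasure.smul])

theorem dist_discretize_one_le (hN : 0 < N)
    (hμ : μ.toMeasure (Metric.closedBall 0 N)ᶜ = 0) :
    dist (discretize N 1 μ) μ ≤ √n * meshX N * μ.rmass := by
  simpa [BMeasure.one_smul] using dist_discretize_le hN 1 hμ

end Discretize

/-! ### One step of the lattice scheme -/

namespace IsRegular

variable {V : BMeasure (E n) → BMeasure (E n × E n)} {s : BMeasure (E n) → BMeasure (E n)}
  {C L R₀ : ℝ} {N : ℕ} {τ R : ℝ} {μ : BMeasure (E n)}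

/-- The grid of index `N` covers the positions and velocities of measures carried by the ball of
radius `R`. -/
structure Covers (C R₀ R : ℝ) (N : ℕ) : Prop where
  pos : 0 < N
  nonneg : 0 ≤ R
  source_le : R₀ ≤ R
  le : R ≤ N
  vel_le : C * (1 + R) ≤ N

theorem ae_covered (H : IsRegular V s C L R₀) (hN : Covers C R₀ R N)
    (hμ : μ.toMeasure (Metric.closedBall 0 R)ᶜ = 0) :
    ∀ᵐ p ∂(V μ).toMeasure, ‖p.1‖ ≤ N ∧ ‖p.2‖ ≤ N := by
  filter_upwards [H.ae_bound hN.nonneg hμ] with p hp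
  exact ⟨hp.1.trans hN.le, hp.2.trans hN.vel_le⟩

theorem carried_source (H : IsRegular V s C L R₀) (hN : Covers C R₀ R N) :
    (s μ).toMeasure (Metric.closedBall 0 R)ᶜ = 0 :=
  carried_mono hN.source_le (H.supp_source μ)

theorem rmass_eulerStep (H : IsRegular V s C L R₀) (hN : Covers C R₀ R N)
    (hμ : μ.toMeasure (Metric.closedBall 0 R)ᶜ = 0) (hτ : 0 ≤ τ) :
    (eulerStep V s N τ μ).rmass = μ.rmass + τ * (s μ).rmass := by
  rw [eulerStep, BMeasure.rmass_add,
    rmass_discretize hN.pos _ (carried_mono hN.le (H.carried_source hN)),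
    Real.coe_toNNReal _ hτ, BMeasure.rmass, toMeasure_latticeTransport hN.pos τ
    (H.ae_covered hN hμ), real_univ_map _ (measurable_roundFlow N τ), H.rmass_V]

/-- With τ ≤ 1/N, rounding a velocity displaces the endpoint by at most √n/N², the same as rounding
a position; hence the factor 2. -/
theorem carried_eulerStep (H : IsRegular V s C L R₀) (hN : Covers C R₀ R N)
    (hμ : μ.toMeasure (Metric.closedBall 0 R)ᶜ = 0) (hτ : 0 ≤ τ) (hτN : τ ≤ meshV N) :
    (eulerStep V s N τ μ).toMeasure
      (Metric.closedBall 0 (R + τ * (C * (1 + R)) + 2 * √n * meshX N))ᶜ = 0 := by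
  have hx := meshX_pos hN.pos
  have hv := meshV_pos hN.pos
  have hC := H.C_pos
  have hR := hN.nonneg
  have hxv : meshX N = meshV N * meshV N := by rw [meshX, meshV]; ring
  have hτx : τ * meshV N ≤ meshX N := by
    rw [hxv]; gcongr
  have hnn : (0 : ℝ) ≤ √n := Real.sqrt_nonneg _
  have e : (eulerStep V s N τ μ).toMeasure = (latticeTransport N τ (V μ)).toMeasure
    + (discretize N τ.toNNReal (s μ)).toMeasure := rfl
  rw [e, Measure.add_apply, add_eq_zero]
  refine ⟨?_, ?_⟩
  · rw [toMeasure_latticeTransport hN.pos τ (H.ae_covered hN hμ), Measure.map_apply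
      (measurable_roundFlow N τ) Metric.isClosed_closedBall.measurableSet.compl]
    have : ∀ᵐ p ∂(V μ).toMeasure, gridRound (meshX N) p.1 + τ • gridRound (meshV N) p.2 ∈
        Metric.closedBall (0 : E n) (R + τ * (C * (1 + R)) + 2 * √n * meshX N) := by
      filter_upwards [H.ae_bound hR hμ] with p hp
      rw [mem_closedBall_zero_iff]
      refine (norm_add_le _ _).trans ?_
      rw [norm_smul, Real.norm_of_nonneg hτ]
      have h1 := norm_gridRound_le hx hp.1
      have h2 := mul_le_mul_of_nonneg_left (norm_gridRound_le hv hp.2) hτ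
      have h3 := mul_le_mul_of_nonneg_left hτx hnn
      linarith
    exact this
  · refine carried_mono ?_ (carried_discretize hN.pos _ hN.le (H.carried_source hN))
    have : 0 ≤ τ * (C * (1 + R)) := by positivity
    have : 0 ≤ √n * meshX N := by positivity
    linarith

/-- Both steps are images of the same measures, up to rounding of positions and velocities. The
error is of order 1/N² rather than τ, so that about NT steps accumulate only O(1/N). -/
theorem dist_eulerStep_freeStep_le (H : IsRegular V s C L R₀) (hN : Covers C R₀ R N)
    (hμ : μ.toMeasure (Metric.closedBall 0 R)ᶜ = 0) (hτ : 0 ≤ τ) (hτN : τ ≤ meshV N) :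
    dist (eulerStep V s N τ μ) (freeStep V s τ μ) ≤
      2 * √n * meshX N * (μ.rmass + (s μ).rmass) := by
  have hx := meshX_pos hN.pos
  have hv := meshV_pos hN.pos
  have hxv : meshX N = meshV N * meshV N := by rw [meshX, meshV]; ring
  have hτx : τ * meshV N ≤ meshX N := by
    rw [hxv]; gcongr
  have hnn : (0 : ℝ) ≤ √n := Real.sqrt_nonneg _
  have hm := μ.rmass_nonneg
  have hms := (s μ).rmass_nonneg
  have h1 : dist (latticeTransport N τ (V μ)) (freeFlow τ (V μ)) ≤
      2 * √n * meshX N * (V μ).toMeasure.real univ := by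
    refine gdist_le_of_map (V μ).toMeasure (measurable_roundFlow N τ)
      (g := fun p => p.1 + τ • p.2) (by fun_prop)
      (toMeasure_latticeTransport hN.pos τ (H.ae_covered hN hμ)) rfl (by positivity)
      (ae_of_all _ fun p => ?_)
    refine (_root_.dist_add_add_le _ _ _ _).trans ?_
    rw [dist_smul₀, Real.norm_of_nonneg hτ]
    have h1 := dist_gridRound_le hx p.1
    have h2 := mul_le_mul_of_nonneg_left (dist_gridRound_le hv p.2) hτ
    have h3 := mul_le_mul_of_nonneg_left hτx hnn
    linarith
  have h2 := dist_discretize_le hN.pos τ.toNNReal (carried_mono hN.le (H.carried_source (μ := μ) hN))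
  have h3 := MDES.dist_add_add_le (latticeTransport N τ (V μ)) (discretize N τ.toNNReal (s μ))
    (freeFlow τ (V μ)) (BMeasure.smul τ.toNNReal (s μ))
  rw [H.rmass_V] at h1
  rw [Real.coe_toNNReal _ hτ] at h2
  have hτ1 : τ ≤ 2 := hτN.trans (by
    rw [meshV, div_le_iff₀ (by exact_mod_cast hN.pos)]
    have : (1 : ℝ) ≤ N := by exact_mod_cast hN.pos
    linarith)
  have h4 : τ * (√n * meshX N * (s μ).rmass) ≤ 2 * (√n * meshX N * (s μ).rmass) := by
    gcongr
  have h5 : dist (eulerStep V s N τ μ) (freeStep V s τ μ) = dist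
    ((latticeTransport N τ (V μ)).add (discretize N τ.toNNReal (s μ)))
    ((freeFlow τ (V μ)).add (BMeasure.smul τ.toNNReal (s μ))) := rfl
  rw [h5]
  linarith

end IsRegular

/-! ### Iterates of the scheme: invariant sets and discrete Gronwall estimates -/

theorem meshX_eq (N : ℕ) : meshX N = meshV N * meshV N := by rw [meshX, meshV]; ring

theorem meshV_le_one {N : ℕ} (hN : 0 < N) : meshV N ≤ 1 := by
  rw [meshV, div_le_iff₀ (by exact_mod_cast hN)]
  have : (1 : ℝ) ≤ N := by exact_mod_cast hN
  linarith

theorem meshV_mul {N : ℕ} (hN : 0 < N) : meshV N * N = 1 := by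
  have : (N : ℝ) ≠ 0 := by positivity
  rw [meshV]; field_simp

theorem tendsto_meshV : Tendsto meshV atTop (𝓝 0) := tendsto_one_div_atTop_nhds_zero_nat

/-- One step of a discrete Gronwall estimate. -/
theorem gronwall_step {a b c t τ κ x y : ℝ} (ha : 0 ≤ a) (ht : 0 ≤ t) (hτ : 0 ≤ τ) (hb : 0 ≤ b)
    (hc : 0 ≤ c) (hκ : 0 ≤ κ) (hx : x ≤ Real.exp (a * t) * (b + κ * c))
    (hy : y ≤ (1 + τ * a) * x + c) : y ≤ Real.exp (a * (t + τ)) * (b + (κ + 1) * c) := by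
  have h1 : 1 + τ * a ≤ Real.exp (a * τ) := by
    have := Real.add_one_le_exp (a * τ)
    linarith
  have h2 : 1 ≤ Real.exp (a * (t + τ)) := Real.one_le_exp (by positivity)
  have h3 : (1 + τ * a) * x ≤ Real.exp (a * τ) * (Real.exp (a * t) * (b + κ * c)) := by
    calc (1 + τ * a) * x ≤ (1 + τ * a) * (Real.exp (a * t) * (b + κ * c)) := by gcongr
      _ ≤ _ := by gcongr
  have h4 : Real.exp (a * τ) * (Real.exp (a * t) * (b + κ * c)) =
      Real.exp (a * (t + τ)) * (b + κ * c) := by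
    rw [mul_add a t τ, Real.exp_add]; ring
  have h5 : c ≤ Real.exp (a * (t + τ)) * c := le_mul_of_one_le_left hc h2
  linarith

/-- The iterates of the lattice scheme. -/
def latticeIter (V : BMeasure (E n) → BMeasure (E n × E n)) (s : BMeasure (E n) → BMeasure (E n))
    (N k : ℕ) (μ : BMeasure (E n)) : BMeasure (E n) :=
  (eulerStep V s N (meshV N))^[k] μ

/-- The interpolated lattice scheme, started at an arbitrary measure. -/
def latticeOrbit (V : BMeasure (E n) → BMeasure (E n × E n)) (s : BMeasure (E n) → BMeasure (E n))
    (N : ℕ) (μ : BMeasure (E n)) (t : ℝ) : BMeasure (E n) :=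
  eulerStep V s N (t - (⌊t * N⌋₊ : ℝ) / N) (latticeIter V s N ⌊t * N⌋₊ μ)

theorem latticeIter_succ (V : BMeasure (E n) → BMeasure (E n × E n))
    (s : BMeasure (E n) → BMeasure (E n)) (N k : ℕ) (μ : BMeasure (E n)) :
    latticeIter V s N (k + 1) μ = eulerStep V s N (meshV N) (latticeIter V s N k μ) :=
  Function.iterate_succ_apply' _ _ _

theorem latticeNode_eq (V : BMeasure (E n) → BMeasure (E n × E n))
    (s : BMeasure (E n) → BMeasure (E n)) (N k : ℕ) (μ : BMeasure (E n)) :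
    latticeNode V s N μ k = latticeIter V s N k (discretize N 1 μ) := by
  induction k with
  | zero => rfl
  | succ k ih => rw [latticeIter_succ, ← ih]; rfl

theorem latticeSolution_eq (V : BMeasure (E n) → BMeasure (E n × E n))
    (s : BMeasure (E n) → BMeasure (E n)) (N : ℕ) (μ : BMeasure (E n)) (t : ℝ) :
    latticeSolution V s N μ t = latticeOrbit V s N (discretize N 1 μ) t := by
  rw [latticeSolution, latticeOrbit, latticeNode_eq]

theorem frac_bounds {N : ℕ} (hN : 0 < N) {t : ℝ} (ht : 0 ≤ t) :
    0 ≤ t - (⌊t * N⌋₊ : ℝ) / N ∧ t - (⌊t * N⌋₊ : ℝ) / N ≤ meshV N ∧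
      (⌊t * N⌋₊ : ℝ) * meshV N ≤ t ∧ t ≤ (⌊t * N⌋₊ : ℝ) * meshV N + meshV N ∧
      (⌊t * N⌋₊ : ℝ) * meshV N = (⌊t * N⌋₊ : ℝ) / N := by
  have hN' : (0 : ℝ) < N := by exact_mod_cast hN
  have h1 := Nat.floor_le (show 0 ≤ t * N by positivity)
  have h2 := Nat.lt_floor_add_one (t * N)
  have h3 : (⌊t * N⌋₊ : ℝ) / N ≤ t := by rw [div_le_iff₀ hN']; exact h1
  have h4 : t ≤ (⌊t * N⌋₊ : ℝ) / N + 1 / N := by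
    rw [← add_div, le_div_iff₀ hN']; exact h2.le
  have e : (⌊t * N⌋₊ : ℝ) * meshV N = (⌊t * N⌋₊ : ℝ) / N := by rw [meshV]; ring
  rw [e, meshV]
  refine ⟨by linarith, by linarith, h3, h4, rfl⟩

namespace IsRegular

variable {V : BMeasure (E n) → BMeasure (E n × E n)} {s : BMeasure (E n) → BMeasure (E n)}
  {C L R₀ : ℝ}

theorem Covers.mono {R R' : ℝ} {N : ℕ} (h : Covers C R₀ R' N) (hC : 0 < C) (hR : 0 ≤ R)
    (hR₀ : R₀ ≤ R) (hle : R ≤ R') : Covers C R₀ R N where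
  pos := h.pos
  nonneg := hR
  source_le := hR₀
  le := hle.trans h.le
  vel_le := le_trans (by gcongr) h.vel_le

theorem exists_covers (C : ℝ) {R₀ R : ℝ} (hR : 0 ≤ R) (hR₀ : R₀ ≤ R) :
    ∃ N₀ : ℕ, ∀ N ≥ N₀, Covers C R₀ R N := by
  obtain ⟨N₀, hN₀⟩ := exists_nat_ge (max R (C * (1 + R)))
  refine ⟨N₀ + 1, fun N hN => ?_⟩
  have : (N₀ : ℝ) ≤ N := by exact_mod_cast (Nat.le_succ _).trans hN
  exact ⟨by omega, hR, hR₀, (le_max_left _ _).trans (hN₀.trans this),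
    (le_max_right _ _).trans (hN₀.trans this)⟩

/-- Estimates for one step of the lattice scheme. -/
theorem exists_step_bounds (H : IsRegular V s C L R₀) {R : ℝ} (hR : 0 ≤ R) (M : ℝ) :
    ∃ A : ℝ, 0 ≤ A ∧ ∀ N, Covers C R₀ R N → ∀ μ ∈ massBall n R M, ∀ τ, 0 ≤ τ → τ ≤ meshV N →
      dist (eulerStep V s N τ μ) (freeStep V s τ μ) ≤ A * meshX N ∧
      dist (eulerStep V s N τ μ) μ ≤ A * τ + A * meshX N ∧
      ∀ ν ∈ massBall n R M, dist (eulerStep V s N τ μ) (eulerStep V s N τ ν) ≤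
        (1 + τ * A) * dist μ ν + A * meshX N := by
  obtain ⟨K, hK, hlip⟩ := H.dist_freeStep_le hR
  obtain ⟨s₀, hs₀, hs⟩ := H.rmass_source_le
  have hC := H.C_pos
  have hL := H.L_nonneg
  set S := s₀ + L * |M| with hS
  have hS0 : 0 ≤ S := by positivity
  set F := 2 * √n * (|M| + S) with hF
  have hF0 : 0 ≤ F := by positivity
  set D := C * (1 + R) * |M| + S with hD
  have hD0 : 0 ≤ D := by positivity
  refine ⟨K + 2 * F + D, by positivity, fun N hN μ hμ τ hτ hτN => ?_⟩
  have hx := meshX_pos hN.pos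
  have key : ∀ μ ∈ massBall n R M, μ.rmass ≤ |M| ∧ (s μ).rmass ≤ S ∧
      dist (eulerStep V s N τ μ) (freeStep V s τ μ) ≤ F * meshX N := fun μ hμ => by
    have h1 : μ.rmass ≤ |M| := hμ.2.trans (le_abs_self _)
    have h2 : (s μ).rmass ≤ S := (hs μ).trans (by rw [hS]; gcongr)
    refine ⟨h1, h2, (H.dist_eulerStep_freeStep_le hN hμ.1 hτ hτN).trans ?_⟩
    calc 2 * √n * meshX N * (μ.rmass + (s μ).rmass) ≤ 2 * √n * meshX N * (|M| + S) := by gcongr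
      _ = _ := by rw [hF]; ring
  obtain ⟨m1, m2, m3⟩ := key μ hμ
  have hKx : 0 ≤ K * meshX N := by positivity
  have hFx : 0 ≤ F * meshX N := by positivity
  have hDx : 0 ≤ D * meshX N := by positivity
  have hKτ : 0 ≤ K * τ := by positivity
  have hFτ : 0 ≤ F * τ := by positivity
  refine ⟨by linarith, ?_, fun ν hν => ?_⟩
  · have h1 := H.dist_freeStep_self_le hR hμ.1 hτ
    have h2 : τ * (C * (1 + R) * μ.rmass + (s μ).rmass) ≤ τ * D := by rw [hD]; gcongr
    have h3 := dist_triangle (eulerStep V s N τ μ) (freeStep V s τ μ) μ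
    linarith
  · obtain ⟨k1, k2, k3⟩ := key ν hν
    have h1 := hlip μ ν hμ.1 hν.1 τ hτ
    have h2 := dist_triangle4 (eulerStep V s N τ μ) (freeStep V s τ μ) (freeStep V s τ ν)
      (eulerStep V s N τ ν)
    rw [dist_comm (freeStep V s τ ν)] at h2
    have h3 : 0 ≤ τ * (2 * F + D) * dist μ ν := by positivity
    linarith

/-- The lattice scheme stays in a fixed set of measures with bounded mass and support. -/
theorem exists_invariant (H : IsRegular V s C L R₀) {R : ℝ} (hR : 0 ≤ R) (hR₀ : R₀ ≤ R) (M : ℝ)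
    {T : ℝ} (hT : 0 ≤ T) :
    ∃ (R' M' : ℝ) (N₀ : ℕ), R ≤ R' ∧ M ≤ M' ∧ ∀ N ≥ N₀, Covers C R₀ R' N ∧
      ∀ μ ∈ massBall n R M, (∀ k : ℕ, k * meshV N ≤ T → latticeIter V s N k μ ∈ massBall n R' M') ∧
        ∀ t ∈ Icc 0 T, latticeOrbit V s N μ t ∈ massBall n R' M' ∧
          latticeOrbit V s N μ t ∈ massBall n
            (Real.exp (C * t) * (1 + R + 2 * √n * (T + 1) * meshV N) - 1) M' := by
  obtain ⟨s₀, hs₀, hs⟩ := H.rmass_source_le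
  have hC := H.C_pos
  have hL := H.L_nonneg
  -- By (V1) it is `1 + radius` that grows by the factor `1 + τ C` in a step. The second unit in `2
  -- + R` is room for the accumulated rounding, which is at most `2 √n (T + 1) / N` and hence at
  -- most 1 once `N ≥ N₂`.
  set R' := Real.exp (C * T) * (2 + R) with hR'
  set M' := Real.exp (L * (T + 1)) * (|M| + (T + 1) * s₀) with hM'
  have hRR' : R ≤ R' := by
    have : 1 ≤ Real.exp (C * T) := Real.one_le_exp (by positivity)
    have : 2 + R ≤ R' := le_mul_of_one_le_left (by positivity) this
    linarith
  obtain ⟨N₁, hN₁⟩ := exists_covers C (R := R') (hR.trans hRR') (hR₀.trans hRR')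
  obtain ⟨N₂, hN₂⟩ := exists_nat_ge (2 * √n * (T + 1))
  have hMM' : M ≤ M' := by
    have h1 : 1 ≤ Real.exp (L * (T + 1)) := Real.one_le_exp (by positivity)
    have h2 : |M| + (T + 1) * s₀ ≤ M' := le_mul_of_one_le_left (by positivity) h1
    have h3 : 0 ≤ (T + 1) * s₀ := by positivity
    linarith [le_abs_self M]
  refine ⟨R', M', max N₁ N₂, hRR', hMM', fun N hN => ?_⟩
  have hcov := hN₁ N ((le_max_left _ _).trans hN)
  refine ⟨hcov, fun μ hμ => ?_⟩
  have hv := meshV_pos hcov.pos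
  have hx := meshX_pos hcov.pos
  have hv1 := meshV_le_one hcov.pos
  have hnn : (0 : ℝ) ≤ √n := Real.sqrt_nonneg _
  have hsmall : 2 * √n * (T + 1) * meshV N ≤ 1 := by
    have h1 : (N₂ : ℝ) ≤ N := by exact_mod_cast (le_max_right _ _).trans hN
    calc 2 * √n * (T + 1) * meshV N ≤ N * meshV N := by gcongr; exact hN₂.trans h1
      _ = 1 := by rw [mul_comm, meshV_mul hcov.pos]
  -- the radius reached at time `t` after `κ` steps
  have hrad : ∀ t κ : ℝ, 0 ≤ t → t ≤ T → 0 ≤ κ → κ * meshV N ≤ T + 1 →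
      R ≤ Real.exp (C * t) * (1 + R + κ * (2 * √n * meshX N)) - 1 ∧
      Real.exp (C * t) * (1 + R + κ * (2 * √n * meshX N)) ≤
        Real.exp (C * t) * (1 + R + 2 * √n * (T + 1) * meshV N) ∧
      Real.exp (C * t) * (1 + R + 2 * √n * (T + 1) * meshV N) ≤ R' := by
    intro t κ ht htT hκ hκT
    have h1 : 1 ≤ Real.exp (C * t) := Real.one_le_exp (by positivity)
    have h2 : κ * (2 * √n * meshX N) ≤ 2 * √n * (T + 1) * meshV N := by
      calc κ * (2 * √n * meshX N) = (2 * √n * meshV N) * (κ * meshV N) := by rw [meshX_eq]; ring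
        _ ≤ (2 * √n * meshV N) * (T + 1) := by gcongr
        _ = _ := by ring
    refine ⟨?_, by gcongr, ?_⟩
    · have h3 : 0 ≤ κ * (2 * √n * meshX N) := by positivity
      have := le_mul_of_one_le_left (show 0 ≤ 1 + R + κ * (2 * √n * meshX N) by positivity) h1
      linarith
    · rw [hR']
      have : 1 + R + 2 * √n * (T + 1) * meshV N ≤ 2 + R := by linarith
      gcongr
  -- the effect of one step
  have hstep : ∀ (ν : BMeasure (E n)) (t κ τ : ℝ), 0 ≤ t → t ≤ T → 0 ≤ κ → κ * meshV N ≤ T + 1 →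
      0 ≤ τ → τ ≤ meshV N →
      ν.toMeasure (Metric.closedBall 0
        (Real.exp (C * t) * (1 + R + κ * (2 * √n * meshX N)) - 1))ᶜ = 0 →
      ν.rmass ≤ Real.exp (L * t) * (|M| + t * s₀) →
      (eulerStep V s N τ ν).toMeasure (Metric.closedBall 0
        (Real.exp (C * (t + τ)) * (1 + R + (κ + 1) * (2 * √n * meshX N)) - 1))ᶜ = 0 ∧
      (eulerStep V s N τ ν).rmass ≤ Real.exp (L * (t + τ)) * (|M| + (t + τ) * s₀) := by
    intro ν t κ τ ht htT hκ hκT hτ hτN hν hνm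
    obtain ⟨r1, r2, r3⟩ := hrad t κ ht htT hκ hκT
    -- The step is estimated at the current radius rather than at `R'`, so that the growth can be
    -- iterated and the sharp radius kept.
    have hcov' := hcov.mono hC (hR.trans r1) (hR₀.trans r1) (by linarith)
    refine ⟨carried_mono ?_ (H.carried_eulerStep hcov' hν hτ hτN), ?_⟩
    · have := gronwall_step (a := C) (b := 1 + R) (c := 2 * √n * meshX N) (t := t) (τ := τ)
        (κ := κ) hC.le ht hτ (by positivity) (by positivity) hκ le_rfl le_rfl
      linarith
    · rw [H.rmass_eulerStep hcov' hν hτ]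
      have h1 : ν.rmass + τ * (s ν).rmass ≤ (1 + τ * L) * ν.rmass + τ * s₀ := by
        have := mul_le_mul_of_nonneg_left (hs ν) hτ
        linarith
      -- The source mass accumulated so far is put into `b`, so the step is used with `κ = 0` and
      -- adds `τ s₀`.
      have := gronwall_step (a := L) (b := |M| + t * s₀) (c := τ * s₀) (t := t) (τ := τ)
        (κ := 0) hL ht hτ (by positivity) (by positivity) le_rfl
        (by simpa using hνm) h1
      refine this.trans (le_of_eq ?_)
      ring
  have hiter : ∀ k : ℕ, k * meshV N ≤ T →
      (latticeIter V s N k μ).toMeasure (Metric.closedBall 0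
        (Real.exp (C * (k * meshV N)) * (1 + R + k * (2 * √n * meshX N)) - 1))ᶜ = 0 ∧
      (latticeIter V s N k μ).rmass ≤
        Real.exp (L * (k * meshV N)) * (|M| + (k * meshV N) * s₀) := by
    intro k
    induction k with
    | zero =>
      intro _
      refine ⟨?_, ?_⟩
      · simpa [latticeIter] using hμ.1
      · simpa [latticeIter] using hμ.2.trans (le_abs_self _)
    | succ k ih =>
      intro hk
      have hk' : k * meshV N ≤ T := by push_cast at hk; linarith
      obtain ⟨i1, i2⟩ := ih hk'
      have := hstep _ (k * meshV N) k (meshV N) (by positivity) hk' (by positivity)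
        (by linarith) hv.le le_rfl i1 i2
      rw [latticeIter_succ]
      push_cast
      rw [add_mul, one_mul]
      exact this
  have hmassle : ∀ t, 0 ≤ t → t ≤ T + 1 → Real.exp (L * t) * (|M| + t * s₀) ≤ M' := by
    intro t ht htT
    rw [hM']
    gcongr
  refine ⟨fun k hk => ?_, fun t ht => ?_⟩
  · obtain ⟨i1, i2⟩ := hiter k hk
    obtain ⟨r1, r2, r3⟩ := hrad (k * meshV N) k (by positivity) hk (by positivity) (by linarith)
    exact ⟨carried_mono (by linarith) i1,
      i2.trans (hmassle _ (by positivity) (by linarith))⟩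
  · obtain ⟨f1, f2, f3, f4, f5⟩ := frac_bounds hcov.pos ht.1
    set k := ⌊t * N⌋₊
    obtain ⟨i1, i2⟩ := hiter k (f3.trans ht.2)
    obtain ⟨j1, j2⟩ := hstep _ (k * meshV N) k _ (by positivity) (f3.trans ht.2) (by positivity)
      (by linarith [ht.2]) f1 f2 i1 i2
    have e : k * meshV N + (t - (k : ℝ) / N) = t := by rw [f5]; ring
    rw [e] at j1 j2
    obtain ⟨r1, r2, r3⟩ := hrad t (k + 1) ht.1 ht.2 (by positivity) (by
      rw [add_mul, one_mul]; linarith [ht.2])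
    have hm := j2.trans (hmassle t ht.1 (by linarith [ht.2]))
    exact ⟨⟨carried_mono (by linarith) j1, hm⟩, ⟨carried_mono (by linarith) j1, hm⟩⟩

end IsRegular

/-- Uniform estimates on `[0, T]` for the lattice scheme of index `N`, started at measures with
mass at most `M` carried by the ball of radius `R`. -/
structure SchemeBounds (V : BMeasure (E n) → BMeasure (E n × E n))
    (s : BMeasure (E n) → BMeasure (E n)) (C R₀ T R M R' M' A : ℝ) (N : ℕ) : Prop where
  covers : IsRegular.Covers C R₀ R' N
  iter_mem : ∀ μ ∈ massBall n R M, ∀ k : ℕ, k * meshV N ≤ T →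
    latticeIter V s N k μ ∈ massBall n R' M'
  orbit_mem : ∀ μ ∈ massBall n R M, ∀ t ∈ Icc 0 T, latticeOrbit V s N μ t ∈ massBall n R' M'
  orbit_mem_sharp : ∀ μ ∈ massBall n R M, ∀ t ∈ Icc 0 T, latticeOrbit V s N μ t ∈ massBall n
    (Real.exp (C * t) * (1 + R + 2 * √n * (T + 1) * meshV N) - 1) M'
  euler_free : ∀ μ ∈ massBall n R' M', dist (eulerStep V s N (meshV N) μ)
    (freeStep V s (meshV N) μ) ≤ A * meshX N
  iter_iter : ∀ μ ∈ massBall n R M, ∀ j k : ℕ, j ≤ k → k * meshV N ≤ T →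
    dist (latticeIter V s N k μ) (latticeIter V s N j μ) ≤
      ((k : ℝ) - j) * (A * meshV N + A * meshX N)
  iter_lip : ∀ μ ∈ massBall n R M, ∀ ν ∈ massBall n R M, ∀ k : ℕ, k * meshV N ≤ T →
    dist (latticeIter V s N k μ) (latticeIter V s N k ν) ≤
      Real.exp (A * (k * meshV N)) * (dist μ ν + k * (A * meshX N))
  orbit_lip : ∀ μ ∈ massBall n R M, ∀ ν ∈ massBall n R M, ∀ t ∈ Icc 0 T,
    dist (latticeOrbit V s N μ t) (latticeOrbit V s N ν t) ≤
      Real.exp (A * t) * (dist μ ν + A * (T + 1) * meshV N)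
  orbit_iter : ∀ μ ∈ massBall n R M, ∀ t ∈ Icc 0 T,
    dist (latticeOrbit V s N μ t) (latticeIter V s N ⌊t * N⌋₊ μ) ≤ 2 * A * meshV N

/-- Both times are moved back to their last nodes, at cost O(1/N), and the steps between the nodes
are counted; they last at most |t - r| + 1/N. -/
theorem SchemeBounds.orbit_time {V : BMeasure (E n) → BMeasure (E n × E n)}
    {s : BMeasure (E n) → BMeasure (E n)} {C R₀ T R M R' M' A : ℝ} {N : ℕ}
    (h : SchemeBounds V s C R₀ T R M R' M' A N) (hA : 0 ≤ A) {μ : BMeasure (E n)}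
    (hμ : μ ∈ massBall n R M) {t r : ℝ} (ht : t ∈ Icc 0 T) (hr : r ∈ Icc 0 T) :
    dist (latticeOrbit V s N μ t) (latticeOrbit V s N μ r) ≤
      A * |t - r| + A * (T + 6) * meshV N := by
  have hv := meshV_pos h.covers.pos
  have hv1 := meshV_le_one h.covers.pos
  have key : ∀ t ∈ Icc 0 T, ∀ r ∈ Icc 0 T, r ≤ t →
      dist (latticeOrbit V s N μ t) (latticeOrbit V s N μ r) ≤
        A * (t - r) + A * (T + 6) * meshV N := by
    intro t ht r hr hrt
    obtain ⟨-, -, f3, f4, -⟩ := frac_bounds h.covers.pos ht.1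
    obtain ⟨-, -, g3, g4, -⟩ := frac_bounds h.covers.pos hr.1
    have hjk : ⌊r * N⌋₊ ≤ ⌊t * N⌋₊ := Nat.floor_le_floor (by gcongr)
    have h1 := h.orbit_iter μ hμ t ht
    have h2 := h.orbit_iter μ hμ r hr
    have h3 := h.iter_iter μ hμ _ _ hjk (f3.trans ht.2)
    set k := ⌊t * N⌋₊
    set j := ⌊r * N⌋₊
    have h4 := dist_triangle4 (latticeOrbit V s N μ t) (latticeIter V s N k μ)
      (latticeIter V s N j μ) (latticeOrbit V s N μ r)
    rw [dist_comm (latticeIter V s N j μ)] at h4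
    have hj0 : (0 : ℝ) ≤ j * meshV N := by positivity
    have h5 : ((k : ℝ) - j) * meshV N ≤ t - r + meshV N := by linarith
    have h5' : ((k : ℝ) - j) * meshV N ≤ T := by linarith [ht.2]
    have h6 : ((k : ℝ) - j) * (A * meshV N + A * meshX N) =
      A * (((k : ℝ) - j) * meshV N) + A * (((k : ℝ) - j) * meshV N) * meshV N := by
      rw [meshX_eq]; ring
    have h7 : A * (((k : ℝ) - j) * meshV N) ≤ A * (t - r + meshV N) := by gcongr
    have h8 : A * (((k : ℝ) - j) * meshV N) * meshV N ≤ A * T * meshV N := by gcongr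
    have h9 : 0 ≤ A * meshV N := by positivity
    linarith
  rcases le_total r t with hrt | hrt
  · rw [abs_of_nonneg (by linarith)]
    exact key t ht r hr hrt
  · rw [abs_of_nonpos (by linarith), dist_comm, neg_sub]
    exact key r hr t ht hrt

namespace IsRegular

variable {V : BMeasure (E n) → BMeasure (E n × E n)} {s : BMeasure (E n) → BMeasure (E n)}
  {C L R₀ : ℝ}

theorem exists_schemeBounds (H : IsRegular V s C L R₀) {R : ℝ} (hR : 0 ≤ R) (hR₀ : R₀ ≤ R)
    (M : ℝ) {T : ℝ} (hT : 0 ≤ T) :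
    ∃ R' M' A : ℝ, R ≤ R' ∧ M ≤ M' ∧ 0 ≤ A ∧
      ∀ᶠ N in atTop, SchemeBounds V s C R₀ T R M R' M' A N := by
  obtain ⟨R', M', N₀, hRR', hMM', hinv⟩ := H.exists_invariant hR hR₀ M hT
  obtain ⟨A, hA, hstep⟩ := H.exists_step_bounds (hR.trans hRR') M'
  refine ⟨R', M', A, hRR', hMM', hA, eventually_atTop.2 ⟨N₀, fun N hN => ?_⟩⟩
  obtain ⟨hcov, hmem⟩ := hinv N hN
  have hv := meshV_pos hcov.pos
  have hx := meshX_pos hcov.pos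
  have hv1 := meshV_le_one hcov.pos
  have hlip : ∀ μ ∈ massBall n R M, ∀ ν ∈ massBall n R M, ∀ k : ℕ, k * meshV N ≤ T →
      dist (latticeIter V s N k μ) (latticeIter V s N k ν) ≤
        Real.exp (A * (k * meshV N)) * (dist μ ν + k * (A * meshX N)) := by
    intro μ hμ ν hν k
    induction k with
    | zero => intro _; simp [latticeIter]
    | succ k ih =>
      intro hk
      have hk' : k * meshV N ≤ T := by push_cast at hk; linarith
      have h1 := (hstep N hcov _ ((hmem μ hμ).1 k hk') (meshV N) hv.le le_rfl).2.2 _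
        ((hmem ν hν).1 k hk')
      have := gronwall_step (c := A * meshX N) hA (by positivity) hv.le dist_nonneg (by positivity)
        (Nat.cast_nonneg k) (ih hk') h1
      rw [latticeIter_succ, latticeIter_succ]
      have e : (k : ℝ) * meshV N + meshV N = ((k + 1 : ℕ) : ℝ) * meshV N := by push_cast; ring
      rw [e] at this
      exact_mod_cast this
  exact
  { covers := hcov
    iter_mem := fun μ hμ => (hmem μ hμ).1
    orbit_mem := fun μ hμ t ht => ((hmem μ hμ).2 t ht).1
    orbit_mem_sharp := fun μ hμ t ht => ((hmem μ hμ).2 t ht).2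
    euler_free := fun μ hμ => (hstep N hcov μ hμ _ hv.le le_rfl).1
    iter_iter := by
      intro μ hμ j k hjk
      induction k, hjk using Nat.le_induction with
      | base => intro _; simp
      | succ k hjk ih =>
        intro hk
        have hk' : k * meshV N ≤ T := by push_cast at hk; linarith
        have h1 := (hstep N hcov _ ((hmem μ hμ).1 k hk') (meshV N) hv.le le_rfl).2.1
        have h2 := dist_triangle (latticeIter V s N (k + 1) μ) (latticeIter V s N k μ)
          (latticeIter V s N j μ)
        rw [latticeIter_succ] at h2 ⊢
        have h3 := ih hk'
        push_cast
        linarith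
    iter_lip := hlip
    orbit_lip := by
      intro μ hμ ν hν t ht
      obtain ⟨f1, f2, f3, f4, f5⟩ := frac_bounds hcov.pos ht.1
      rw [latticeOrbit, latticeOrbit]
      set k := ⌊t * N⌋₊
      have hk := f3.trans ht.2
      have h1 := (hstep N hcov _ ((hmem μ hμ).1 k hk) _ f1 f2).2.2 _ ((hmem ν hν).1 k hk)
      have h2 := gronwall_step (c := A * meshX N) hA (by positivity) f1 dist_nonneg
        (by positivity) (Nat.cast_nonneg k) (hlip μ hμ ν hν k hk) h1
      have e : k * meshV N + (t - (k : ℝ) / N) = t := by rw [f5]; ring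
      rw [e] at h2
      refine h2.trans ?_
      -- The `k` full steps and the last partial one each cost `A / N²`, and `(k + 1) / N ≤ T + 1`.
      have h3 : ((k : ℝ) + 1) * (A * meshX N) ≤ A * (T + 1) * meshV N := by
        calc ((k : ℝ) + 1) * (A * meshX N) = A * (k * meshV N + meshV N) * meshV N := by
              rw [meshX_eq]; ring
          _ ≤ A * (T + 1) * meshV N := by gcongr
      gcongr
    orbit_iter := by
      intro μ hμ t ht
      obtain ⟨f1, f2, f3, f4, f5⟩ := frac_bounds hcov.pos ht.1
      rw [latticeOrbit]
      have h1 := (hstep N hcov _ ((hmem μ hμ).1 _ (f3.trans ht.2)) _ f1 f2).2.1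
      have h2 : A * (t - (⌊t * N⌋₊ : ℝ) / N) ≤ A * meshV N := by gcongr
      have h3 : A * meshX N ≤ A * meshV N := by
        rw [meshX_eq]
        gcongr
        exact mul_le_of_le_one_left hv.le hv1
      linarith }

/-- Consistency of the lattice scheme with the weak equation. -/
theorem exists_consistency (H : IsRegular V s C L R₀) {T R M R' M' A : ℝ} (hR : 0 ≤ R)
    (hRR' : R ≤ R') (hMM' : M ≤ M') (hA : 0 ≤ A)
    {f : E n → ℝ} (hf : ContDiff ℝ ∞ f) (hc : HasCompactSupport f) :
    ∃ B : ℝ, 0 ≤ B ∧ ∀ N, SchemeBounds V s C R₀ T R M R' M' A N → ∀ μ ∈ massBall n R M,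
      ∀ k : ℕ, k * meshV N ≤ T →
      |∫ x, f x ∂(latticeIter V s N k μ).toMeasure - ∫ x, f x ∂μ.toMeasure
        - k * meshV N * weakRHS V s f μ| ≤
          B * ((k * meshV N) ^ 2 + k * meshV N * meshV N) := by
  obtain ⟨G, hG1, hG2, -, -⟩ := exists_bounds_of_testFunction hf hc
  obtain ⟨B₀, hB₀, hcons⟩ := H.abs_integral_freeStep_sub_le (hR.trans hRR') hf hc M'
  obtain ⟨B₁, hB₁, hlip⟩ := H.abs_weakRHS_sub_le (hR.trans hRR') hf hc
  refine ⟨2 * B₁ * A + B₀ + G * A, by positivity, fun N hN μ hμ k => ?_⟩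
  have hv := meshV_pos hN.covers.pos
  have hv1 := meshV_le_one hN.covers.pos
  induction k with
  | zero => intro _; simp [latticeIter]
  | succ k ih =>
    intro hk
    have hk' : k * meshV N ≤ T := by push_cast at hk; linarith
    have hm := hN.iter_mem μ hμ k hk'
    have hμ' := massBall_mono hRR' hMM' hμ
    have h0 := ih hk'
    set m := latticeIter V s N k μ with hmdef
    have h1 := hcons m hm (meshV N) hv.le
    have h2 := abs_integral_sub_le_gdist hG1 hG2 (eulerStep V s N (meshV N) m)
      (freeStep V s (meshV N) m)
    have h3 : (G : ℝ) * gdist (eulerStep V s N (meshV N) m) (freeStep V s (meshV N) m) ≤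
        G * (A * meshX N) := by
      gcongr
      exact hN.euler_free m hm
    have h4 := hlip m μ hm.1 hμ'.1
    have h5 : dist m μ ≤ 2 * A * (k * meshV N) := by
      have := hN.iter_iter μ hμ 0 k (Nat.zero_le k) hk'
      refine this.trans ?_
      have hx : meshX N ≤ meshV N := by
        rw [meshX_eq]; exact mul_le_of_le_one_left hv.le hv1
      calc ((k : ℝ) - (0 : ℕ)) * (A * meshV N + A * meshX N)
          ≤ k * (A * meshV N + A * meshV N) := by
            rw [Nat.cast_zero, sub_zero]; gcongr
        _ = _ := by ring
    have h6 : meshV N * |weakRHS V s f m - weakRHS V s f μ| ≤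
        meshV N * (B₁ * (2 * A * (k * meshV N))) := by
      gcongr
      exact h4.trans (by gcongr)
    have h7 : |meshV N * (weakRHS V s f m - weakRHS V s f μ)| =
        meshV N * |weakRHS V s f m - weakRHS V s f μ| := by
      rw [abs_mul, abs_of_pos hv]
    rw [latticeIter_succ, ← hmdef]
    set F := ∫ x, f x ∂(eulerStep V s N (meshV N) m).toMeasure
    set F₁ := ∫ x, f x ∂(freeStep V s (meshV N) m).toMeasure
    set F₂ := ∫ x, f x ∂m.toMeasure
    set F₀ := ∫ x, f x ∂μ.toMeasure
    -- The four terms are rounding, consistency of the free step, drift of the right-hand side since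
    -- time 0, and the induction hypothesis. With `h = 1/N`, the drift is at most `2 B₁ A k h²` and
    -- the first two are O(h²), while the claimed bound grows by `B (2k + 2) h²`.
    have e : F - F₀ - ((k + 1 : ℕ) : ℝ) * meshV N * weakRHS V s f μ =
        (F - F₁) + (F₁ - F₂ - meshV N * weakRHS V s f m) +
        meshV N * (weakRHS V s f m - weakRHS V s f μ) +
        (F₂ - F₀ - k * meshV N * weakRHS V s f μ) := by
      push_cast; ring
    rw [e]
    refine (abs_add_le _ _).trans ((add_le_add ((abs_add_le _ _).trans
      (add_le_add (abs_add_le _ _) le_rfl)) le_rfl).trans ?_)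
    rw [h7]
    rw [meshX_eq] at h3
    have hh : 0 ≤ meshV N ^ 2 := by positivity
    have hk0 : (0 : ℝ) ≤ k := Nat.cast_nonneg k
    have hkh : 0 ≤ (k : ℝ) * meshV N ^ 2 := by positivity
    have g1 : 0 ≤ B₁ * A * meshV N ^ 2 := by positivity
    have g2 : 0 ≤ B₀ * meshV N ^ 2 := by positivity
    have g3 : 0 ≤ G * A * meshV N ^ 2 := by positivity
    have g4 : 0 ≤ B₁ * A * (k * meshV N ^ 2) := by positivity
    have g5 : 0 ≤ B₀ * (k * meshV N ^ 2) := by positivity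
    have g6 : 0 ≤ G * A * (k * meshV N ^ 2) := by positivity
    push_cast
    linarith

end IsRegular

/-! ### Extraction of a convergent subsequence -/

/-- Diagonal extraction for countably many sequences with values in compact sets. -/
theorem exists_subseq_tendsto_of_countable {ι X : Type*} [Countable ι] [TopologicalSpace X]
    [FirstCountableTopology X] (u : ℕ → ι → X) (K : ι → Set X) (hK : ∀ i, IsCompact (K i))
    (hu : ∀ i, ∀ᶠ N in atTop, u N i ∈ K i) :
    ∃ φ : ℕ → ℕ, StrictMono φ ∧ ∀ i, ∃ x, Tendsto (fun k => u (φ k) i) atTop (𝓝 x) := by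
  classical
  choose N₀ hN₀ using fun i => (hu i).exists
  -- Early terms outside `K i` are replaced by a fixed one inside, so that Tychonoff applies
  -- although no stage `N` need work for all `i` at once.
  let v : ℕ → ι → X := fun N i => if u N i ∈ K i then u N i else u (N₀ i) i
  have hv : ∀ N, v N ∈ pi univ K := by
    intro N i _
    by_cases h : u N i ∈ K i
    · simp [v, h]
    · simpa [v, h] using hN₀ i
  obtain ⟨x, -, φ, hφ, hlim⟩ := (isCompact_univ_pi hK).tendsto_subseq hv
  refine ⟨φ, hφ, fun i => ⟨x i, ?_⟩⟩
  refine (tendsto_pi_nhds.1 hlim i).congr' ?_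
  filter_upwards [hφ.tendsto_atTop.eventually (hu i)] with k hk
  simp [v, hk]

namespace IsRegular

variable {V : BMeasure (E n) → BMeasure (E n × E n)} {s : BMeasure (E n) → BMeasure (E n)}
  {C L R₀ : ℝ}

theorem exists_discretize_bounds {R M δ : ℝ} (hδ : 0 < δ) :
    ∀ᶠ N in atTop, ∀ μ ∈ massBall n R M, discretize N 1 μ ∈ massBall n (R + δ) M ∧
      dist (discretize N 1 μ) μ ≤ √n * |M| * meshV N := by
  obtain ⟨N₁, hN₁⟩ := exists_nat_ge R
  have hlim : Tendsto (fun N : ℕ => √n * meshV N) atTop (𝓝 0) := by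
    simpa using tendsto_meshV.const_mul (√n)
  filter_upwards [hlim.eventually (gt_mem_nhds hδ), eventually_ge_atTop (N₁ + 1)]
    with N hsmall hN μ hμ
  have hpos : 0 < N := by omega
  have hv := meshV_pos hpos
  have hx : meshX N ≤ meshV N := by
    rw [meshX_eq]; exact mul_le_of_le_one_left hv.le (meshV_le_one hpos)
  have hRN : R ≤ N := hN₁.trans (by exact_mod_cast (Nat.le_succ _).trans hN)
  have hμN := carried_mono hRN hμ.1
  have hnn : (0 : ℝ) ≤ √n := Real.sqrt_nonneg _
  have hnx := mul_le_mul_of_nonneg_left hx hnn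
  refine ⟨⟨carried_mono (by linarith) (carried_discretize hpos 1 hRN hμ.1), ?_⟩, ?_⟩
  · rw [rmass_discretize hpos 1 hμN]
    simpa using hμ.2
  · refine (dist_discretize_one_le hpos hμN).trans ?_
    have := hμ.2.trans (le_abs_self M)
    calc √n * meshX N * μ.rmass ≤ √n * meshV N * |M| := by
          have := μ.rmass_nonneg
          gcongr
      _ = _ := by ring

/-- Uniform estimates for the lattice approximate solutions. -/
theorem exists_solution_bounds (H : IsRegular V s C L R₀) {R : ℝ} (hR : 0 ≤ R) (hR₀ : R₀ ≤ R)
    (M : ℝ) {T : ℝ} (hT : 0 ≤ T) {δ : ℝ} (hδ : 0 < δ) :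
    ∃ R' M' A B : ℝ, 0 ≤ R' ∧ R₀ ≤ R' ∧ 0 ≤ A ∧ 0 ≤ B ∧ ∀ᶠ N in atTop, ∀ μ ∈ massBall n R M,
      (∀ t ∈ Icc 0 T, latticeSolution V s N μ t ∈ massBall n R' M' ∧
        latticeSolution V s N μ t ∈ massBall n (Real.exp (C * t) * (1 + R + 2 * δ)) M') ∧
      (∀ ν ∈ massBall n R M, ∀ t ∈ Icc 0 T,
        dist (latticeSolution V s N μ t) (latticeSolution V s N ν t) ≤
          Real.exp (A * t) * (dist μ ν + B * meshV N)) ∧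
      (∀ t ∈ Icc 0 T, ∀ r ∈ Icc 0 T,
        dist (latticeSolution V s N μ t) (latticeSolution V s N μ r) ≤
          A * |t - r| + B * meshV N) ∧
      dist (latticeSolution V s N μ 0) μ ≤ B * meshV N := by
  obtain ⟨R', M', A, hRR', -, hA, hev⟩ :=
    H.exists_schemeBounds (R := R + δ) (by positivity) (by linarith) M hT
  have hlim : Tendsto (fun N : ℕ => 2 * √n * (T + 1) * meshV N) atTop (𝓝 0) := by
    simpa using tendsto_meshV.const_mul (2 * √n * (T + 1))
  refine ⟨R', M', A, A * (T + 6) + 2 * (√n * |M|), by linarith, by linarith, hA, by positivity, ?_⟩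
  filter_upwards [hev, exists_discretize_bounds (n := n) (R := R) (M := M) hδ,
    hlim.eventually (gt_mem_nhds hδ)] with N hN hd hsmall μ hμ
  obtain ⟨hdμ, hdμ'⟩ := hd μ hμ
  have hv := meshV_pos hN.covers.pos
  have hDh : 0 ≤ √n * |M| * meshV N := by positivity
  have hAh : 0 ≤ A * meshV N := by positivity
  have hATh : 0 ≤ A * T * meshV N := by positivity
  simp only [latticeSolution_eq]
  refine ⟨fun t ht => ⟨hN.orbit_mem _ hdμ t ht,
    massBall_mono ?_ le_rfl (hN.orbit_mem_sharp _ hdμ t ht)⟩, fun ν hν t ht => ?_,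
    fun t ht r hr => ?_, ?_⟩
  -- One `δ` is spent on rounding the initial datum, the other on the rounding accumulated by the
  -- scheme.
  · have h1 : Real.exp (C * t) * (1 + (R + δ) + 2 * √n * (T + 1) * meshV N) ≤
        Real.exp (C * t) * (1 + R + 2 * δ) :=
      mul_le_mul_of_nonneg_left (by linarith) (Real.exp_pos _).le
    linarith
  · obtain ⟨hdν, hdν'⟩ := hd ν hν
    refine (hN.orbit_lip _ hdμ _ hdν t ht).trans ?_
    refine mul_le_mul_of_nonneg_left ?_ (Real.exp_pos _).le
    have := dist_triangle4 (discretize N 1 μ) μ ν (discretize N 1 ν)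
    rw [dist_comm ν] at this
    linarith
  · have := hN.orbit_time hA hdμ ht hr
    linarith
  · have h0 : (0 : ℝ) ∈ Icc 0 T := ⟨le_rfl, hT⟩
    have h1 := hN.orbit_iter _ hdμ 0 h0
    have e : latticeIter V s N ⌊(0 : ℝ) * N⌋₊ (discretize N 1 μ) = discretize N 1 μ := by
      simp [latticeIter]
    rw [e] at h1
    have := dist_triangle (latticeOrbit V s N (discretize N 1 μ) 0) (discretize N 1 μ) μ
    linarith

theorem exists_mem_massBall_ge (R₀ : ℝ) (μ : BMeasure (E n)) :
    ∃ (m : ℕ) (R : ℝ), 0 ≤ R ∧ R₀ ≤ R ∧ (m : ℝ) ≤ R ∧ μ ∈ massBall n m m := by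
  obtain ⟨m, hm⟩ := exists_mem_massBall μ
  exact ⟨m, max m R₀, (Nat.cast_nonneg m).trans (le_max_left _ _), le_max_right _ _,
    le_max_left _ _, hm⟩

/-- Along one sequence, the lattice approximate solutions converge for all initial data and all
times. -/
theorem exists_subseq_tendsto (H : IsRegular V s C L R₀) {T : ℝ} (hT : 0 ≤ T) :
    ∃ φ : ℕ → ℕ, StrictMono φ ∧ ∀ μ, ∀ t ∈ Icc 0 T,
      ∃ ν, Tendsto (fun k => latticeSolution V s (φ k) μ t) atTop (𝓝 ν) := by
  -- Every datum lies in one of countably many compact sets; a countable dense subset of each,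
  -- together with one of `[0, T]`, suffices for the extraction.
  choose D hDsub hDc hDd using fun m : ℕ =>
    (isCompact_massBall (n := n) m m).isSeparable.exists_countable_dense_subset
  obtain ⟨Q, hQsub, hQc, hQd⟩ :=
    (isCompact_Icc (a := (0 : ℝ)) (b := T)).isSeparable.exists_countable_dense_subset
  have hDc' : (⋃ m, D m).Countable := countable_iUnion hDc
  have _ : Countable ↥(⋃ m, D m) := hDc'.to_subtype
  have _ : Countable ↥Q := hQc.to_subtype
  have hbd : ∀ μ : BMeasure (E n), ∃ R' M' : ℝ, ∀ᶠ N in atTop, ∀ t ∈ Icc 0 T,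
      latticeSolution V s N μ t ∈ massBall n R' M' := by
    intro μ
    obtain ⟨m, R, hR, hR₀, hmR, hμ⟩ := exists_mem_massBall_ge R₀ μ
    obtain ⟨R', M', A, B, -, -, -, -, hev⟩ := H.exists_solution_bounds hR hR₀ m hT one_pos
    exact ⟨R', M', hev.mono fun N hN t ht =>
      ((hN μ (massBall_mono hmR le_rfl hμ)).1 t ht).1⟩
  choose R' M' hRM using hbd
  obtain ⟨φ, hφ, hlim⟩ := exists_subseq_tendsto_of_countable
    (ι := ↥(⋃ m, D m) × ↥Q) (fun N i => latticeSolution V s N i.1 i.2)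
    (fun i => massBall n (R' i.1) (M' i.1)) (fun i => isCompact_massBall _ _)
    (fun i => (hRM i.1).mono fun N hN => hN i.2 (hQsub i.2.2))
  refine ⟨φ, hφ, fun μ t ht => ?_⟩
  have hcauchy : CauchySeq fun k => latticeSolution V s (φ k) μ t := by
    obtain ⟨m, R, hR, hR₀, hmR, hμ⟩ := exists_mem_massBall_ge R₀ μ
    obtain ⟨_, _, A, B, -, -, hA, hB, hev⟩ := H.exists_solution_bounds hR hR₀ m hT one_pos
    -- It suffices to be eventually `ε`-close to some point: the limit for a nearby datum and time
    -- in the dense sets, by the bounds uniform in `N`.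
    have key : ∀ ε > 0, ∃ x, ∀ᶠ k in atTop, dist (latticeSolution V s (φ k) μ t) x < ε := by
      intro ε hε
      set η := ε / (4 * (Real.exp (A * t) + A + 1)) with hη
      have hη0 : 0 < η := by positivity
      obtain ⟨d, hd, hdd⟩ := Metric.mem_closure_iff.1 (hDd m hμ) η hη0
      obtain ⟨q, hq, hqd⟩ := Metric.mem_closure_iff.1 (hQd ht) η hη0
      obtain ⟨x, hx⟩ := hlim (⟨d, mem_iUnion.2 ⟨m, hd⟩⟩, ⟨q, hq⟩)
      refine ⟨x, ?_⟩
      have hmesh : Tendsto (fun k => (Real.exp (A * t) + 1) * (B * meshV (φ k))) atTop (𝓝 0) := by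
        have := ((tendsto_meshV.comp hφ.tendsto_atTop).const_mul B).const_mul
          (Real.exp (A * t) + 1)
        simpa using this
      filter_upwards [hmesh.eventually (gt_mem_nhds (show 0 < ε / 4 by positivity)),
        hφ.tendsto_atTop.eventually hev,
        (Metric.tendsto_nhds.1 hx) (ε / 4) (by positivity)] with k hk1 hk2 hk3
      obtain ⟨-, b2, -, -⟩ := hk2 μ (massBall_mono hmR le_rfl hμ)
      have hdm := massBall_mono hmR le_rfl (hDsub m hd)
      obtain ⟨-, -, b3, -⟩ := hk2 d hdm
      have c1 := b2 d hdm t ht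
      have c2 := b3 t ht q (hQsub hq)
      rw [Real.dist_eq] at hqd
      have c3 := dist_triangle4 (latticeSolution V s (φ k) μ t) (latticeSolution V s (φ k) d t)
        (latticeSolution V s (φ k) d q) x
      have c4 : Real.exp (A * t) * dist μ d ≤ Real.exp (A * t) * η := by gcongr
      have c5 : A * |t - q| ≤ A * η := by gcongr
      have c6 : (Real.exp (A * t) + A + 1) * η = ε / 4 := by
        rw [hη]; field_simp
      linarith
    rw [Metric.cauchySeq_iff]
    intro ε hε
    obtain ⟨x, hx⟩ := key (ε / 2) (half_pos hε)
    obtain ⟨k₀, hk₀⟩ := eventually_atTop.1 hx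
    refine ⟨k₀, fun i hi j hj => ?_⟩
    have := dist_triangle_right (latticeSolution V s (φ i) μ t) (latticeSolution V s (φ j) μ t) x
    linarith [hk₀ i hi, hk₀ j hj]
  -- Completeness is used only in a compact set that holds the tail of the sequence; the shift by
  -- `k₀` puts every term in it.
  obtain ⟨k₀, hk₀⟩ := eventually_atTop.1 (hφ.tendsto_atTop.eventually (hRM μ))
  obtain ⟨ν, -, hν⟩ := cauchySeq_tendsto_of_isComplete
    (isCompact_massBall (n := n) (R' μ) (M' μ)).isComplete
    (u := fun k => latticeSolution V s (φ (k + k₀)) μ t)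
    (fun k => hk₀ (k + k₀) (Nat.le_add_left _ _) t ht)
    (hcauchy.comp_tendsto (tendsto_add_atTop_nat k₀))
  exact ⟨ν, (tendsto_add_atTop_iff_nat (f := fun k => latticeSolution V s (φ k) μ t) k₀).1 hν⟩

end IsRegular

/-! ### The limit semigroup -/

/-- `S` is the pointwise limit of the lattice approximate solutions along `φ`. -/
structure IsPointwiseLimit (V : BMeasure (E n) → BMeasure (E n × E n))
    (s : BMeasure (E n) → BMeasure (E n)) (T : ℝ) (φ : ℕ → ℕ)
    (S : ℝ → BMeasure (E n) → BMeasure (E n)) : Prop where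
  strictMono : StrictMono φ
  tendsto : ∀ μ, ∀ t ∈ Icc 0 T, Tendsto (fun k => latticeSolution V s (φ k) μ t) atTop (𝓝 (S t μ))

namespace IsPointwiseLimit

variable {V : BMeasure (E n) → BMeasure (E n × E n)} {s : BMeasure (E n) → BMeasure (E n)}
  {C L R₀ T : ℝ} {φ : ℕ → ℕ} {S : ℝ → BMeasure (E n) → BMeasure (E n)}

theorem tendsto_meshV (hS : IsPointwiseLimit V s T φ S) :
    Tendsto (fun k => meshV (φ k)) atTop (𝓝 0) :=
  MDES.tendsto_meshV.comp hS.strictMono.tendsto_atTop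

/-- The bounds of the scheme pass to the limit and the mesh terms disappear. The time bound of the
approximations is kept too, since convergence uniform in time depends on it. -/
theorem exists_bounds (hS : IsPointwiseLimit V s T φ S) (H : IsRegular V s C L R₀) {R : ℝ}
    (hR : 0 ≤ R) (hR₀ : R₀ ≤ R) (M : ℝ) (hT : 0 ≤ T) {δ : ℝ} (hδ : 0 < δ) :
    ∃ R' M' A B : ℝ, 0 ≤ R' ∧ R₀ ≤ R' ∧ 0 ≤ A ∧ 0 ≤ B ∧ ∀ μ ∈ massBall n R M,
      (∀ t ∈ Icc 0 T, S t μ ∈ massBall n R' M' ∧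
        S t μ ∈ massBall n (Real.exp (C * t) * (1 + R + 2 * δ)) M') ∧
      (∀ ν ∈ massBall n R M, ∀ t ∈ Icc 0 T,
        dist (S t μ) (S t ν) ≤ Real.exp (A * t) * dist μ ν) ∧
      (∀ t ∈ Icc 0 T, ∀ r ∈ Icc 0 T, dist (S t μ) (S r μ) ≤ A * |t - r|) ∧
      (∀ᶠ k in atTop, ∀ t ∈ Icc 0 T, ∀ r ∈ Icc 0 T,
        dist (latticeSolution V s (φ k) μ t) (latticeSolution V s (φ k) μ r) ≤
          A * |t - r| + B * meshV (φ k)) ∧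
      S 0 μ = μ := by
  obtain ⟨R', M', A, B, hR', hR₀', hA, hB, hev⟩ := H.exists_solution_bounds hR hR₀ M hT hδ
  have hev' := hS.strictMono.tendsto_atTop.eventually hev
  have hmesh : Tendsto (fun k => B * meshV (φ k)) atTop (𝓝 0) := by
    simpa using hS.tendsto_meshV.const_mul B
  refine ⟨R', M', A, B, hR', hR₀', hA, hB, fun μ hμ => ⟨fun t ht => ⟨?_, ?_⟩,
    fun ν hν t ht => ?_, fun t ht r hr => ?_, ?_, ?_⟩⟩
  · exact (isCompact_massBall _ _).isClosed.mem_of_tendsto (hS.tendsto μ t ht)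
      (hev'.mono fun k hk => ((hk μ hμ).1 t ht).1)
  · exact (isCompact_massBall _ _).isClosed.mem_of_tendsto (hS.tendsto μ t ht)
      (hev'.mono fun k hk => ((hk μ hμ).1 t ht).2)
  · have h1 : Tendsto (fun k => Real.exp (A * t) * (dist μ ν + B * meshV (φ k))) atTop
        (𝓝 (Real.exp (A * t) * (dist μ ν + 0))) := (hmesh.const_add _).const_mul _
    rw [add_zero] at h1
    exact le_of_tendsto_of_tendsto ((hS.tendsto μ t ht).dist (hS.tendsto ν t ht)) h1
      (hev'.mono fun k hk => (hk μ hμ).2.1 ν hν t ht)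
  · have h1 : Tendsto (fun k => A * |t - r| + B * meshV (φ k)) atTop (𝓝 (A * |t - r| + 0)) :=
      hmesh.const_add _
    rw [add_zero] at h1
    exact le_of_tendsto_of_tendsto ((hS.tendsto μ t ht).dist (hS.tendsto μ r hr)) h1
      (hev'.mono fun k hk => (hk μ hμ).2.2.1 t ht r hr)
  · exact hev'.mono fun k hk => (hk μ hμ).2.2.1
  · refine tendsto_nhds_unique (hS.tendsto μ 0 ⟨le_rfl, hT⟩) (tendsto_iff_dist_tendsto_zero.2 ?_)
    exact squeeze_zero' (Eventually.of_forall fun k => dist_nonneg)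
      (hev'.mono fun k hk => (hk μ hμ).2.2.2) hmesh

/-- Pointwise convergence on a finite net of times becomes uniform, because the limit is Lipschitz
in time and the approximations are so up to a vanishing error. -/
theorem isLatticeLimit (hS : IsPointwiseLimit V s T φ S) (H : IsRegular V s C L R₀) (hT : 0 ≤ T) :
    IsLatticeLimit V s T S := by
  refine ⟨φ, hS.strictMono, fun μ => ?_⟩
  obtain ⟨m, R, hR, hR₀, hmR, hμ⟩ := IsRegular.exists_mem_massBall_ge R₀ μ
  obtain ⟨_, _, A, B, -, -, hA, hB, hb⟩ := hS.exists_bounds H hR hR₀ m hT one_pos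
  obtain ⟨-, -, b3, b4, -⟩ := hb μ (massBall_mono hmR le_rfl hμ)
  have hmesh : Tendsto (fun k => B * meshV (φ k)) atTop (𝓝 0) := by
    simpa using hS.tendsto_meshV.const_mul B
  rw [ENNReal.tendsto_nhds_zero]
  intro ε hε
  obtain ⟨ε', hε'0, hε'⟩ : ∃ ε' : ℝ, 0 < ε' ∧ ENNReal.ofReal ε' ≤ ε := by
    rcases eq_or_ne ε ⊤ with rfl | htop
    · exact ⟨1, one_pos, le_top⟩
    · exact ⟨ε.toReal, ENNReal.toReal_pos hε.ne' htop, (ENNReal.ofReal_toReal htop).le⟩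
  set η := ε' / (2 * (2 * A + 1)) with hη
  have hη0 : 0 < η := by positivity
  obtain ⟨F, hFsub, hFfin, hF⟩ := (isCompact_Icc (a := (0 : ℝ)) (b := T)).finite_cover_balls hη0
  have hpt : ∀ᶠ k in atTop, ∀ t ∈ F, dist (latticeSolution V s (φ k) μ t) (S t μ) < η :=
    (eventually_all_finite hFfin).2 fun t ht =>
      Metric.tendsto_nhds.1 (hS.tendsto μ t (hFsub ht)) η hη0
  filter_upwards [hpt, b4, hmesh.eventually (gt_mem_nhds (show 0 < ε' / 2 by positivity))]
    with k hk1 hk2 hk3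
  refine iSup₂_le fun t ht => le_trans ?_ hε'
  rw [gWass_eq]
  refine ENNReal.ofReal_le_ofReal ?_
  obtain ⟨q, hq, hqt⟩ := mem_iUnion₂.1 (hF ht)
  rw [Metric.mem_ball, Real.dist_eq] at hqt
  have c1 := hk2 t ht q (hFsub hq)
  have c2 := hk1 q hq
  have c3 := b3 q (hFsub hq) t ht
  have c4 := dist_triangle4 (latticeSolution V s (φ k) μ t) (latticeSolution V s (φ k) μ q)
    (S q μ) (S t μ)
  rw [abs_sub_comm] at c3
  have c5 : A * |t - q| ≤ A * η := by gcongr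
  have c6 : (2 * A + 1) * η = ε' / 2 := by
    rw [hη]; field_simp
  rw [← dist_eq_gdist]
  linarith

/-- The nodes of the lattice scheme converge to `S`. -/
theorem tendsto_iter (hS : IsPointwiseLimit V s T φ S) {R M R' M' A δ : ℝ} (hδ : 0 < δ)
    (hb : ∀ᶠ N in atTop, SchemeBounds V s C R₀ T (R + δ) M R' M' A N) {μ : BMeasure (E n)}
    (hμ : μ ∈ massBall n R M) {t : ℝ} (ht : t ∈ Icc 0 T) :
    Tendsto (fun k => latticeIter V s (φ k) ⌊t * φ k⌋₊ (discretize (φ k) 1 μ)) atTop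
      (𝓝 (S t μ)) := by
  have hmesh : Tendsto (fun k => 2 * A * meshV (φ k)) atTop (𝓝 0) := by
    simpa using hS.tendsto_meshV.const_mul (2 * A)
  refine tendsto_of_tendsto_of_dist (hS.tendsto μ t ht) (squeeze_zero'
    (Eventually.of_forall fun k => dist_nonneg) ?_ hmesh)
  filter_upwards [hS.strictMono.tendsto_atTop.eventually hb, hS.strictMono.tendsto_atTop.eventually
    (IsRegular.exists_discretize_bounds (n := n) (R := R) (M := M) hδ)] with k hk1 hk2
  rw [latticeSolution_eq]
  exact hk1.orbit_iter _ (hk2 μ hμ).1 t ht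

theorem tendsto_discretize (hS : IsPointwiseLimit V s T φ S) (μ : BMeasure (E n)) :
    Tendsto (fun k => discretize (φ k) 1 μ) atTop (𝓝 μ) := by
  obtain ⟨m, hμ⟩ := exists_mem_massBall μ
  have hmesh : Tendsto (fun k => √n * |(m : ℝ)| * meshV (φ k)) atTop (𝓝 0) := by
    simpa using hS.tendsto_meshV.const_mul (√n * |(m : ℝ)|)
  refine tendsto_iff_dist_tendsto_zero.2 (squeeze_zero'
    (Eventually.of_forall fun k => dist_nonneg) ?_ hmesh)
  filter_upwards [hS.strictMono.tendsto_atTop.eventually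
    (IsRegular.exists_discretize_bounds (n := n) (R := m) (M := m) one_pos)] with k hk
  exact (hk μ hμ).2

/-- The scheme is autonomous, so its iterates compose exactly. Two errors remain: ⌊tN⌋ + ⌊rN⌋ may
fall one step short of ⌊(t+r)N⌋, and the second run starts from the discretization of the limit at
time r instead of from the iterate; both vanish, the latter by stability in the datum. -/
theorem semigroup (hS : IsPointwiseLimit V s T φ S) (H : IsRegular V s C L R₀) {t r : ℝ}
    (ht : 0 ≤ t) (hr : 0 ≤ r) (htr : t + r ≤ T) (μ : BMeasure (E n)) :
    S (t + r) μ = S t (S r μ) := by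
  have hT : 0 ≤ T := by linarith
  have htT : t ∈ Icc 0 T := ⟨ht, by linarith⟩
  have hrT : r ∈ Icc 0 T := ⟨hr, by linarith⟩
  have htrT : t + r ∈ Icc 0 T := ⟨by linarith, htr⟩
  obtain ⟨m, R, hR, hR₀, hmR, hμ⟩ := IsRegular.exists_mem_massBall_ge R₀ μ
  replace hμ := massBall_mono hmR le_rfl hμ
  obtain ⟨R', M', A, hRR', -, hA, hb⟩ :=
    H.exists_schemeBounds (R := R + 1) (by positivity) (by linarith) m hT
  -- The second run needs bounds on a ball that contains both the iterate at time `r` and the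
  -- discretization of `S r μ`, hence the radius `R' + 1`.
  obtain ⟨R'', M'', A', -, -, hA', hb'⟩ :=
    H.exists_schemeBounds (R := R' + 1) (by linarith) (by linarith) M' hT
  have hφ := hS.strictMono.tendsto_atTop
  have hd := hφ.eventually (IsRegular.exists_discretize_bounds (n := n) (R := R) (M := m) one_pos)
  have hSr : S r μ ∈ massBall n R' M' := by
    refine (isCompact_massBall _ _).isClosed.mem_of_tendsto (hS.tendsto μ r hrT) ?_
    filter_upwards [hφ.eventually hb, hd] with k hk1 hk2
    rw [latticeSolution_eq]
    exact hk1.orbit_mem _ (hk2 μ hμ).1 r hrT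
  have hd' := hφ.eventually
    (IsRegular.exists_discretize_bounds (n := n) (R := R') (M := M') one_pos)
  have l1 := hS.tendsto_iter one_pos hb hμ htrT
  have l2 := hS.tendsto_iter one_pos hb hμ hrT
  have l3 := hS.tendsto_iter one_pos hb' hSr htT
  have l4 := hS.tendsto_discretize (S r μ)
  refine tendsto_nhds_unique l1 (tendsto_of_tendsto_of_dist l3 ?_)
  have hbound : Tendsto (fun k => Real.exp (A' * T) *
      (dist (latticeIter V s (φ k) ⌊r * φ k⌋₊ (discretize (φ k) 1 μ))
        (discretize (φ k) 1 (S r μ)) + T * A' * meshV (φ k)) + 2 * A * meshV (φ k))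
      atTop (𝓝 0) := by
    have h1 := l2.dist l4
    rw [dist_self] at h1
    have h2 := ((h1.add (hS.tendsto_meshV.const_mul (T * A'))).const_mul
      (Real.exp (A' * T))).add (hS.tendsto_meshV.const_mul (2 * A))
    simpa using h2
  refine squeeze_zero' (Eventually.of_forall fun k => dist_nonneg) ?_ hbound
  filter_upwards [hφ.eventually hb, hφ.eventually hb', hd, hd'] with k hk hk' hdk hdk'
  set N := φ k
  have hpos := hk.covers.pos
  have hv := meshV_pos hpos
  have hv1 := meshV_le_one hpos
  obtain ⟨-, -, f3, -, -⟩ := frac_bounds hpos ht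
  obtain ⟨-, -, g3, -, -⟩ := frac_bounds hpos hr
  obtain ⟨-, -, e3, e4, -⟩ := frac_bounds hpos htrT.1
  have hfl1 : ⌊t * N⌋₊ + ⌊r * N⌋₊ ≤ ⌊(t + r) * N⌋₊ := by
    refine Nat.le_floor ?_
    have h1 := Nat.floor_le (show 0 ≤ t * (N : ℝ) by positivity)
    have h2 := Nat.floor_le (show 0 ≤ r * (N : ℝ) by positivity)
    push_cast
    linarith
  have hfl2 : ⌊(t + r) * N⌋₊ ≤ ⌊t * N⌋₊ + ⌊r * N⌋₊ + 1 := by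
    have h1 := Nat.lt_floor_add_one (t * N)
    have h2 := Nat.lt_floor_add_one (r * N)
    have h3 : ⌊(t + r) * N⌋₊ < ⌊t * N⌋₊ + ⌊r * N⌋₊ + 2 := by
      rw [Nat.floor_lt (by positivity)]
      push_cast
      linarith
    omega
  obtain ⟨hdμ, -⟩ := hdk μ hμ
  obtain ⟨hdν, -⟩ := hdk' (S r μ) hSr
  set j := ⌊t * N⌋₊
  set i := ⌊r * N⌋₊
  set l := ⌊(t + r) * N⌋₊
  set a := discretize N 1 μ
  set b := discretize N 1 (S r μ)
  have q1 := hk.iter_iter a hdμ (j + i) l hfl1 (e3.trans htr)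
  have q2 : latticeIter V s N (j + i) a = latticeIter V s N j (latticeIter V s N i a) :=
    Function.iterate_add_apply _ _ _ _
  have hmem : latticeIter V s N i a ∈ massBall n (R' + 1) M' :=
    massBall_mono (by linarith) le_rfl (hk.iter_mem a hdμ i (g3.trans hrT.2))
  have q3 := hk'.iter_lip _ hmem b hdν j (f3.trans htT.2)
  have q4 : ((l : ℝ) - (j + i : ℕ)) * (A * meshV N + A * meshX N) ≤ 2 * A * meshV N := by
    have h1 : (l : ℝ) - (j + i : ℕ) ≤ 1 := by
      have : (l : ℝ) ≤ ((j + i : ℕ) : ℝ) + 1 := by exact_mod_cast hfl2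
      linarith
    have hx : meshX N ≤ meshV N := by
      rw [meshX_eq]; exact mul_le_of_le_one_left hv.le hv1
    have h2 : 0 < meshX N := meshX_pos hpos
    calc ((l : ℝ) - (j + i : ℕ)) * (A * meshV N + A * meshX N)
        ≤ 1 * (A * meshV N + A * meshX N) := by gcongr
      _ ≤ 1 * (A * meshV N + A * meshV N) := by gcongr
      _ = _ := by ring
  have q5 : Real.exp (A' * (j * meshV N)) * (dist (latticeIter V s N i a) b + j * (A' * meshX N))
      ≤ Real.exp (A' * T) * (dist (latticeIter V s N i a) b + T * A' * meshV N) := by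
    have h1 : (j : ℝ) * (A' * meshX N) ≤ T * A' * meshV N := by
      calc (j : ℝ) * (A' * meshX N) = (j * meshV N) * (A' * meshV N) := by rw [meshX_eq]; ring
        _ ≤ T * (A' * meshV N) := by gcongr; exact f3.trans htT.2
        _ = _ := by ring
    have h2 : j * meshV N ≤ T := f3.trans htT.2
    have h3 : 0 < meshX N := meshX_pos hpos
    gcongr
  have q6 := dist_triangle (latticeIter V s N l a) (latticeIter V s N (j + i) a)
    (latticeIter V s N j b)
  rw [dist_comm]
  rw [q2] at q1 q6
  linarith

theorem integral_tendsto {f : E n → ℝ} (hf : ContDiff ℝ ∞ f) (hc : HasCompactSupport f)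
    {u : ℕ → BMeasure (E n)} {μ : BMeasure (E n)} (hu : Tendsto u atTop (𝓝 μ)) :
    Tendsto (fun k => ∫ x, f x ∂(u k).toMeasure) atTop (𝓝 (∫ x, f x ∂μ.toMeasure)) := by
  obtain ⟨G, hG1, hG2, -, -⟩ := exists_bounds_of_testFunction hf hc
  rw [tendsto_iff_dist_tendsto_zero] at hu ⊢
  refine squeeze_zero (fun k => dist_nonneg) (fun k => ?_) (by simpa using hu.const_mul (G : ℝ))
  rw [Real.dist_eq]
  exact abs_integral_sub_le_gdist hG1 hG2 (u k) μ

/-- Short-time expansion of `S`, tested against `f`. -/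
theorem exists_expansion (hS : IsPointwiseLimit V s T φ S) (H : IsRegular V s C L R₀) {R : ℝ}
    (hR : 0 ≤ R) (hR₀ : R₀ ≤ R) (M : ℝ) (hT : 0 ≤ T)
    {f : E n → ℝ} (hf : ContDiff ℝ ∞ f) (hc : HasCompactSupport f) :
    ∃ B : ℝ, 0 ≤ B ∧ ∀ μ ∈ massBall n R M, ∀ t ∈ Icc 0 T,
      |∫ x, f x ∂(S t μ).toMeasure - ∫ x, f x ∂μ.toMeasure - t * weakRHS V s f μ| ≤ B * t ^ 2 := by
  obtain ⟨R', M', A, hRR', hMM', hA, hb⟩ :=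
    H.exists_schemeBounds (R := R + 1) (by positivity) (by linarith) M hT
  obtain ⟨B, hB, hcons⟩ := H.exists_consistency (T := T) (by positivity) hRR' hMM' hA hf hc
  obtain ⟨B₁, hB₁, hlip⟩ := H.abs_weakRHS_sub_le (R := R') (by linarith) hf hc
  refine ⟨B, hB, fun μ hμ t ht => ?_⟩
  have hφ := hS.strictMono.tendsto_atTop
  have hd := hφ.eventually (IsRegular.exists_discretize_bounds (n := n) (R := R) (M := M) one_pos)
  have l1 := integral_tendsto hf hc (hS.tendsto_iter one_pos hb hμ ht)
  have l2 := integral_tendsto hf hc (hS.tendsto_discretize μ)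
  have l3 : Tendsto (fun k => (⌊t * φ k⌋₊ : ℝ) * meshV (φ k)) atTop (𝓝 t) := by
    have h1 : Tendsto (fun k => t - meshV (φ k)) atTop (𝓝 (t - 0)) :=
      hS.tendsto_meshV.const_sub t
    rw [sub_zero] at h1
    refine tendsto_of_tendsto_of_tendsto_of_le_of_le' h1 tendsto_const_nhds ?_ ?_
    · filter_upwards [hφ.eventually hb] with k hk
      obtain ⟨-, -, f3, f4, -⟩ := frac_bounds hk.covers.pos ht.1
      linarith
    · filter_upwards [hφ.eventually hb] with k hk
      exact (frac_bounds hk.covers.pos ht.1).2.2.1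
  have l4 : Tendsto (fun k => weakRHS V s f (discretize (φ k) 1 μ)) atTop
      (𝓝 (weakRHS V s f μ)) := by
    have h1 := tendsto_iff_dist_tendsto_zero.1 (hS.tendsto_discretize μ)
    rw [tendsto_iff_dist_tendsto_zero]
    refine squeeze_zero' (Eventually.of_forall fun k => dist_nonneg) ?_
      (by simpa using h1.const_mul B₁)
    filter_upwards [hd] with k hk
    rw [Real.dist_eq]
    exact hlip _ _ (massBall_mono hRR' hMM' (hk μ hμ).1).1
      (massBall_mono (by linarith) hMM' hμ).1
  have l5 := ((l1.sub l2).sub (l3.mul l4)).abs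
  have l6 : Tendsto (fun k => B * (((⌊t * φ k⌋₊ : ℝ) * meshV (φ k)) ^ 2
      -- The first-order error carries an extra mesh factor, so only the quadratic term survives.
      + (⌊t * φ k⌋₊ : ℝ) * meshV (φ k) * meshV (φ k))) atTop (𝓝 (B * (t ^ 2 + t * 0))) :=
    ((l3.pow 2).add (l3.mul hS.tendsto_meshV)).const_mul B
  rw [mul_zero, add_zero] at l6
  refine le_of_tendsto_of_tendsto l5 l6 ?_
  filter_upwards [hφ.eventually hb, hd] with k hk hdk
  exact hcons (φ k) hk _ (hdk μ hμ).1 _ ((frac_bounds hk.covers.pos ht.1).2.2.1.trans ht.2)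

theorem isSolution (hS : IsPointwiseLimit V s T φ S) (H : IsRegular V s C L R₀) (hT : 0 ≤ T)
    (μ : BMeasure (E n)) : IsSolution V s T (fun t => S t μ) := by
  obtain ⟨m, R, hR, hR₀, hmR, hμ⟩ := IsRegular.exists_mem_massBall_ge R₀ μ
  replace hμ := massBall_mono hmR le_rfl hμ
  obtain ⟨R', M', A, _, hR', hR₀', hA, -, hb⟩ := hS.exists_bounds H hR hR₀ m hT one_pos
  obtain ⟨b1, -, b3, -, -⟩ := hb μ hμ
  have hmem : ∀ t ∈ Icc 0 T, S t μ ∈ massBall n R' M' := fun t ht => (b1 t ht).1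
  have hlipInt : ∀ f : E n → ℝ, ContDiff ℝ ∞ f → HasCompactSupport f →
      ∃ G : ℝ≥0, ∀ ν η : BMeasure (E n),
        |∫ x, f x ∂ν.toMeasure - ∫ x, f x ∂η.toMeasure| ≤ G * dist ν η := fun f hf hc => by
    obtain ⟨G, hG1, hG2, -, -⟩ := exists_bounds_of_testFunction hf hc
    exact ⟨G, abs_integral_sub_le_gdist hG1 hG2⟩
  constructor
  · intro t₀ ht₀
    have h1 : Tendsto (fun t => A * |t - t₀|) (𝓝[Icc 0 T] t₀) (𝓝 0) := by
      have : Tendsto (fun t => A * |t - t₀|) (𝓝 t₀) (𝓝 (A * |t₀ - t₀|)) := by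
        refine Continuous.tendsto ?_ t₀
        fun_prop
      rw [sub_self, abs_zero, mul_zero] at this
      exact this.mono_left nhdsWithin_le_nhds
    have h2 : Tendsto (fun t => dist (S t μ) (S t₀ μ)) (𝓝[Icc 0 T] t₀) (𝓝 0) :=
      squeeze_zero' (Eventually.of_forall fun t => dist_nonneg)
        (eventually_mem_nhdsWithin.mono fun t ht => b3 t ht t₀ ht₀) h1
    simp only [gWass_eq, ← dist_eq_gdist]
    simpa using ENNReal.tendsto_ofReal h2
  · intro f hf hc
    obtain ⟨G, -, -, hG3, hG4⟩ := exists_bounds_of_testFunction hf hc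
    exact ae_restrict_of_forall_mem measurableSet_Icc fun t ht =>
      H.integrable_fderiv hR' hG3 hG4 (hmem t ht).1
  · intro f hf hc
    obtain ⟨G, hG⟩ := hlipInt f hf hc
    have hl : LipschitzOnWith (G * (L.toNNReal * A.toNNReal))
        (fun t => ∫ x, f x ∂(s (S t μ)).toMeasure) (Icc 0 T) := by
      refine LipschitzOnWith.of_dist_le_mul fun t ht r hr => ?_
      rw [Real.dist_eq, Real.dist_eq]
      push_cast
      rw [Real.coe_toNNReal _ H.L_nonneg, Real.coe_toNNReal _ hA]
      refine (hG _ _).trans ?_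
      calc (G : ℝ) * dist (s (S t μ)) (s (S r μ)) ≤ G * (L * (A * |t - r|)) := by
            gcongr
            exact (H.lipSource _ _).trans (mul_le_mul_of_nonneg_left (b3 t ht r hr) H.L_nonneg)
        _ = _ := by ring
    exact hl.continuousOn.integrableOn_compact isCompact_Icc
  · intro f hf hc
    obtain ⟨G, hG⟩ := hlipInt f hf hc
    refine LipschitzOnWith.absolutelyContinuousOnInterval (K := G * A.toNNReal) ?_
    rw [uIcc_of_le hT]
    refine LipschitzOnWith.of_dist_le_mul fun t ht r hr => ?_
    rw [Real.dist_eq, Real.dist_eq]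
    push_cast
    rw [Real.coe_toNNReal _ hA]
    refine (hG _ _).trans ?_
    calc (G : ℝ) * dist (S t μ) (S r μ) ≤ G * (A * |t - r|) := by
          gcongr
          exact b3 t ht r hr
      _ = _ := by ring
  · intro f hf hc
    obtain ⟨B, hB, hexp⟩ := hS.exists_expansion H hR' hR₀' M' hT hf hc
    obtain ⟨B₁, hB₁, hlip⟩ := H.abs_weakRHS_sub_le hR' hf hc
    -- The endpoints are dropped because the derivative is two-sided and nothing is known of `S`
    -- outside `[0, T]`.
    have hIoo : ∀ᵐ t ∂volume.restrict (Icc 0 T), t ∈ Ioo 0 T := by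
      rw [Measure.restrict_congr_set Ioo_ae_eq_Icc.symm]
      exact ae_restrict_mem measurableSet_Ioo
    filter_upwards [hIoo] with t ht
    change HasDerivAt (fun t => ∫ x, f x ∂(S t μ).toMeasure) (weakRHS V s f (S t μ)) t
    -- By the semigroup law, the expansion at time 0 applies with datum `S a μ`; the constant `B` is
    -- uniform because the whole curve stays in one bounded set.
    have hforward : ∀ a b, 0 ≤ a → a ≤ b → b ≤ T →
        |∫ x, f x ∂(S b μ).toMeasure - ∫ x, f x ∂(S a μ).toMeasure
          - (b - a) * weakRHS V s f (S a μ)| ≤ B * (b - a) ^ 2 := by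
      intro a b ha hab hbT
      have := hexp (S a μ) (hmem a ⟨ha, hab.trans hbT⟩) (b - a) ⟨by linarith, by linarith⟩
      rwa [← hS.semigroup H (by linarith) ha (by linarith), sub_add_cancel] at this
    rw [hasDerivAt_iff_isLittleO_nhds_zero]
    refine Asymptotics.IsBigO.trans_isLittleO (g := fun h : ℝ => h ^ 2) ?_
      (Asymptotics.isLittleO_pow_id one_lt_two)
    refine Asymptotics.IsBigO.of_bound (B + B₁ * A) ?_
    have hev : ∀ᶠ h : ℝ in 𝓝 0, t + h ∈ Ioo 0 T := by
      have : Tendsto (fun h : ℝ => t + h) (𝓝 0) (𝓝 (t + 0)) := by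
        refine Continuous.tendsto ?_ 0
        fun_prop
      rw [add_zero] at this
      exact this.eventually (isOpen_Ioo.mem_nhds ht)
    filter_upwards [hev] with h hh
    rw [Real.norm_eq_abs, Real.norm_of_nonneg (sq_nonneg h), smul_eq_mul]
    have hBA : 0 ≤ B₁ * A * h ^ 2 := by positivity
    rcases le_total 0 h with h0 | h0
    · have := hforward t (t + h) ht.1.le (by linarith) hh.2.le
      rw [add_sub_cancel_left] at this
      linarith
    · have h1 := hforward (t + h) t hh.1.le (by linarith) ht.2.le
      have htm : t ∈ Icc 0 T := ⟨ht.1.le, ht.2.le⟩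
      have hthm : t + h ∈ Icc 0 T := ⟨hh.1.le, hh.2.le⟩
      have h2 := hlip (S (t + h) μ) (S t μ) (hmem _ hthm).1 (hmem _ htm).1
      have h3 : B₁ * dist (S (t + h) μ) (S t μ) ≤ B₁ * (A * |h|) := by
        gcongr
        simpa using b3 (t + h) hthm t htm
      have h4 : |h * (weakRHS V s f (S (t + h) μ) - weakRHS V s f (S t μ))| ≤
          B₁ * A * h ^ 2 := by
        rw [abs_mul]
        calc |h| * |weakRHS V s f (S (t + h) μ) - weakRHS V s f (S t μ)|
            ≤ |h| * (B₁ * (A * |h|)) := by gcongr; exact h2.trans h3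
          _ = B₁ * A * |h| ^ 2 := by ring
          _ = _ := by rw [sq_abs]
      -- For `h ≤ 0` only the forward expansion from `t + h` is available; its right-hand side is
      -- then moved from `t + h` to `t`, at cost `B₁ A h²`.
      have e : ∫ x, f x ∂(S (t + h) μ).toMeasure - ∫ x, f x ∂(S t μ).toMeasure
          - h * weakRHS V s f (S t μ) =
          -(∫ x, f x ∂(S t μ).toMeasure - ∫ x, f x ∂(S (t + h) μ).toMeasure
            - (t - (t + h)) * weakRHS V s f (S (t + h) μ))
          + h * (weakRHS V s f (S (t + h) μ) - weakRHS V s f (S t μ)) := by ring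
      rw [e]
      refine (abs_add_le _ _).trans ?_
      rw [abs_neg]
      have e2 : B * (t - (t + h)) ^ 2 = B * h ^ 2 := by ring
      linarith

theorem isLipschitzSemigroup (hS : IsPointwiseLimit V s T φ S) (H : IsRegular V s C L R₀)
    (hT : 0 ≤ T) : IsLipschitzSemigroup V s R₀ T S where
  zero μ := by
    obtain ⟨m, R, hR, hR₀, hmR, hμ⟩ := IsRegular.exists_mem_massBall_ge R₀ μ
    obtain ⟨_, _, _, _, -, -, -, -, hb⟩ := hS.exists_bounds H hR hR₀ m hT one_pos
    exact (hb μ (massBall_mono hmR le_rfl hμ)).2.2.2.2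
  add t r ht hr htr μ := hS.semigroup H ht hr htr μ
  solution μ := hS.isSolution H hT μ
  bounds R M hR hM := by
    -- The radius must hold the source as well. With `δ = M / 4`, `1 + 2δ` is strictly below `1 +
    -- M`, which turns the closed ball into the required open one.
    obtain ⟨R', M', A, _, -, -, hA, -, hb⟩ := hS.exists_bounds H (R := max R R₀)
      (hR.le.trans (le_max_left _ _)) (le_max_right _ _) M hT (δ := M / 4) (by positivity)
    have hC := H.C_pos
    have hmax : 0 < max R R₀ := hR.trans_le (le_max_left _ _)
    refine ⟨C + A, by positivity, fun μ ν hsupp hmass => ?_⟩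
    have hm : ∀ η : BMeasure (E n), η.supp ⊆ Metric.ball 0 R → η.mass ≤ ENNReal.ofReal M →
        η ∈ massBall n (max R R₀) M := fun η h1 h2 => by
      refine ⟨supp_subset_closedBall_iff.1 (h1.trans ((Metric.ball_subset_ball
        (le_max_left _ _)).trans Metric.ball_subset_closedBall)), ?_⟩
      rw [BMeasure.mass_eq] at h2
      exact (ENNReal.ofReal_le_ofReal_iff hM.le).1 h2
    have hμ := hm μ (subset_union_left.trans hsupp) (le_self_add.trans hmass)
    have hν := hm ν (subset_union_right.trans hsupp) (le_add_self.trans hmass)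
    obtain ⟨b1, b2, b3, -, -⟩ := hb μ hμ
    refine ⟨fun t ht => ?_, fun t ht => ?_, fun t ht r hr => ?_⟩
    · refine (supp_subset_closedBall_iff.2 (b1 t ht).2.1).trans
        (Metric.closedBall_subset_ball ?_)
      have ht0 := ht.1
      calc Real.exp (C * t) * (1 + max R R₀ + 2 * (M / 4))
          < Real.exp (C * t) * (max R R₀ + M + 1) :=
            mul_lt_mul_of_pos_left (by linarith) (Real.exp_pos _)
        _ ≤ Real.exp ((C + A) * t) * (max R R₀ + M + 1) := by gcongr; linarith
    · rw [gWass_eq, gWass_eq, ← ENNReal.ofReal_mul (Real.exp_pos _).le, ← dist_eq_gdist,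
        ← dist_eq_gdist]
      refine ENNReal.ofReal_le_ofReal ((b2 ν hν t ht).trans ?_)
      have ht0 := ht.1
      gcongr
      linarith
    · rw [gWass_eq, ← dist_eq_gdist]
      refine ENNReal.ofReal_le_ofReal ((b3 t ht r hr).trans ?_)
      gcongr
      linarith

end IsPointwiseLimit

end MDES

end

/-! ### The theorem -/

theorem theorem1 (n : ℕ)
    (V : MDES.BMeasure (MDES.E n) → MDES.BMeasure (MDES.E n × MDES.E n))
    (s : MDES.BMeasure (MDES.E n) → MDES.BMeasure (MDES.E n))
    (hV : MDES.IsPVF V)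
    (hV1 : MDES.SupportSublinear V)
    (hV2 : MDES.LocallyLipschitzPVF V)
    (hs1 : MDES.LipschitzSource s)
    (R₀ : ℝ) (hs2 : ∀ μ, (s μ).supp ⊆ Metric.ball 0 R₀)
    (T : ℝ) (hT : 0 < T) :
    ∃ S : ℝ → MDES.BMeasure (MDES.E n) → MDES.BMeasure (MDES.E n),
      MDES.IsLipschitzSemigroup V s R₀ T S ∧ MDES.IsLatticeLimit V s T S := by
  classical
  obtain ⟨C, hC, hV1⟩ := hV1
  obtain ⟨L, hL⟩ := hs1
  have H : MDES.IsRegular V s C L R₀ :=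
    { pvf := hV
      C_pos := hC
      sublinear := hV1
      locLip := hV2
      L_nonneg := L.coe_nonneg
      lipSource := fun μ ν => by
        have := hL μ ν
        rw [MDES.gWass_eq, MDES.gWass_eq, ← ENNReal.ofReal_coe_nnreal,
          ← ENNReal.ofReal_mul L.coe_nonneg, ENNReal.ofReal_le_ofReal_iff
          (mul_nonneg L.coe_nonneg (MDES.gdist_nonneg _ _))] at this
        exact this
      supp_source := fun μ =>
        MDES.supp_subset_closedBall_iff.1 ((hs2 μ).trans Metric.ball_subset_closedBall) }
  obtain ⟨φ, hφ, hlim⟩ := H.exists_subseq_tendsto hT.le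
  -- Outside `[0, T]` the values of `S` are arbitrary.
  choose! S hS using hlim
  have hS' : MDES.IsPointwiseLimit V s T φ (fun t μ => S μ t) := ⟨hφ, hS⟩
  exact ⟨_, hS'.isLipschitzSemigroup H hT.le, hS'.isLatticeLimit H hT.le⟩
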